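/- **Setting.** Let $I$ be a compact topological space with a quasi-metric $\rho$ (that is, $\rho(x,x)=0$, $\rho(x,y)>0$ for $x\ne y$, $\rho(x,y)=\rho(y,x)$, and $\rho(x,z)\le K(\rho(x,y)+\rho(y,z))$ for some $K\ge 1$) whose balls $B_\rho(x,r)$, $r>0$, form bases of neighbourhoods of the points $x \in I$. Let $m$ be a Borel measure on $I$ with $m(I)=1$, with $m(\{x\})=0$ for every $x\in I$, and doubling: there is $C>0$ with $0<m(B_\rho(x,r))<C\,m(B_\rho(x,r/2))<\infty$ for all $x\in I$, $r>0$. Put $$\beta_\rho(x,y)=\inf\{m(B): B \text{ is a } \rho\text{-ball containing } x \text{ and } y\}.$$ *Good grids.* A good grid is a sequence $\mathcal P=(\mathcal P^k)_{k\ge 0}$ of finite families of measurable sets of positive measure such that each $\mathcal P^k$ is a partition of $I$ up to null sets, each $Q\in\mathcal P^{k+1}$ is contained in some $P\in\mathcal P^k$, $\bigcup_k\mathcal P^k$ generates the $\sigma$-algebra, and there are $a,b\in(0,1)$ with $a\,m(P)\le m(Q)\le b\,m(P)$ whenever $Q\in\mathcal P^{k+1}$, $P\in\mathcal P^k$, $Q\subset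 P$. Say that $\mathcal P$ is a grid of $(I,\rho,m)$ with boundary exponent $\eta$ if there are $c_1,c_2,c_3,c_4>0$ and $\lambda\in(0,1)$ such that every $Q\in\mathcal P^k$, $k\ge1$, satisfies, with $\beta=\beta_\rho$: $B_\beta(z,c_1\lambda^k)\subset Q$ for some $z\in Q$; $\beta(x,y)\le c_2\lambda^k$ for all $x,y\in Q$; and $m\{x\in Q:\beta(x,I\setminus Q)\le c_3t\lambda^k\}\le c_4t^\eta m(Q)$ for all $t>0$. *Besov spaces.* For $p\in[1,\infty)$, $q\in[1,\infty]$, $0<s<1/p$ let $\mathcal B^s_{p,q}(\mathcal P)$ be the space of all $f\in L^p(m)$ (complex-valued) that can be written as $f=\sum_k\sum_{Q\in\mathcal P^k}c_Q\,m(Q)^{s-1/p}1_Q$, with $\sum_k\|\sum_{Q\in\mathcal P^k}c_Q\,m(Q)^{s-1/p}1_Q\|_{L^p}<\infty$ and $N(c)=\big(\sum_k(\sum_{Q\in\mathcal P^k}|c_Q|^p)^{q/p}\big)^{1/q}<\infty$ (supremum over $k$ of $(\sum_{Q\in\mathcal P^k}|c_Q|^p)^{1/p}$ if $q=\infty$),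 normed by the infimum of $N(c)$ over all such representations. The Besov space $\mathbb B^s_{p,q}$ of $(I,\rho,m)$ is $\mathcal B^s_{p,q}(\mathcal P)$ for any grid $\mathcal P$ of $(I,\rho,m)$ with a boundary exponent $\eta>sp$. **Statement.** 1. $(I,\rho,m)$ has a grid with some boundary exponent $\eta>0$ (so its Besov spaces are available for all small $s$), and $[0,1]$, with the usual metric and the Lebesgue measure, has a grid with boundary exponent $1$ (so its Besov spaces are available for all $s \in (0,1/p)$). 2. Let $p\in[1,\infty)$, $q\in[1,\infty]$ and $0<s<1/p$. For every grid $\mathcal P$ of $(I,\rho,m)$ with boundary exponent $\eta>sp$ and every grid $\mathcal G$ of $[0,1]$ with boundary exponent $\eta'>sp$, the Besov spaces $\mathcal B^s_{p,q}(\mathcal P)$ and $\mathcal B^s_{p,q}(\mathcal G)$ are isomorphic: there are a linear bijection $T$ from the first onto the second and $C>0$ with $|Tf|\le C|f|$ and $|f|\le C|Tf|$ for all $f$. That is, for small $s$ the Besov space $\mathbb B^s_{p,q}$ of $(I,\rho,m)$ is isomorphic as a Banach space to the Besov space $\mathbb B^s_{p,q}$ of $[0,1]$. -/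

import Mathlib

open MeasureTheory Set Topology
open scoped ENNReal NNReal

/-- Quasi-metrics: symmetric, vanishing exactly on the diagonal, with a relaxed triangle
inequality. -/
structure IsQuasiMetric {I : Type*} (ρ : I → I → ℝ) : Prop where
  self_eq_zero : ∀ x, ρ x x = 0
  pos_of_ne : ∀ x y, x ≠ y → 0 < ρ x y
  symm : ∀ x y, ρ x y = ρ y x
  quasi_triangle : ∃ C : ℝ, 1 ≤ C ∧ ∀ x y z, ρ x z ≤ C * (ρ x y + ρ y z)

/-- The quasi-ball with centre `x` and radius `r`. -/
def quasiBall {I : Type*} (ρ : I → I → ℝ) (x : I) (r : ℝ) : Set I := {y | ρ x y < r}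

/-- Homogeneous spaces of Coifman and Weiss: a topological space with a quasi-metric whose balls
form bases of neighbourhoods, and a doubling measure. -/
structure IsHomogeneousSpace {I : Type*} [TopologicalSpace I] [MeasurableSpace I]
    (ρ : I → I → ℝ) (m : Measure I) : Prop where
  quasiMetric : IsQuasiMetric ρ
  nhds_basis : ∀ x : I, (𝓝 x).HasBasis (fun r : ℝ => 0 < r) (fun r => quasiBall ρ x r)
  doubling : ∃ C : ℝ≥0, ∀ (x : I) (r : ℝ), 0 < r →
    0 < m (quasiBall ρ x r) ∧
    m (quasiBall ρ x r) < C * m (quasiBall ρ x (r / 2)) ∧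
    C * m (quasiBall ρ x (r / 2)) < ∞

/-- The measure quasi-metric `β(x, y) = inf {m(B) : B is a ρ-ball that contains x and y}` of a
homogeneous space. It makes the space Ahlfors regular of dimension one. -/
noncomputable def measureQuasiMetric {I : Type*} [MeasurableSpace I] (ρ : I → I → ℝ)
    (m : Measure I) (x y : I) : ℝ :=
  sInf {t : ℝ | ∃ (z : I) (r : ℝ), 0 < r ∧ x ∈ quasiBall ρ z r ∧ y ∈ quasiBall ρ z r ∧
    t = m.real (quasiBall ρ z r)}

/-- Good grids: nested finite partitions (up to null sets) into measurable sets of positive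
measure that generate the `σ`-algebra, with ratios of consecutive measures bounded away from
`0` and `1`. -/
structure GoodGrid {I : Type*} [MeasurableSpace I] (m : Measure I) where
  cells : ℕ → Finset (Set I)
  measurableSet : ∀ k, ∀ Q ∈ cells k, MeasurableSet Q
  measure_pos : ∀ k, ∀ Q ∈ cells k, 0 < m Q
  disjoint : ∀ k, ∀ Q ∈ cells k, ∀ W ∈ cells k, Q ≠ W → m (Q ∩ W) = 0
  cover : ∀ k, m (⋃ Q ∈ cells k, Q)ᶜ = 0
  nested : ∀ k, ∀ Q ∈ cells (k + 1), ∃ P ∈ cells k, Q ⊆ P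
  generates : MeasurableSpace.generateFrom {Q : Set I | ∃ k, Q ∈ cells k} = ‹MeasurableSpace I›
  ratio : ∃ a b : ℝ, 0 < a ∧ a < 1 ∧ 0 < b ∧ b < 1 ∧
    ∀ k, ∀ P ∈ cells k, ∀ Q ∈ cells (k + 1), Q ⊆ P →
      a * m.real P ≤ m.real Q ∧ m.real Q ≤ b * m.real P

namespace GoodGrid

/-- The grid is adapted to the quasi-metric `α` with boundary exponent `η`: the cells of level
`k ≥ 1` contain, and are contained in, `α`-balls of radius comparable to `lam ^ k`, and the part
of a cell close to its complement has small measure. The distance to the complement is an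
infimum in `[0, ∞]`. -/
def IsAdapted {I : Type*} [MeasurableSpace I] {m : Measure I} (P : GoodGrid m)
    (α : I → I → ℝ) (η : ℝ) : Prop :=
  ∃ c₁ c₂ c₃ c₄ lam : ℝ, 0 < c₁ ∧ 0 < c₂ ∧ 0 < c₃ ∧ 0 < c₄ ∧ 0 < lam ∧ lam < 1 ∧
    ∀ k, 1 ≤ k → ∀ Q ∈ P.cells k,
      (∃ z ∈ Q, quasiBall α z (c₁ * lam ^ k) ⊆ Q) ∧
      (∀ x ∈ Q, ∀ y ∈ Q, α x y ≤ c₂ * lam ^ k) ∧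
      (∀ t : ℝ, 0 < t →
        m {x ∈ Q | (⨅ y ∈ Qᶜ, ENNReal.ofReal (α x y)) ≤ ENNReal.ofReal (c₃ * t * lam ^ k)}
          ≤ ENNReal.ofReal (c₄ * t ^ η) * m Q)

/-- A grid of the homogeneous space `(I, ρ, m)` with boundary exponent `η`: one that is adapted
to the measure quasi-metric of the space. -/
def IsHomogeneousGrid {I : Type*} [MeasurableSpace I] {m : Measure I} (P : GoodGrid m)
    (ρ : I → I → ℝ) (η : ℝ) : Prop :=
  P.IsAdapted (measureQuasiMetric ρ m) η

section Besov

variable {I : Type*} [MeasurableSpace I] {m : Measure I} [IsFiniteMeasure m]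

/-- The canonical Souza atom `|Q|^(s - 1/p) 1_Q`, as an element of `L^p`. -/
noncomputable def atom (P : GoodGrid m) (s : ℝ) (p : ℝ≥0∞) (k : ℕ) (Q : P.cells k) :
    Lp ℂ p m :=
  indicatorConstLp p (P.measurableSet k Q.1 Q.2) (measure_ne_top m Q.1)
    ((m.real Q.1 ^ (s - 1 / p.toReal) : ℝ) : ℂ)

/-- The coefficient space `ℓ^q(ℓ^p)`, with its usual norm
`(∑ₖ (∑_{Q ∈ P^k} |c_Q|^p)^(q/p))^(1/q)` (the supremum over `k` if `q = ∞`). -/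
noncomputable abbrev Coeff (P : GoodGrid m) (p q : ℝ≥0∞) [Fact (1 ≤ p)] :=
  lp (fun k : ℕ => PiLp p (fun _ : P.cells k => ℂ)) q

/-- The block of level `k` of the series with coefficients `c`. -/
noncomputable def block (P : GoodGrid m) (s : ℝ) (p q : ℝ≥0∞) [Fact (1 ≤ p)]
    (c : P.Coeff p q) (k : ℕ) : Lp ℂ p m :=
  ∑ Q : P.cells k, c k Q • P.atom s p k Q

/-- `f = ∑ₖ ∑_{Q ∈ P^k} c_Q a_Q`, with absolute convergence in `L^p`. -/
def IsRep (P : GoodGrid m) (s : ℝ) (p q : ℝ≥0∞) [Fact (1 ≤ p)]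
    (c : P.Coeff p q) (f : Lp ℂ p m) : Prop :=
  Summable (fun k => ‖P.block s p q c k‖) ∧ HasSum (fun k => P.block s p q c k) f

variable (P : GoodGrid m) (s : ℝ) (p q : ℝ≥0∞) [Fact (1 ≤ p)]

theorem block_add (c d : P.Coeff p q) (k : ℕ) :
    P.block s p q (c + d) k = P.block s p q c k + P.block s p q d k := by
  simp [block, add_smul, Finset.sum_add_distrib]

theorem block_smul (a : ℂ) (c : P.Coeff p q) (k : ℕ) :
    P.block s p q (a • c) k = a • P.block s p q c k := by
  simp [block, mul_smul, Finset.smul_sum]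

/-- The Besov space `B^s_{p,q}(P)`: all `f` in `L^p` that have a representation with coefficients
in `ℓ^q(ℓ^p)`. -/
noncomputable def besov : Submodule ℂ (Lp ℂ p m) where
  carrier := {f | ∃ c : P.Coeff p q, P.IsRep s p q c f}
  zero_mem' := by
    have h : ∀ k, P.block s p q 0 k = 0 := fun k => by simp [block]
    refine ⟨0, ?_, ?_⟩
    · simp [h, summable_zero]
    · simp only [h]; exact hasSum_zero
  add_mem' := by
    rintro f g ⟨c, hc, hc'⟩ ⟨d, hd, hd'⟩
    refine ⟨c + d, ?_, ?_⟩
    · simp only [block_add]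
      exact Summable.of_nonneg_of_le (fun _ => norm_nonneg _) (fun _ => norm_add_le _ _)
        (hc.add hd)
    · simp only [block_add]
      exact hc'.add hd'
  smul_mem' := by
    rintro a f ⟨c, hc, hc'⟩
    refine ⟨a • c, ?_, ?_⟩
    · simp only [block_smul, norm_smul]
      exact hc.mul_left _
    · simp only [block_smul]
      exact hc'.const_smul a

/-- The Besov norm: the infimum of the `ℓ^q(ℓ^p)` norms of the coefficients over all
representations. -/
noncomputable def besovNorm [Fact (1 ≤ q)] (f : P.besov s p q) : ℝ :=
  sInf {t : ℝ | ∃ c : P.Coeff p q, P.IsRep s p q c (f : Lp ℂ p m) ∧ t = ‖c‖}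

end Besov

end GoodGrid

/-! Both Besov spaces are identified with the same space of sequences. The cells of level `k` of a
grid of a homogeneous space have measure comparable to `lam ^ k` (`HasSize`), because the measure
quasi-metric is Ahlfors regular of dimension one (`IsHomogeneousSpace.isOneRegular`,
`IsOneRegular.hasSize`). Under this size condition the martingale differences of `f` give a
representation by atoms that is optimal up to a constant. Blocks of level `j < k` have no difference
of level `k`. Blocks of level `j ≥ k` enter the weighted difference of level `k` with the factor
`lam ^ (s * (j - k))`, so a Hardy inequality (`seqNorm_geometric`) bounds the differences by the
coefficients of any representation (`stepNorm_diff_le`).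

A difference of level `k + 1` is constant on cells and has mean zero over every cell of level `k`.
Its value on one chosen child of each cell, the heir, is therefore determined by the values on the
other children, and those values are arbitrary. They serve as coordinates, with comparable norm. The
numbers of non-heirs of levels `0, ..., k` add up to the number of cells of level `k`, which is
comparable to `lam ^ (-k)`. Listed level by level, the coordinates form a sequence with an
`ℓ^q(ℓ^p)` norm over consecutive blocks of indices `n` comparable to `lam ^ (-k)`
(`exists_coordinates`). For another rate `lam'` the blocks are different, but each meets boundedly
many blocks of the other kind, so the norms are equivalent (`IsGeometricLevel.mixedNorm_le`).
Composing one coordinate map with the inverse of the other gives the isomorphism.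

Grids exist by a construction in the manner of Christ's dyadic cubes. A power of the measure
quasi-metric is comparable to a metric (`IsHomogeneousSpace.exists_metric`), and nets at geometric
scales give nested Borel partitions with inner and outer balls (`exists_nested_partition`). The
child at the centre of a cell is far from the complement of the cell, so passing one level down
removes a fixed proportion of the boundary layer; iteration gives the power law
(`IsLabelling.exists_boundary_exponent`). In the unit interval the measure quasi-metric is the usual
distance and the dyadic intervals have exponent one. -/

/-! ### Sequence norms and Schur's test. -/

/-- The `ℓ^q` norm, with values in `[0, ∞]`, of a sequence in `[0, ∞]`. -/
noncomputable def seqNorm (q : ℝ≥0∞) (u : ℕ → ℝ≥0∞) : ℝ≥0∞ :=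
  if q = ∞ then ⨆ k, u k else (∑' k, u k ^ q.toReal) ^ (1 / q.toReal)

theorem ENNReal.one_le_toReal {q : ℝ≥0∞} (h : 1 ≤ q) (hq : q ≠ ∞) : 1 ≤ q.toReal := by
  simpa using (ENNReal.toReal_le_toReal ENNReal.one_ne_top hq).2 h

theorem seqNorm_mono {q : ℝ≥0∞} {u v : ℕ → ℝ≥0∞} (h : ∀ k, u k ≤ v k) :
    seqNorm q u ≤ seqNorm q v := by
  unfold seqNorm
  split_ifs with hq
  · exact iSup_mono h
  · gcongr with k
    exact h k

theorem seqNorm_const_mul {q : ℝ≥0∞} (hq : 1 ≤ q) (a : ℝ≥0∞) (u : ℕ → ℝ≥0∞) :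
    seqNorm q (fun k => a * u k) = a * seqNorm q u := by
  unfold seqNorm
  split_ifs with h
  · rw [ENNReal.mul_iSup]
  · have hq' := ENNReal.one_le_toReal hq h
    have h0 : 0 ≤ q.toReal := by linarith
    simp only [ENNReal.mul_rpow_of_nonneg _ _ h0]
    rw [ENNReal.tsum_mul_left, ENNReal.mul_rpow_of_nonneg _ _ (by positivity), ← ENNReal.rpow_mul,
      mul_one_div_cancel (by linarith), ENNReal.rpow_one]

theorem le_seqNorm {q : ℝ≥0∞} (hq : 1 ≤ q) (u : ℕ → ℝ≥0∞) (k : ℕ) : u k ≤ seqNorm q u := by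
  unfold seqNorm
  split_ifs with h
  · exact le_iSup u k
  · have hq' := ENNReal.one_le_toReal hq h
    calc u k = (u k ^ q.toReal) ^ (1 / q.toReal) := by
          rw [← ENNReal.rpow_mul, mul_one_div_cancel (by linarith), ENNReal.rpow_one]
      _ ≤ _ := by
          gcongr
          exact ENNReal.le_tsum k

/-- Hölder's inequality for a weighted sum. -/
theorem ENNReal.tsum_mul_rpow_le {ι : Type*} [Countable ι] {q : ℝ} (hq : 1 ≤ q)
    (K u : ι → ℝ≥0∞) {A : ℝ≥0∞}
    (hK : ∑' k, K k ≤ A) : (∑' k, K k * u k) ^ q ≤ A ^ (q - 1) * ∑' k, K k * u k ^ q := by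
  rcases hq.eq_or_lt with rfl | hq1
  · simp
  let _ : MeasurableSpace ι := ⊤
  have hc := (Real.HolderConjugate.conjExponent hq1).symm
  set r := Real.conjExponent q with hr
  have hr0 : 0 < r := hc.pos
  have hq0 : 0 < q := by linarith
  have hsum : 1 / r + 1 / q = 1 := by
    have := hc.inv_add_inv_eq_one
    simpa [one_div] using this
  -- The weight is split as `K = K ^ (1 / r) * K ^ (1 / q)`, with `r` the exponent conjugate to `q`.
  have h := ENNReal.lintegral_mul_le_Lp_mul_Lq (Measure.count : Measure ι) hc
    (f := fun k => K k ^ (1 / r)) (g := fun k => K k ^ (1 / q) * u k)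
    (measurable_of_countable _).aemeasurable (measurable_of_countable _).aemeasurable
  simp only [lintegral_count, Pi.mul_apply] at h
  have e1 : ∀ k, K k ^ (1 / r) * (K k ^ (1 / q) * u k) = K k * u k := fun k => by
    rw [← mul_assoc, ← ENNReal.rpow_add_of_nonneg _ _ (by positivity) (by positivity), hsum,
      ENNReal.rpow_one]
  have e2 : ∀ k, (K k ^ (1 / r)) ^ r = K k := fun k => by
    rw [← ENNReal.rpow_mul, one_div_mul_cancel hr0.ne', ENNReal.rpow_one]
  have e3 : ∀ k, (K k ^ (1 / q) * u k) ^ q = K k * u k ^ q := fun k => by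
    rw [ENNReal.mul_rpow_of_nonneg _ _ hq0.le, ← ENNReal.rpow_mul, one_div_mul_cancel hq0.ne',
      ENNReal.rpow_one]
  simp only [e1, e2, e3] at h
  calc (∑' k, K k * u k) ^ q
      ≤ ((∑' k, K k) ^ (1 / r) * (∑' k, K k * u k ^ q) ^ (1 / q)) ^ q := by gcongr
    _ = (∑' k, K k) ^ (q - 1) * ∑' k, K k * u k ^ q := by
        rw [ENNReal.mul_rpow_of_nonneg _ _ hq0.le, ← ENNReal.rpow_mul, ← ENNReal.rpow_mul,
          one_div_mul_cancel hq0.ne', ENNReal.rpow_one]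
        congr 2
        have : 1 / r = 1 - 1 / q := by linarith
        rw [this]; field_simp
    _ ≤ _ := by gcongr

/-- Schur's test in `ℓ^q`. -/
theorem seqNorm_schur {q : ℝ≥0∞} (hq : 1 ≤ q) (K : ℕ → ℕ → ℝ≥0∞) {A : ℝ≥0∞}
    (h₁ : ∀ j, ∑' k, K j k ≤ A) (h₂ : ∀ k, ∑' j, K j k ≤ A) (u : ℕ → ℝ≥0∞) :
    seqNorm q (fun j => ∑' k, K j k * u k) ≤ A * seqNorm q u := by
  unfold seqNorm
  split_ifs with h
  · refine iSup_le fun j => ?_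
    calc ∑' k, K j k * u k ≤ ∑' k, K j k * ⨆ k, u k := by
          gcongr with k; exact le_iSup u k
      _ = (∑' k, K j k) * ⨆ k, u k := ENNReal.tsum_mul_right
      _ ≤ _ := by gcongr; exact h₁ j
  · have hq' := ENNReal.one_le_toReal hq h
    set r := q.toReal
    have hr0 : 0 < r := by linarith
    -- Hölder uses the row sums and costs `A ^ (r - 1)`; after interchanging the sums, the column
    -- sums cost one more factor `A`.
    have key : ∑' j, (∑' k, K j k * u k) ^ r ≤ A ^ r * ∑' k, u k ^ r := by
      calc ∑' j, (∑' k, K j k * u k) ^ r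
          ≤ ∑' j, A ^ (r - 1) * ∑' k, K j k * u k ^ r := by
            gcongr with j
            exact ENNReal.tsum_mul_rpow_le hq' _ _ (h₁ j)
        _ = A ^ (r - 1) * ∑' k, (∑' j, K j k) * u k ^ r := by
            rw [ENNReal.tsum_mul_left, ENNReal.tsum_comm]
            simp only [ENNReal.tsum_mul_right]
        _ ≤ A ^ (r - 1) * ∑' k, A * u k ^ r := by
            gcongr with k; exact h₂ k
        _ = _ := by
            rw [ENNReal.tsum_mul_left, ← mul_assoc]
            congr 1
            nth_rewrite 2 [← ENNReal.rpow_one A]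
            rw [← ENNReal.rpow_add_of_nonneg _ _ (by linarith) zero_le_one]
            congr 1; ring
    calc (∑' j, (∑' k, K j k * u k) ^ r) ^ (1 / r)
        ≤ (A ^ r * ∑' k, u k ^ r) ^ (1 / r) := by gcongr
      _ = _ := by
        rw [ENNReal.mul_rpow_of_nonneg _ _ (by positivity), ← ENNReal.rpow_mul,
          mul_one_div_cancel hr0.ne', ENNReal.rpow_one]

section lp

variable {E : ℕ → Type*} [∀ k, NormedAddCommGroup (E k)]

theorem seqNorm_coe_lp {q : ℝ≥0∞} (hq : 1 ≤ q) (x : lp E q) :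
    seqNorm q (fun k => ‖x k‖ₑ) = ENNReal.ofReal ‖x‖ := by
  unfold seqNorm
  split_ifs with h
  · subst h
    apply le_antisymm
    · refine iSup_le fun k => ?_
      beta_reduce
      rw [← ofReal_norm]
      exact ENNReal.ofReal_le_ofReal (lp.norm_apply_le_norm (by simp) x k)
    · rw [lp.norm_eq_ciSup]
      refine ENNReal.ofReal_le_of_le_toReal ?_
      refine ciSup_le fun k => ?_
      have hfin : ⨆ k, ‖x k‖ₑ ≠ ∞ := by
        refine ne_top_of_le_ne_top (ENNReal.ofReal_ne_top (r := ‖x‖)) (iSup_le fun k => ?_)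
        rw [← ofReal_norm]
        exact ENNReal.ofReal_le_ofReal (lp.norm_apply_le_norm (by simp) x k)
      have := (ENNReal.toReal_le_toReal (by simp) hfin).2 (le_iSup (fun k => ‖x k‖ₑ) k)
      simpa using this
  · have hq' := ENNReal.one_le_toReal hq h
    set r := q.toReal with hr
    have hr0 : 0 < r := by linarith
    rw [lp.norm_eq_tsum_rpow hr0, ← ENNReal.ofReal_rpow_of_nonneg
      (tsum_nonneg fun k => by positivity) (by positivity), ENNReal.ofReal_tsum_of_nonneg
      (fun k => by positivity) ((lp.memℓp x).summable hr0)]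
    congr 2
    ext k
    beta_reduce
    rw [← ofReal_norm, ENNReal.ofReal_rpow_of_nonneg (norm_nonneg _) hr0.le]

theorem memℓp_of_seqNorm_ne_top {q : ℝ≥0∞} (hq : 1 ≤ q) {x : ∀ k, E k}
    (h : seqNorm q (fun k => ‖x k‖ₑ) ≠ ∞) : Memℓp x q := by
  unfold seqNorm at h
  split_ifs at h with hq'
  · subst hq'
    refine memℓp_infty ⟨(⨆ k, ‖x k‖ₑ).toReal, ?_⟩
    rintro _ ⟨k, rfl⟩
    have := (ENNReal.toReal_le_toReal (by simp) h).2 (le_iSup (fun k => ‖x k‖ₑ) k)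
    simpa using this
  · have hq1 := ENNReal.one_le_toReal hq hq'
    have hr0 : 0 < q.toReal := by linarith
    refine memℓp_gen ?_
    have h2 : ∑' k, ‖x k‖ₑ ^ q.toReal ≠ ∞ := fun h3 => h (by rw [h3]; simp [hr0])
    have := ENNReal.summable_toReal h2
    refine this.congr fun k => ?_
    rw [← ENNReal.toReal_rpow]; simp

end lp

/-- Subadditivity of `t ↦ t ^ r` passes from two terms to finite sums, and then to the supremum over
finite sets. -/
theorem ENNReal.tsum_rpow_le_tsum {ι : Type*} (b : ι → ℝ≥0∞) {r : ℝ} (h0 : 0 < r) (h1 : r ≤ 1) :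
    (∑' k, b k) ^ r ≤ ∑' k, b k ^ r := by
  rw [← ENNReal.le_rpow_inv_iff h0, ENNReal.tsum_eq_iSup_sum]
  refine iSup_le fun s => ?_
  rw [ENNReal.le_rpow_inv_iff h0]
  refine le_trans ?_ (ENNReal.sum_le_tsum s)
  classical
  induction s using Finset.induction_on with
  | empty => simp [h0]
  | insert a s ha ih =>
    rw [Finset.sum_insert ha, Finset.sum_insert ha]
    exact (ENNReal.rpow_add_le_add_rpow _ _ h0.le h1).trans (by gcongr)

/-! ### Mixed norms and their independence of the rate. -/

/-- The `ℓ^p` norm of the part of a sequence where the level function equals `k`. -/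
noncomputable def levelNorm (p : ℝ≥0∞) (lev : ℕ → ℕ) (x : ℕ → ℂ) (k : ℕ) : ℝ≥0∞ :=
  (∑' n, if lev n = k then ‖x n‖ₑ ^ p.toReal else 0) ^ (1 / p.toReal)

/-- The `ℓ^q(ℓ^p)` norm of a sequence, with inner sums over the fibres of the level function. -/
noncomputable def mixedNorm (p q : ℝ≥0∞) (lev : ℕ → ℕ) (x : ℕ → ℂ) : ℝ≥0∞ :=
  seqNorm q (levelNorm p lev x)

/-- The fibre over `k` consists of indices comparable to `lam ^ (-k)`. -/
def IsGeometricLevel (lam B : ℝ) (lev : ℕ → ℕ) : Prop :=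
  ∀ n : ℕ, 1 ≤ B * ((n + 1) * lam ^ lev n) ∧ (n + 1) * lam ^ lev n ≤ B

/-- Two indices in one fibre of `lev'` differ by a factor of at most `B' ^ 2`. Since `lam ^ (-lev
n)` is comparable to `n + 1`, their `lev` values can then only differ by a bounded amount. -/
theorem IsGeometricLevel.exists_lt_add {lam lam' B B' : ℝ} {lev lev' : ℕ → ℕ} (h0 : 0 < lam)
    (h1 : lam < 1) (h0' : 0 < lam') (h : IsGeometricLevel lam B lev)
    (h' : IsGeometricLevel lam' B' lev') :
    ∃ M : ℕ, ∀ n n', lev' n = lev' n' → lev n' < lev n + M := by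
  have hB : 0 < B := by
    have := (h 0).2
    have h2 : 0 < lam ^ lev 0 := by positivity
    push_cast at this; linarith
  have hB' : 0 < B' := by
    have := (h' 0).2
    have h2 : 0 < lam' ^ lev' 0 := by positivity
    push_cast at this; linarith
  obtain ⟨M, hM⟩ := exists_pow_lt_of_lt_one (show 0 < 1 / (B ^ 2 * B' ^ 2) by positivity) h1
  refine ⟨M, fun n n' hn => ?_⟩
  by_contra! hlt
  obtain ⟨d, hd⟩ := Nat.exists_eq_add_of_le hlt
  have a1 := (h n').1
  have a2 := (h n).2
  have a3 := (h' n).1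
  have a4 := (h' n').2
  rw [← hn] at a4
  have hl : 0 < lam' ^ lev' n := by positivity
  have b1 : ((n' : ℝ) + 1) ≤ B' ^ 2 * (n + 1) := by
    have : ((n' : ℝ) + 1) * lam' ^ lev' n ≤ B' ^ 2 * (n + 1) * lam' ^ lev' n := by
      nlinarith
    exact le_of_mul_le_mul_right this hl
  have b2 : lam ^ lev n' ≤ lam ^ lev n * lam ^ M := by
    rw [hd, pow_add, pow_add]
    exact mul_le_of_le_one_right (by positivity) (pow_le_one₀ h0.le h1.le)
  have hM' : lam ^ M * (B ^ 2 * B' ^ 2) < 1 := by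
    rwa [lt_div_iff₀ (by positivity)] at hM
  have : (1 : ℝ) < 1 := by
    calc (1 : ℝ) ≤ B * ((n' + 1) * lam ^ lev n') := a1
      _ ≤ B * ((B' ^ 2 * (n + 1)) * (lam ^ lev n * lam ^ M)) := by gcongr
      _ = B * B' ^ 2 * lam ^ M * ((n + 1) * lam ^ lev n) := by ring
      _ ≤ B * B' ^ 2 * lam ^ M * B := by gcongr
      _ = lam ^ M * (B ^ 2 * B' ^ 2) := by ring
      _ < 1 := hM'
  exact lt_irrefl _ this

-- The fibres of `lev` that meet the fibre of `lev'` over `j` have levels within `M` of the level of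
-- any fixed index `n₀` in that fibre.
open Classical in
theorem tsum_level_meet_le {lev lev' : ℕ → ℕ} {M : ℕ}
    (hM : ∀ n n', lev' n = lev' n' → lev n' < lev n + M) (j : ℕ) :
    ∑' k, (if ∃ n, lev n = k ∧ lev' n = j then (1 : ℝ≥0∞) else 0) ≤ 2 * M := by
  by_cases hj : ∃ n₀, lev' n₀ = j
  · obtain ⟨n₀, hn₀⟩ := hj
    calc ∑' k, (if ∃ n, lev n = k ∧ lev' n = j then (1 : ℝ≥0∞) else 0)
        ≤ ∑' k, (if k ∈ Finset.Ico (lev n₀ - M) (lev n₀ + M) then (1 : ℝ≥0∞) else 0) := by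
          gcongr with k
          split_ifs with h1 h2 h2
          · exact le_rfl
          · obtain ⟨n, hn, hn'⟩ := h1
            have := hM n n₀ (by rw [hn', hn₀])
            have := hM n₀ n (by rw [hn', hn₀])
            exact absurd (Finset.mem_Ico.2 ⟨by omega, by omega⟩) h2
          · exact zero_le_one
          · exact le_rfl
      _ = ((Finset.Ico (lev n₀ - M) (lev n₀ + M)).card : ℝ≥0∞) := by
          rw [tsum_eq_sum (s := Finset.Ico (lev n₀ - M) (lev n₀ + M))
            (fun k hk => if_neg hk)]
          rw [Finset.sum_congr rfl fun k hk => if_pos hk]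
          simp
      _ ≤ 2 * M := by
          rw [Nat.card_Ico]
          have : lev n₀ + M - (lev n₀ - M) ≤ 2 * M := by omega
          exact_mod_cast this
  · have : ∀ k, ¬ ∃ n, lev n = k ∧ lev' n = j := fun k ⟨n, _, hn⟩ => hj ⟨n, hn⟩
    simp [this]

-- A fibre of `lev'` is covered by the fibres of `lev` that it meets. The sum over them leaves the
-- power `1 / p` by subadditivity, as `1 / p ≤ 1`. The resulting zero-one kernel is what Schur's
-- test is applied to.
open Classical in
theorem levelNorm_le_tsum {p : ℝ≥0∞} (hp : 1 ≤ p) (hp' : p ≠ ∞) (lev lev' : ℕ → ℕ) (x : ℕ → ℂ)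
    (j : ℕ) : levelNorm p lev' x j ≤
      ∑' k, (if ∃ n, lev n = k ∧ lev' n = j then (1 : ℝ≥0∞) else 0) * levelNorm p lev x k := by
  have hp1 := ENNReal.one_le_toReal hp hp'
  have hp0 : 0 < p.toReal := by linarith
  unfold levelNorm
  set a : ℕ → ℝ≥0∞ := fun n => ‖x n‖ₑ ^ p.toReal
  set K : ℕ → ℝ≥0∞ := fun k => if ∃ n, lev n = k ∧ lev' n = j then (1 : ℝ≥0∞) else 0 with hK
  have h1 : (∑' n, if lev' n = j then a n else 0) ≤
      ∑' k, K k * ∑' n, if lev n = k then a n else 0 := by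
    simp only [← ENNReal.tsum_mul_left]
    rw [ENNReal.tsum_comm]
    gcongr with n
    refine le_trans ?_ (ENNReal.le_tsum (lev n))
    by_cases hn : lev' n = j
    · have : K (lev n) = 1 := if_pos ⟨n, rfl, hn⟩
      simp [this, hn]
    · simp [hn]
  calc (∑' n, if lev' n = j then a n else 0) ^ (1 / p.toReal)
      ≤ (∑' k, K k * ∑' n, if lev n = k then a n else 0) ^ (1 / p.toReal) := by gcongr
    _ ≤ ∑' k, (K k * ∑' n, if lev n = k then a n else 0) ^ (1 / p.toReal) :=
        ENNReal.tsum_rpow_le_tsum _ (by positivity) (by rw [div_le_one hp0]; exact hp1)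
    _ = _ := by
        congr 1
        ext k
        rw [ENNReal.mul_rpow_of_nonneg _ _ (by positivity)]
        congr 1
        simp only [hK]
        split_ifs
        · simp
        · simp [hp0]

/-- Level functions of geometric growth define equivalent mixed norms, whatever their rates. -/
theorem IsGeometricLevel.mixedNorm_le {lam lam' B B' : ℝ} {lev lev' : ℕ → ℕ} (h0 : 0 < lam)
    (h1 : lam < 1) (h0' : 0 < lam') (h1' : lam' < 1) (h : IsGeometricLevel lam B lev)
    (h' : IsGeometricLevel lam' B' lev') {p q : ℝ≥0∞} (hp : 1 ≤ p) (hp' : p ≠ ∞) (hq : 1 ≤ q) :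
    ∃ M : ℝ≥0∞, M ≠ ∞ ∧ ∀ x, mixedNorm p q lev' x ≤ M * mixedNorm p q lev x := by
  classical
  obtain ⟨M, hM⟩ := h.exists_lt_add h0 h1 h0' h'
  obtain ⟨M', hM'⟩ := h'.exists_lt_add h0' h1' h0 h
  refine ⟨2 * (max M M' : ℕ), ENNReal.mul_ne_top (by simp) (by simp), fun x => ?_⟩
  refine (seqNorm_mono (levelNorm_le_tsum hp hp' lev lev' x)).trans ?_
  refine seqNorm_schur hq _ (fun j => (tsum_level_meet_le hM j).trans ?_) (fun k => ?_) _
  · gcongr; exact le_max_left _ _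
  · have := tsum_level_meet_le hM' k
    simp only [and_comm] at this ⊢
    refine this.trans ?_
    gcongr; exact le_max_right _ _

/-- A union of nonempty finite types can be enumerated level by level. -/
theorem exists_equiv_nat_sigma (D : ℕ → Type*) [∀ k, Fintype (D k)] [∀ k, Nonempty (D k)] :
    ∃ e : ℕ ≃ Σ k, D k, ∀ n, ∑ i ∈ Finset.range (e n).1, Fintype.card (D i) ≤ n ∧
      n < ∑ i ∈ Finset.range ((e n).1 + 1), Fintype.card (D i) := by
  set S : ℕ → ℕ := fun k => ∑ i ∈ Finset.range k, Fintype.card (D i) with hS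
  have hS1 : ∀ k, S (k + 1) = S k + Fintype.card (D k) := fun k => Finset.sum_range_succ _ _
  have hSm : Monotone S := monotone_nat_of_le_succ fun k => by rw [hS1]; omega
  -- Nonemptiness enters here: the partial sums are unbounded, so every `n` lies in some block.
  have hSk : ∀ k, k ≤ S k := fun k => by
    induction k with
    | zero => simp
    | succ k ih => rw [hS1]; have := Fintype.card_pos (α := D k); omega
  let g : (Σ k, D k) → ℕ := fun x => S x.1 + (Fintype.equivFin (D x.1) x.2 : ℕ)
  have hg1 : ∀ x, S x.1 ≤ g x := fun x => Nat.le_add_right _ _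
  have hg2 : ∀ x, g x < S (x.1 + 1) := fun x => by
    rw [hS1]; exact Nat.add_lt_add_left (Fintype.equivFin (D x.1) x.2).2 _
  have hinj : Function.Injective g := by
    rintro ⟨k, i⟩ ⟨k', i'⟩ h
    have hk : k = k' := by
      rcases lt_trichotomy k k' with hlt | rfl | hlt
      · have := hg2 ⟨k, i⟩; have := hg1 ⟨k', i'⟩; have := hSm (show k + 1 ≤ k' from hlt)
        simp only at *; omega
      · rfl
      · have := hg2 ⟨k', i'⟩; have := hg1 ⟨k, i⟩; have := hSm (show k' + 1 ≤ k from hlt)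
        simp only at *; omega
    subst hk
    have : (Fintype.equivFin (D k) i : ℕ) = Fintype.equivFin (D k) i' := Nat.add_left_cancel h
    rw [(Fintype.equivFin (D k)).injective (Fin.ext this)]
  have hsurj : Function.Surjective g := fun n => by
    classical
    have hex : ∃ k, n < S (k + 1) := ⟨n, hSk (n + 1)⟩
    have h1 := Nat.find_spec hex
    have h2 : S (Nat.find hex) ≤ n := by
      rcases Nat.eq_zero_or_pos (Nat.find hex) with h0 | h0
      · rw [h0]; simp [hS]
      · have := Nat.find_min hex (Nat.sub_lt h0 one_pos)
        rw [Nat.sub_add_cancel (Nat.one_le_iff_ne_zero.2 h0.ne')] at this; omega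
    set k := Nat.find hex
    rw [hS1] at h1
    refine ⟨⟨k, (Fintype.equivFin (D k)).symm ⟨n - S k, by omega⟩⟩, ?_⟩
    simp only [g, Equiv.apply_symm_apply]; omega
  refine ⟨(Equiv.ofBijective g ⟨hinj, hsurj⟩).symm, fun n => ?_⟩
  have h := (Equiv.ofBijective g ⟨hinj, hsurj⟩).apply_symm_apply n
  set x := (Equiv.ofBijective g ⟨hinj, hsurj⟩).symm n
  have h' : g x = n := h
  exact ⟨h' ▸ hg1 x, h' ▸ hg2 x⟩

/-! ### Cells, step functions and conditional expectations. -/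

namespace GoodGrid

section Structure

variable {I : Type*} [MeasurableSpace I] {m : Measure I} (P : GoodGrid m)

theorem aedisjoint_cells (k : ℕ) {Q W : P.cells k} (h : Q ≠ W) : AEDisjoint m Q.1 W.1 :=
  P.disjoint k Q.1 Q.2 W.1 W.2 fun h' => h (Subtype.ext h')

theorem cell_measure_ne_zero (k : ℕ) (Q : P.cells k) : m Q.1 ≠ 0 :=
  (P.measure_pos k Q.1 Q.2).ne'

theorem real_pos [IsFiniteMeasure m] (k : ℕ) (Q : P.cells k) : 0 < m.real Q.1 :=
  ENNReal.toReal_pos (P.cell_measure_ne_zero k Q) (measure_ne_top m _)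

/-- The cell of the previous level that contains a given cell. -/
noncomputable def parent (k : ℕ) (Q : P.cells (k + 1)) : P.cells k :=
  ⟨(P.nested k Q.1 Q.2).choose, (P.nested k Q.1 Q.2).choose_spec.1⟩

theorem subset_parent (k : ℕ) (Q : P.cells (k + 1)) : Q.1 ⊆ (P.parent k Q).1 :=
  (P.nested k Q.1 Q.2).choose_spec.2

theorem eq_of_mem_of_ae_mem (k : ℕ) : ∀ᵐ x ∂m, ∀ Q W : P.cells k, x ∈ Q.1 → x ∈ W.1 → Q = W := by
  rw [ae_all_iff]; intro Q
  rw [ae_all_iff]; intro W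
  by_cases h : Q = W
  · simp [h]
  · have : m (Q.1 ∩ W.1) = 0 := P.aedisjoint_cells k h
    filter_upwards [measure_eq_zero_iff_ae_notMem.1 this] with x hx h1 h2
    exact absurd ⟨h1, h2⟩ hx

theorem ae_exists_mem (k : ℕ) : ∀ᵐ x ∂m, ∃ Q : P.cells k, x ∈ Q.1 := by
  filter_upwards [measure_eq_zero_iff_ae_notMem.1 (P.cover k)] with x hx
  simp only [mem_compl_iff, not_not, mem_iUnion] at hx
  obtain ⟨Q, hQ, hx⟩ := hx
  exact ⟨⟨Q, hQ⟩, hx⟩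

theorem sum_restrict (k : ℕ) : ∑ Q : P.cells k, m.restrict Q.1 = m := by
  rw [← Measure.sum_fintype, ← Measure.restrict_iUnion_ae
    (fun Q W h => P.aedisjoint_cells k h)
    (fun Q => (P.measurableSet k Q.1 Q.2).nullMeasurableSet)]
  refine Measure.restrict_eq_self_of_ae_mem ?_
  filter_upwards [P.ae_exists_mem k] with x ⟨Q, hQ⟩
  exact mem_iUnion.2 ⟨Q, hQ⟩

-- A child whose chosen parent is another cell `P'` meets `W` only inside `P' ∩ W`, which is null.
open Classical in
theorem restrict_eq_sum (k : ℕ) (W : P.cells k) :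
    m.restrict W.1 = ∑ Q : P.cells (k + 1) with P.parent k Q = W, m.restrict Q.1 := by
  have h : ∀ Q : P.cells (k + 1), (m.restrict Q.1).restrict W.1 =
      if P.parent k Q = W then m.restrict Q.1 else 0 := fun Q => by
    rw [Measure.restrict_restrict (P.measurableSet k W.1 W.2)]
    split_ifs with hQ
    · rw [inter_eq_right.2 (hQ ▸ P.subset_parent k Q)]
    · rw [Measure.restrict_eq_zero]
      exact measure_mono_null (by rw [inter_comm]; gcongr; exact P.subset_parent k Q)
        (P.aedisjoint_cells k hQ)
  calc m.restrict W.1 = (∑ Q : P.cells (k + 1), m.restrict Q.1).restrict W.1 := by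
        rw [P.sum_restrict]
    _ = ∑ Q : P.cells (k + 1), (m.restrict Q.1).restrict W.1 := by
        rw [← Measure.sum_fintype, Measure.restrict_sum_of_countable, Measure.sum_fintype]
    _ = _ := by
        simp only [h]
        rw [Finset.sum_filter]

theorem lintegral_eq_sum (k : ℕ) (g : I → ℝ≥0∞) :
    ∫⁻ x, g x ∂m = ∑ Q : P.cells k, ∫⁻ x in Q.1, g x ∂m := by
  conv_lhs => rw [← P.sum_restrict k]
  rw [lintegral_finsetSum_measure]

open Classical in
theorem real_eq_sum [IsFiniteMeasure m] (k : ℕ) (W : P.cells k) :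
    m.real W.1 = ∑ Q : P.cells (k + 1) with P.parent k Q = W, m.real Q.1 := by
  have h := congrArg (fun μ : Measure I => μ univ) (P.restrict_eq_sum k W)
  simp only [Measure.restrict_apply_univ, Measure.coe_finsetSum, Finset.sum_apply] at h
  simp only [measureReal_def]
  rw [h, ENNReal.toReal_sum fun _ _ => measure_ne_top m _]

theorem sum_real (k : ℕ) [IsProbabilityMeasure m] : ∑ Q : P.cells k, m.real Q.1 = 1 := by
  have h := congrArg (fun μ : Measure I => μ univ) (P.sum_restrict k)
  simp only [Measure.restrict_apply_univ, Measure.coe_finsetSum, Finset.sum_apply,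
    measure_univ] at h
  simp only [measureReal_def]
  rw [← ENNReal.toReal_sum fun _ _ => measure_ne_top m _, h, ENNReal.toReal_one]

end Structure

section StepFunctions

variable {I : Type*} [MeasurableSpace I] {m : Measure I} [IsFiniteMeasure m] (P : GoodGrid m)
  (p : ℝ≥0∞) [hp1 : Fact (1 ≤ p)]

set_option linter.unusedSectionVars false

/-- The function that is constant on the cells of level `k`, with given values. -/
noncomputable def step (k : ℕ) : (P.cells k → ℂ) →ₗ[ℂ] Lp ℂ p m where
  toFun v := ∑ Q, v Q • indicatorConstLp p (P.measurableSet k Q.1 Q.2) (measure_ne_top m Q.1) 1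
  map_add' v w := by simp [add_smul, Finset.sum_add_distrib]
  map_smul' a v := by simp [mul_smul, Finset.smul_sum]

theorem step_ae (k : ℕ) (v : P.cells k → ℂ) :
    ∀ᵐ x ∂m, ∀ Q : P.cells k, x ∈ Q.1 → P.step p k v x = v Q := by
  have h1 := Lp.coeFn_finsetSum Finset.univ (fun Q : P.cells k =>
    v Q • indicatorConstLp p (P.measurableSet k Q.1 Q.2) (measure_ne_top m Q.1) (1 : ℂ))
  have h2 : ∀ᵐ x ∂m, ∀ Q : P.cells k,
      (v Q • indicatorConstLp p (P.measurableSet k Q.1 Q.2) (measure_ne_top m Q.1) (1 : ℂ) :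
        Lp ℂ p m) x = v Q * Q.1.indicator (fun _ => 1) x := by
    rw [ae_all_iff]; intro Q
    filter_upwards [Lp.coeFn_smul (v Q) (indicatorConstLp p (P.measurableSet k Q.1 Q.2)
      (measure_ne_top m Q.1) (1 : ℂ)), indicatorConstLp_coeFn (p := p)
      (hs := P.measurableSet k Q.1 Q.2) (hμs := measure_ne_top m Q.1) (c := (1 : ℂ))] with x h h'
    rw [h, Pi.smul_apply, h', smul_eq_mul]
  filter_upwards [h1, h2, P.eq_of_mem_of_ae_mem k] with x h1 h2 h3 Q hQ
  change (∑ Q : P.cells k, v Q • indicatorConstLp p (P.measurableSet k Q.1 Q.2)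
    (measure_ne_top m Q.1) (1 : ℂ) : Lp ℂ p m) x = v Q
  rw [h1, Finset.sum_apply, Finset.sum_congr rfl fun W _ => h2 W, Finset.sum_eq_single Q]
  · simp [hQ]
  · intro W _ hW
    have : x ∉ W.1 := fun hx => hW (h3 W Q hx hQ)
    simp [this]
  · simp

theorem step_parent (k : ℕ) (v : P.cells k → ℂ) :
    P.step p (k + 1) (v ∘ P.parent k) = P.step p k v := by
  refine Lp.ext ?_
  filter_upwards [P.step_ae p k v, P.step_ae p (k + 1) (v ∘ P.parent k),
    P.ae_exists_mem (k + 1)] with x h1 h2 ⟨Q, hQ⟩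
  rw [h2 Q hQ, h1 _ (P.subset_parent k Q hQ)]
  rfl

theorem integrable_Lp (f : Lp ℂ p m) : Integrable f m :=
  (Lp.memLp f).integrable hp1.out

/-- The mean values of a function over the cells of level `k`. -/
noncomputable def avg (k : ℕ) : Lp ℂ p m →ₗ[ℂ] (P.cells k → ℂ) where
  toFun f Q := (m.real Q.1 : ℂ)⁻¹ * ∫ x in Q.1, f x ∂m
  map_add' f g := by
    ext Q
    rw [setIntegral_congr_ae (P.measurableSet k Q.1 Q.2)
      ((Lp.coeFn_add f g).mono fun x hx _ => hx)]
    simp only [Pi.add_apply]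
    rw [integral_add (integrable_Lp p f).integrableOn (integrable_Lp p g).integrableOn, mul_add]
  map_smul' a f := by
    ext Q
    rw [setIntegral_congr_ae (P.measurableSet k Q.1 Q.2)
      ((Lp.coeFn_smul a f).mono fun x hx _ => hx)]
    simp only [Pi.smul_apply, RingHom.id_apply, smul_eq_mul]
    rw [integral_const_mul]
    ring

theorem avg_apply (k : ℕ) (f : Lp ℂ p m) (Q : P.cells k) :
    P.avg p k f Q = (m.real Q.1 : ℂ)⁻¹ * ∫ x in Q.1, f x ∂m := rfl

theorem avg_step (k : ℕ) (v : P.cells k → ℂ) : P.avg p k (P.step p k v) = v := by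
  ext Q
  rw [avg_apply, setIntegral_congr_ae (P.measurableSet k Q.1 Q.2)
    ((P.step_ae p k v).mono fun x hx => hx Q)]
  rw [setIntegral_const, Complex.real_smul, ← mul_assoc, inv_mul_cancel₀, one_mul]
  exact_mod_cast (P.real_pos k Q).ne'

theorem step_injective (k : ℕ) : Function.Injective (P.step p k) := fun v w h => by
  rw [← P.avg_step p k v, h, avg_step]

open Classical in
theorem avg_eq_sum (k : ℕ) (f : Lp ℂ p m) (W : P.cells k) :
    P.avg p k f W = (m.real W.1 : ℂ)⁻¹ *
      ∑ Q : P.cells (k + 1) with P.parent k Q = W, (m.real Q.1 : ℂ) * P.avg p (k + 1) f Q := by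
  rw [avg_apply, P.restrict_eq_sum k W,
    integral_finsetSum_measure fun Q _ => (integrable_Lp p f).integrableOn]
  congr 1
  refine Finset.sum_congr rfl fun Q _ => ?_
  rw [avg_apply, ← mul_assoc, mul_inv_cancel₀, one_mul]
  exact_mod_cast (P.real_pos (k + 1) Q).ne'

/-- The tower property: averages over a cell are weighted means of the averages over its children.
-/
theorem avg_congr_of_le {j k : ℕ} (h : j ≤ k) {f g : Lp ℂ p m}
    (hfg : P.avg p k f = P.avg p k g) : P.avg p j f = P.avg p j g := by
  induction k, h using Nat.le_induction with
  | base => exact hfg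
  | succ k _ ih =>
    refine ih ?_
    ext W
    rw [avg_eq_sum, avg_eq_sum, hfg]

/-- The conditional expectation with respect to the cells of level `k`. -/
noncomputable def cexp (k : ℕ) : Lp ℂ p m →ₗ[ℂ] Lp ℂ p m := P.step p k ∘ₗ P.avg p k

theorem cexp_apply (k : ℕ) (f : Lp ℂ p m) : P.cexp p k f = P.step p k (P.avg p k f) := rfl

theorem exists_step_of_le {j k : ℕ} (h : j ≤ k) (v : P.cells j → ℂ) :
    ∃ w : P.cells k → ℂ, P.step p j v = P.step p k w := by
  induction k, h using Nat.le_induction with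
  | base => exact ⟨v, rfl⟩
  | succ k _ ih =>
    obtain ⟨w, hw⟩ := ih
    exact ⟨_, hw.trans (P.step_parent p k w).symm⟩

theorem cexp_step {j k : ℕ} (h : j ≤ k) (v : P.cells j → ℂ) :
    P.cexp p k (P.step p j v) = P.step p j v := by
  obtain ⟨w, hw⟩ := P.exists_step_of_le p h v
  rw [hw, cexp_apply, avg_step]

theorem enorm_rpow_eq_lintegral (hp : p ≠ ∞) (f : Lp ℂ p m) :
    ‖f‖ₑ ^ p.toReal = ∫⁻ x, ‖f x‖ₑ ^ p.toReal ∂m := by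
  have hp' := ENNReal.one_le_toReal hp1.out hp
  have h0 : p ≠ 0 := (zero_lt_one.trans_le hp1.out).ne'
  rw [Lp.enorm_def, eLpNorm_eq_lintegral_rpow_enorm_toReal h0 hp, ← ENNReal.rpow_mul,
    one_div_mul_cancel (by linarith), ENNReal.rpow_one]

theorem enorm_step (hp : p ≠ ∞) (k : ℕ) (v : P.cells k → ℂ) :
    ‖P.step p k v‖ₑ ^ p.toReal = ∑ Q : P.cells k, m Q.1 * ‖v Q‖ₑ ^ p.toReal := by
  rw [enorm_rpow_eq_lintegral p hp, P.lintegral_eq_sum k]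
  refine Finset.sum_congr rfl fun Q _ => ?_
  rw [setLIntegral_congr_fun_ae (g := fun _ => ‖v Q‖ₑ ^ p.toReal) (P.measurableSet k Q.1 Q.2)
    ((P.step_ae p k v).mono fun x hx hQ => by rw [hx Q hQ]), setLIntegral_const, mul_comm]

/-- Jensen's inequality on one cell, obtained from Hölder. Summed over the cells it makes the
conditional expectation a contraction of `L^p`. -/
theorem measure_mul_enorm_avg_le (hp : p ≠ ∞) (k : ℕ) (f : Lp ℂ p m) (Q : P.cells k) :
    m Q.1 * ‖P.avg p k f Q‖ₑ ^ p.toReal ≤ ∫⁻ x in Q.1, ‖f x‖ₑ ^ p.toReal ∂m := by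
  have hp' := ENNReal.one_le_toReal hp1.out hp
  have hp0 : 0 < p.toReal := by linarith
  have h0 : p ≠ 0 := (zero_lt_one.trans_le hp1.out).ne'
  have hm0 := P.cell_measure_ne_zero k Q
  have hmt := measure_ne_top m Q.1
  have h1 : ‖∫ x in Q.1, f x ∂m‖ₑ ≤
      (∫⁻ x in Q.1, ‖f x‖ₑ ^ p.toReal ∂m) ^ (1 / p.toReal) * m Q.1 ^ (1 - 1 / p.toReal) := by
    refine (enorm_integral_le_lintegral_enorm _).trans ?_
    have := eLpNorm_le_eLpNorm_mul_rpow_measure_univ (μ := m.restrict Q.1) (p := 1) (q := p)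
      hp1.out (Lp.aestronglyMeasurable f).restrict
    rwa [eLpNorm_one_eq_lintegral_enorm, eLpNorm_eq_lintegral_rpow_enorm_toReal h0 hp,
      Measure.restrict_apply_univ, ENNReal.toReal_one, div_one] at this
  have h2 : ‖∫ x in Q.1, f x ∂m‖ₑ ^ p.toReal ≤
      (∫⁻ x in Q.1, ‖f x‖ₑ ^ p.toReal ∂m) * m Q.1 ^ (p.toReal - 1) := by
    calc _ ≤ ((∫⁻ x in Q.1, ‖f x‖ₑ ^ p.toReal ∂m) ^ (1 / p.toReal) *
          m Q.1 ^ (1 - 1 / p.toReal)) ^ p.toReal := by gcongr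
      _ = _ := by
        rw [ENNReal.mul_rpow_of_nonneg _ _ hp0.le, ← ENNReal.rpow_mul, ← ENNReal.rpow_mul,
          one_div_mul_cancel hp0.ne', ENNReal.rpow_one]
        congr 2; field_simp
  have h3 : ‖(m.real Q.1 : ℂ)⁻¹‖ₑ = (m Q.1)⁻¹ := by
    rw [enorm_inv (by exact_mod_cast (P.real_pos k Q).ne')]
    congr 1
    rw [← ofReal_norm, Complex.norm_real, Real.norm_of_nonneg measureReal_nonneg,
      measureReal_def, ENNReal.ofReal_toReal hmt]
  rw [avg_apply, enorm_mul, h3, ENNReal.mul_rpow_of_nonneg _ _ hp0.le]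
  calc m Q.1 * ((m Q.1)⁻¹ ^ p.toReal * ‖∫ x in Q.1, f x ∂m‖ₑ ^ p.toReal)
      ≤ m Q.1 * ((m Q.1)⁻¹ ^ p.toReal *
        ((∫⁻ x in Q.1, ‖f x‖ₑ ^ p.toReal ∂m) * m Q.1 ^ (p.toReal - 1))) := by gcongr
    _ = (m Q.1 * (m Q.1)⁻¹ ^ p.toReal * m Q.1 ^ (p.toReal - 1)) *
        ∫⁻ x in Q.1, ‖f x‖ₑ ^ p.toReal ∂m := by ring
    _ = _ := by
      have : m Q.1 * (m Q.1)⁻¹ ^ p.toReal * m Q.1 ^ (p.toReal - 1) = 1 := by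
        rw [ENNReal.inv_rpow, ← ENNReal.rpow_neg]
        nth_rewrite 1 [← ENNReal.rpow_one (m Q.1)]
        rw [← ENNReal.rpow_add _ _ hm0 hmt, ← ENNReal.rpow_add _ _ hm0 hmt,
          show 1 + -p.toReal + (p.toReal - 1) = 0 by ring, ENNReal.rpow_zero]
      rw [this, one_mul]

theorem enorm_cexp_le (hp : p ≠ ∞) (k : ℕ) (f : Lp ℂ p m) : ‖P.cexp p k f‖ₑ ≤ ‖f‖ₑ := by
  have hp' := ENNReal.one_le_toReal hp1.out hp
  rw [← ENNReal.rpow_le_rpow_iff (z := p.toReal) (by linarith), cexp_apply, P.enorm_step p hp,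
    enorm_rpow_eq_lintegral p hp, P.lintegral_eq_sum k]
  exact Finset.sum_le_sum fun Q _ => P.measure_mul_enorm_avg_le p hp k f Q

theorem norm_cexp_le (hp : p ≠ ∞) (k : ℕ) (f : Lp ℂ p m) : ‖P.cexp p k f‖ ≤ ‖f‖ :=
  enorm_le_iff_norm_le.1 (P.enorm_cexp_le p hp k f)

end StepFunctions

end GoodGrid

/-! ### Martingale differences. -/

namespace GoodGrid

section Differences

variable {I : Type*} [MeasurableSpace I] {m : Measure I} [IsFiniteMeasure m] (P : GoodGrid m)
  (p : ℝ≥0∞) [hp1 : Fact (1 ≤ p)]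

/-- The martingale differences of a function, as functions on the set of cells. -/
noncomputable def diff : (k : ℕ) → Lp ℂ p m →ₗ[ℂ] (P.cells k → ℂ)
  | 0 => P.avg p 0
  | k + 1 => P.avg p (k + 1) - (LinearMap.funLeft ℂ ℂ (P.parent k)) ∘ₗ P.avg p k

theorem step_diff_zero (f : Lp ℂ p m) : P.step p 0 (P.diff p 0 f) = P.cexp p 0 f := rfl

theorem step_diff_succ (k : ℕ) (f : Lp ℂ p m) :
    P.step p (k + 1) (P.diff p (k + 1) f) = P.cexp p (k + 1) f - P.cexp p k f := by
  have : P.diff p (k + 1) f = P.avg p (k + 1) f - P.avg p k f ∘ P.parent k := rfl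
  rw [this, map_sub, step_parent, cexp_apply, cexp_apply]

theorem sum_step_diff (n : ℕ) (f : Lp ℂ p m) :
    ∑ i ∈ Finset.range (n + 1), P.step p i (P.diff p i f) = P.cexp p n f := by
  induction n with
  | zero => simp [step_diff_zero]
  | succ n ih => rw [Finset.sum_range_succ, ih, step_diff_succ]; abel

theorem norm_step_diff_le (hp : p ≠ ∞) (k : ℕ) (f : Lp ℂ p m) :
    ‖P.step p k (P.diff p k f)‖ ≤ 2 * ‖f‖ := by
  cases k with
  | zero =>
    rw [step_diff_zero]
    have := P.norm_cexp_le p hp 0 f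
    have := norm_nonneg f
    linarith
  | succ k =>
    rw [step_diff_succ]
    refine (norm_sub_le _ _).trans ?_
    have := P.norm_cexp_le p hp k f
    have := P.norm_cexp_le p hp (k + 1) f
    linarith

/-- A function constant on cells of level `j` is fixed by the conditional expectations of levels `k
- 1` and `k`. -/
theorem diff_step_of_lt {j k : ℕ} (h : j < k) (v : P.cells j → ℂ) :
    P.diff p k (P.step p j v) = 0 := by
  apply P.step_injective p k
  obtain ⟨k, rfl⟩ : ∃ k', k = k' + 1 := ⟨k - 1, by omega⟩
  rw [step_diff_succ, P.cexp_step p h.le, P.cexp_step p (Nat.lt_succ_iff.1 h), sub_self, map_zero]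

theorem avg_step_diff (k : ℕ) (f : Lp ℂ p m) :
    P.avg p k (P.step p (k + 1) (P.diff p (k + 1) f)) = 0 := by
  rw [step_diff_succ, map_sub, cexp_apply, cexp_apply, avg_step, sub_eq_zero]
  exact P.avg_congr_of_le p (Nat.le_succ k) (P.avg_step p _ _)

/-- Coefficients of level `k` with mean zero over the cells of the previous level. -/
def IsMeanZero (k : ℕ) (y : P.cells k → ℂ) : Prop :=
  ∀ j, j < k → P.avg p j (P.step p k y) = 0

theorem isMeanZero_diff (k : ℕ) (f : Lp ℂ p m) : P.IsMeanZero p k (P.diff p k f) := by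
  intro j hj
  obtain ⟨k, rfl⟩ : ∃ k', k = k' + 1 := ⟨k - 1, by omega⟩
  rw [P.avg_congr_of_le p (Nat.lt_succ_iff.1 hj) (g := 0), map_zero]
  rw [avg_step_diff, map_zero]

theorem diff_step_of_gt {j k : ℕ} (h : j < k) {y : P.cells k → ℂ} (hy : P.IsMeanZero p k y) :
    P.diff p j (P.step p k y) = 0 := by
  apply P.step_injective p j
  cases j with
  | zero => rw [step_diff_zero, cexp_apply, hy 0 h]
  | succ j =>
    rw [step_diff_succ, cexp_apply, cexp_apply, hy _ h, hy j (by omega)]; simp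

theorem diff_step_self {k : ℕ} {y : P.cells k → ℂ} (hy : P.IsMeanZero p k y) :
    P.diff p k (P.step p k y) = y := by
  apply P.step_injective p k
  cases k with
  | zero => rw [step_diff_zero, cexp_step _ _ le_rfl]
  | succ j =>
    rw [step_diff_succ, cexp_step _ _ le_rfl, cexp_apply, hy j (by omega)]; simp

variable {p}

/-- The partial sums up to level `n` are fixed by the conditional expectation of level `n`, which is
a contraction. The error is thus at most twice the norm of the tail. -/
theorem tendsto_cexp (hp : p ≠ ∞) {g : ℕ → Lp ℂ p m}
    (hg : ∀ j, ∃ v, g j = P.step p j v) {f : Lp ℂ p m} (hf : HasSum g f) :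
    Filter.Tendsto (fun n => P.cexp p n f) Filter.atTop (𝓝 f) := by
  have h1 : Filter.Tendsto (fun n => 2 * ‖f - ∑ i ∈ Finset.range (n + 1), g i‖) Filter.atTop
      (𝓝 0) := by
    have := (hf.tendsto_sum_nat.comp (Filter.tendsto_add_atTop_nat 1)).const_sub f
    simpa using this.norm.const_mul 2
  rw [tendsto_iff_norm_sub_tendsto_zero]
  refine squeeze_zero (fun _ => norm_nonneg _) (fun n => ?_) h1
  set S := ∑ i ∈ Finset.range (n + 1), g i with hS
  have h2 : P.cexp p n S = S := by
    rw [hS, map_sum]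
    refine Finset.sum_congr rfl fun i hi => ?_
    obtain ⟨v, hv⟩ := hg i
    rw [hv, P.cexp_step p (by simpa [Nat.lt_succ_iff] using hi)]
  have h3 : P.cexp p n f - f = P.cexp p n (f - S) - (f - S) := by
    rw [map_sub, h2]; abel
  rw [h3]
  refine (norm_sub_le _ _).trans ?_
  have := P.norm_cexp_le p hp n (f - S)
  linarith

/-- Terms of level below `k` have no difference of level `k`, so only the tail of the series
contributes; taking a difference costs a factor `2`. -/
theorem enorm_step_diff_le (hp : p ≠ ∞) {g : ℕ → Lp ℂ p m}
    (hg : ∀ j, ∃ v, g j = P.step p j v) {f : Lp ℂ p m} (hf : HasSum g f) (k : ℕ) :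
    ‖P.step p k (P.diff p k f)‖ₑ ≤ 2 * ∑' j, if k ≤ j then ‖g j‖ₑ else 0 := by
  set S := ∑ i ∈ Finset.range k, g i with hS
  have h1 : HasSum (fun n => g (n + k)) (f - S) := (hasSum_nat_add_iff' k).2 hf
  have h2 : P.diff p k f = P.diff p k (f - S) := by
    rw [map_sub, hS, map_sum, Finset.sum_eq_zero, sub_zero]
    intro i hi
    obtain ⟨v, hv⟩ := hg i
    rw [hv, P.diff_step_of_lt p (by simpa using hi)]
  have h3 : ‖f - S‖ₑ ≤ ∑' n, ‖g (n + k)‖ₑ := by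
    rw [← h1.tsum_eq]
    exact enorm_tsum_le_tsum_enorm
  have h4 : ∑' n, ‖g (n + k)‖ₑ ≤ ∑' j, if k ≤ j then ‖g j‖ₑ else 0 := by
    calc ∑' n, ‖g (n + k)‖ₑ = ∑' n, (fun j => if k ≤ j then ‖g j‖ₑ else 0) (n + k) := by simp
      _ ≤ _ := ENNReal.tsum_comp_le_tsum_of_injective (add_left_injective k) _
  rw [h2]
  calc ‖P.step p k (P.diff p k (f - S))‖ₑ = ENNReal.ofReal ‖P.step p k (P.diff p k (f - S))‖ :=
        (ofReal_norm _).symm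
    _ ≤ ENNReal.ofReal (2 * ‖f - S‖) :=
        ENNReal.ofReal_le_ofReal (P.norm_step_diff_le p hp k (f - S))
    _ = 2 * ‖f - S‖ₑ := by
        rw [ENNReal.ofReal_mul (by norm_num), ofReal_norm]; simp
    _ ≤ _ := by gcongr; exact h3.trans h4

/-- Uniqueness of martingale expansions: every partial sum reaching level `k` already has difference
`y k`, and taking differences is continuous. -/
theorem diff_eq_of_hasSum (hp : p ≠ ∞) {y : ∀ k, P.cells k → ℂ}
    (hy : ∀ k, P.IsMeanZero p k (y k)) {f : Lp ℂ p m} (hf : HasSum (fun k => P.step p k (y k)) f)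
    (k : ℕ) : P.diff p k f = y k := by
  apply P.step_injective p k
  rw [← sub_eq_zero, ← norm_le_zero_iff]
  have h1 : Filter.Tendsto (fun n => 2 * ‖f - ∑ i ∈ Finset.range (n + (k + 1)),
      P.step p i (y i)‖) Filter.atTop (𝓝 0) := by
    have := (hf.tendsto_sum_nat.comp (Filter.tendsto_add_atTop_nat (k + 1))).const_sub f
    simpa using this.norm.const_mul 2
  refine ge_of_tendsto h1 (Filter.Eventually.of_forall fun n => ?_)
  have h2 : P.diff p k (∑ i ∈ Finset.range (n + (k + 1)), P.step p i (y i)) = y k := by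
    rw [map_sum, Finset.sum_eq_single k, P.diff_step_self p (hy k)]
    · intro i _ hi
      rcases lt_or_gt_of_ne hi with h | h
      · exact P.diff_step_of_lt p h _
      · exact P.diff_step_of_gt p h (hy i)
    · intro h; simp at h; omega
  nth_rewrite 1 [← h2]
  rw [← map_sub, ← map_sub]
  exact P.norm_step_diff_le p hp k _

end Differences

end GoodGrid

/-! ### The Besov norm in terms of martingale differences. -/

theorem PiLp.enorm_rpow_eq_sum {ι : Type*} [Fintype ι] {p : ℝ≥0∞} [hp1 : Fact (1 ≤ p)] (hp : p ≠ ∞)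
    (v : PiLp p (fun _ : ι => ℂ)) : ‖v‖ₑ ^ p.toReal = ∑ i, ‖v i‖ₑ ^ p.toReal := by
  have hp' := ENNReal.one_le_toReal hp1.out hp
  have h0 : 0 < p.toReal := by linarith
  rw [← ofReal_norm, PiLp.norm_eq_sum h0, ENNReal.ofReal_rpow_of_nonneg (by positivity) h0.le,
    ← Real.rpow_mul (by positivity), one_div_mul_cancel h0.ne', Real.rpow_one,
    ENNReal.ofReal_sum_of_nonneg fun i _ => by positivity]
  refine Finset.sum_congr rfl fun i _ => ?_
  rw [← ofReal_norm, ENNReal.ofReal_rpow_of_nonneg (norm_nonneg _) h0.le]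

/-- A discrete Hardy inequality: all rows and columns of the triangular kernel are parts of one
geometric series, so Schur's test applies. -/
theorem seqNorm_geometric {q : ℝ≥0∞} (hq : 1 ≤ q) (r : ℝ≥0∞) (u : ℕ → ℝ≥0∞) :
    seqNorm q (fun k => ∑' j, (if k ≤ j then r ^ (j - k) else 0) * u j) ≤
      (1 - r)⁻¹ * seqNorm q u := by
  refine seqNorm_schur hq _ (fun k => ?_) (fun j => ?_) u
  · have h : ∀ j, (if k ≤ j then r ^ (j - k) else 0) =
        ∑' n, if n + k = j then r ^ n else 0 := fun j => by
      split_ifs with h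
      · rw [tsum_eq_single (j - k)]
        · rw [if_pos (by omega)]
        · intro n hn; rw [if_neg (by omega)]
      · rw [ENNReal.tsum_eq_zero.2]
        intro n; rw [if_neg (by omega)]
    simp only [h]
    rw [ENNReal.tsum_comm, ← ENNReal.tsum_geometric]
    simp
  · rw [tsum_eq_sum (s := Finset.range (j + 1))
      (fun k hk => if_neg (by simp at hk; omega))]
    calc ∑ k ∈ Finset.range (j + 1), (if k ≤ j then r ^ (j - k) else 0)
        = ∑ k ∈ Finset.range (j + 1), r ^ (j + 1 - 1 - k) := by
          refine Finset.sum_congr rfl fun k hk => ?_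
          rw [if_pos (by simpa [Nat.lt_succ_iff] using hk)]; rfl
      _ = ∑ k ∈ Finset.range (j + 1), r ^ k := Finset.sum_range_reflect _ _
      _ ≤ ∑' k, r ^ k := ENNReal.sum_le_tsum _
      _ = _ := ENNReal.tsum_geometric r

namespace GoodGrid

section Size

set_option linter.unusedSectionVars false

variable {I : Type*} [MeasurableSpace I] {m : Measure I} [IsFiniteMeasure m] (P : GoodGrid m)

/-- The cells of level `k` have measure comparable to `lam ^ k`. -/
def HasSize (lam A : ℝ≥0) : Prop :=
  ∀ k, ∀ Q : P.cells k, (lam : ℝ≥0∞) ^ k ≤ A * m Q.1 ∧ m Q.1 ≤ A * (lam : ℝ≥0∞) ^ k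

variable (p q : ℝ≥0∞) [hp1 : Fact (1 ≤ p)]

theorem atom_eq_smul (s : ℝ) (k : ℕ) (Q : P.cells k) :
    P.atom s p k Q = ((m.real Q.1 ^ (s - 1 / p.toReal) : ℝ) : ℂ) •
      indicatorConstLp p (P.measurableSet k Q.1 Q.2) (measure_ne_top m Q.1) (1 : ℂ) := by
  refine Lp.ext ?_
  have h1 : P.atom s p k Q =ᵐ[m] Q.1.indicator
      (fun _ => ((m.real Q.1 ^ (s - 1 / p.toReal) : ℝ) : ℂ)) := indicatorConstLp_coeFn
  filter_upwards [h1, Lp.coeFn_smul ((m.real Q.1 ^ (s - 1 / p.toReal) : ℝ) : ℂ)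
    (indicatorConstLp p (P.measurableSet k Q.1 Q.2) (measure_ne_top m Q.1) (1 : ℂ)),
    indicatorConstLp_coeFn (p := p)
      (hs := P.measurableSet k Q.1 Q.2) (hμs := measure_ne_top m Q.1) (c := (1 : ℂ))] with x h h' h''
  rw [h, h', Pi.smul_apply, h'']
  by_cases hx : x ∈ Q.1 <;> simp [hx]

theorem block_eq_step (s : ℝ) (c : P.Coeff p q) (k : ℕ) :
    P.block s p q c k =
      P.step p k (fun Q => c k Q * ((m.real Q.1 ^ (s - 1 / p.toReal) : ℝ) : ℂ)) := by
  change _ = ∑ Q, _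
  simp only [block, atom_eq_smul, smul_smul]

theorem enorm_real_rpow (k : ℕ) (Q : P.cells k) (t : ℝ) :
    ‖((m.real Q.1 ^ t : ℝ) : ℂ)‖ₑ = m Q.1 ^ t := by
  rw [← ofReal_norm, Complex.norm_real, Real.norm_of_nonneg (by positivity),
    ← ENNReal.ofReal_rpow_of_pos (P.real_pos k Q), measureReal_def,
    ENNReal.ofReal_toReal (measure_ne_top m _)]

variable {p q} {lam A : ℝ≥0}

/-- An atom on `Q` has `L^p` norm `m(Q) ^ s`, which is at most a constant times `lam ^ (s * k)`.
`enorm_atomCoeff_le` is the converse estimate, with the lower bound for `m(Q)`. -/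
theorem enorm_block_le (hp : p ≠ ∞) (hP : P.HasSize lam A) {s : ℝ} (hs : 0 < s) (c : P.Coeff p q)
    (k : ℕ) : ‖P.block s p q c k‖ₑ ≤ (A : ℝ≥0∞) ^ s * ((lam : ℝ≥0∞) ^ s) ^ k * ‖c k‖ₑ := by
  have hp' := ENNReal.one_le_toReal hp1.out hp
  have h0 : 0 < p.toReal := by linarith
  rw [← ENNReal.rpow_le_rpow_iff h0, block_eq_step, P.enorm_step p hp,
    ENNReal.mul_rpow_of_nonneg _ _ h0.le, PiLp.enorm_rpow_eq_sum hp, Finset.mul_sum]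
  refine Finset.sum_le_sum fun Q _ => ?_
  have hm0 := P.cell_measure_ne_zero k Q
  have hmt := measure_ne_top m Q.1
  rw [enorm_mul, enorm_real_rpow, ENNReal.mul_rpow_of_nonneg _ _ h0.le, ← ENNReal.rpow_mul]
  calc m Q.1 * (‖c k Q‖ₑ ^ p.toReal * m Q.1 ^ ((s - 1 / p.toReal) * p.toReal))
      = (m Q.1 * m Q.1 ^ ((s - 1 / p.toReal) * p.toReal)) * ‖c k Q‖ₑ ^ p.toReal := by ring
    _ = (m Q.1 ^ s) ^ p.toReal * ‖c k Q‖ₑ ^ p.toReal := by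
        nth_rewrite 1 [← ENNReal.rpow_one (m Q.1)]
        rw [← ENNReal.rpow_add _ _ hm0 hmt, ← ENNReal.rpow_mul]
        congr 2; field_simp; ring
    _ ≤ ((A * (lam : ℝ≥0∞) ^ k) ^ s) ^ p.toReal * ‖c k Q‖ₑ ^ p.toReal := by
        gcongr
        exact (hP k Q).2
    _ = _ := by
        rw [ENNReal.mul_rpow_of_nonneg _ _ hs.le, ← ENNReal.rpow_natCast, ← ENNReal.rpow_natCast,
          ← ENNReal.rpow_mul, ← ENNReal.rpow_mul, mul_comm (k : ℝ) s]

/-- The coefficients, with respect to the atoms, of a function constant on the cells. -/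
noncomputable def atomCoeff (p : ℝ≥0∞) (s : ℝ) (k : ℕ) (y : P.cells k → ℂ) :
    PiLp p (fun _ : P.cells k => ℂ) :=
  WithLp.toLp p fun Q => y Q * ((m.real Q.1 ^ (1 / p.toReal - s) : ℝ) : ℂ)

theorem enorm_atomCoeff_le (hp : p ≠ ∞) (hlam : lam ≠ 0) (hA : A ≠ 0) (hP : P.HasSize lam A)
    {s : ℝ} (hs : 0 < s) (k : ℕ) (y : P.cells k → ℂ) : ‖P.atomCoeff p s k y‖ₑ ≤
      (A : ℝ≥0∞) ^ s * ((((lam : ℝ≥0∞) ^ s) ^ k)⁻¹ * ‖P.step p k y‖ₑ) := by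
  have hp' := ENNReal.one_le_toReal hp1.out hp
  have h0 : 0 < p.toReal := by linarith
  have hl : (lam : ℝ≥0∞) ≠ 0 := by simpa using hlam
  have hA' : (A : ℝ≥0∞) ≠ 0 := by simpa using hA
  rw [← mul_assoc, ← ENNReal.rpow_le_rpow_iff h0, PiLp.enorm_rpow_eq_sum hp,
    ENNReal.mul_rpow_of_nonneg _ _ h0.le, P.enorm_step p hp, Finset.mul_sum]
  refine Finset.sum_le_sum fun Q _ => ?_
  have hm0 := P.cell_measure_ne_zero k Q
  have hmt := measure_ne_top m Q.1
  change ‖y Q * _‖ₑ ^ _ ≤ _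
  rw [enorm_mul, enorm_real_rpow, ENNReal.mul_rpow_of_nonneg _ _ h0.le, ← ENNReal.rpow_mul]
  calc ‖y Q‖ₑ ^ p.toReal * m Q.1 ^ ((1 / p.toReal - s) * p.toReal)
      = ((m Q.1)⁻¹ ^ s) ^ p.toReal * (m Q.1 * ‖y Q‖ₑ ^ p.toReal) := by
        have : m Q.1 ^ ((1 / p.toReal - s) * p.toReal) =
            ((m Q.1)⁻¹ ^ s) ^ p.toReal * m Q.1 := by
          nth_rewrite 3 [← ENNReal.rpow_one (m Q.1)]
          rw [ENNReal.inv_rpow, ← ENNReal.rpow_neg, ← ENNReal.rpow_mul,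
            ← ENNReal.rpow_add _ _ hm0 hmt]
          congr 1; field_simp; ring
        rw [this]; ring
    _ ≤ ((A * ((lam : ℝ≥0∞) ^ k)⁻¹) ^ s) ^ p.toReal * (m Q.1 * ‖y Q‖ₑ ^ p.toReal) := by
        gcongr
        rw [← div_eq_mul_inv, ENNReal.le_div_iff_mul_le (Or.inl (pow_ne_zero _ hl))
          (Or.inl (by simp)), mul_comm, ← div_eq_mul_inv]
        exact ENNReal.div_le_of_le_mul (hP k Q).1
    _ = _ := by
        rw [ENNReal.mul_rpow_of_nonneg _ _ hs.le, ENNReal.inv_rpow]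
        congr 4
        rw [← ENNReal.rpow_natCast, ← ENNReal.rpow_natCast,
          ← ENNReal.rpow_mul, ← ENNReal.rpow_mul, mul_comm (k : ℝ) s]

/-- The weighted `ℓ^q(L^p)` norm of a sequence of functions constant on cells. -/
noncomputable def stepNorm (p q : ℝ≥0∞) [Fact (1 ≤ p)] (lam : ℝ≥0) (s : ℝ)
    (y : ∀ k, P.cells k → ℂ) : ℝ≥0∞ :=
  seqNorm q fun k => (((lam : ℝ≥0∞) ^ s) ^ k)⁻¹ * ‖P.step p k (y k)‖ₑ

/-- The difference of level `k` is at most twice the sum of the blocks from `k` on. Multiplying by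
`lam ^ (-s * k)` leaves the kernel `lam ^ (s * (j - k))` of the Hardy inequality. -/
theorem stepNorm_diff_le (hp : p ≠ ∞) (hq : 1 ≤ q) (hlam : lam ≠ 0)
    (hP : P.HasSize lam A) {s : ℝ} (hs : 0 < s) {c : P.Coeff p q} {f : Lp ℂ p m}
    (h : P.IsRep s p q c f) : P.stepNorm p q lam s (fun k => P.diff p k f) ≤
      2 * (A : ℝ≥0∞) ^ s * (1 - (lam : ℝ≥0∞) ^ s)⁻¹ * ENNReal.ofReal ‖c‖ := by
  have hl : (lam : ℝ≥0∞) ^ s ≠ 0 := by simp [hlam]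
  have hlt : (lam : ℝ≥0∞) ^ s ≠ ∞ := by simp [hs.le]
  set r := (lam : ℝ≥0∞) ^ s
  have h1 : ∀ k, (r ^ k)⁻¹ * ‖P.step p k (P.diff p k f)‖ₑ ≤
      2 * (A : ℝ≥0∞) ^ s * ∑' j, (if k ≤ j then r ^ (j - k) else 0) * ‖c j‖ₑ := fun k => by
    calc (r ^ k)⁻¹ * ‖P.step p k (P.diff p k f)‖ₑ
        ≤ (r ^ k)⁻¹ * (2 * ∑' j, if k ≤ j then ‖P.block s p q c j‖ₑ else 0) := by
          gcongr
          exact P.enorm_step_diff_le hp (fun j => ⟨_, P.block_eq_step p q s c j⟩) h.2 k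
      _ ≤ (r ^ k)⁻¹ * (2 * ∑' j, if k ≤ j then (A : ℝ≥0∞) ^ s * r ^ j * ‖c j‖ₑ else 0) := by
          gcongr with j
          split_ifs
          · exact P.enorm_block_le hp hP hs c j
          · exact le_rfl
      _ = (2 * (A : ℝ≥0∞) ^ s) * ((r ^ k)⁻¹ * ∑' j, if k ≤ j then r ^ j * ‖c j‖ₑ else 0) := by
          have : ∀ j, (if k ≤ j then (A : ℝ≥0∞) ^ s * r ^ j * ‖c j‖ₑ else 0) =
              (A : ℝ≥0∞) ^ s * (if k ≤ j then r ^ j * ‖c j‖ₑ else 0) := fun j => by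
            split_ifs <;> ring
          simp only [this, ENNReal.tsum_mul_left]
          ring
      _ = _ := by
          rw [← ENNReal.tsum_mul_left]
          congr 2
          ext j
          split_ifs with hj
          · obtain ⟨d, rfl⟩ := Nat.exists_eq_add_of_le hj
            rw [Nat.add_sub_cancel_left, pow_add, ← mul_assoc, ← mul_assoc,
              ENNReal.inv_mul_cancel (pow_ne_zero _ hl) (ENNReal.pow_ne_top hlt), one_mul]
          · simp
  calc P.stepNorm p q lam s (fun k => P.diff p k f)
      ≤ seqNorm q (fun k => 2 * (A : ℝ≥0∞) ^ s *
          ∑' j, (if k ≤ j then r ^ (j - k) else 0) * ‖c j‖ₑ) := seqNorm_mono h1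
    _ = 2 * (A : ℝ≥0∞) ^ s *
          seqNorm q (fun k => ∑' j, (if k ≤ j then r ^ (j - k) else 0) * ‖c j‖ₑ) :=
        seqNorm_const_mul hq _ _
    _ ≤ 2 * (A : ℝ≥0∞) ^ s * ((1 - r)⁻¹ * seqNorm q (fun k => ‖c k‖ₑ)) := by
        gcongr; exact seqNorm_geometric hq r _
    _ = _ := by rw [seqNorm_coe_lp hq]; ring

/-- Each weighted term is at most the step norm, so the unweighted series is dominated by a
geometric one with ratio `lam ^ s < 1` and converges in `L^p`. Its terms are rewritten in atoms by
`atomCoeff`. -/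
theorem exists_isRep_of_stepNorm (hp : p ≠ ∞) (hq : 1 ≤ q) (hlam : lam ≠ 0) (hlam1 : lam < 1)
    (hA : A ≠ 0) (hP : P.HasSize lam A) {s : ℝ} (hs : 0 < s) {y : ∀ k, P.cells k → ℂ}
    (hy : P.stepNorm p q lam s y ≠ ∞) : ∃ (f : Lp ℂ p m) (c : P.Coeff p q),
      HasSum (fun k => P.step p k (y k)) f ∧ P.IsRep s p q c f ∧
      ENNReal.ofReal ‖c‖ ≤ (A : ℝ≥0∞) ^ s * P.stepNorm p q lam s y := by
  have hl : (lam : ℝ≥0∞) ^ s ≠ 0 := by simp [hlam]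
  have hlt : (lam : ℝ≥0∞) ^ s ≠ ∞ := by simp [hs.le]
  have hl1 : (lam : ℝ≥0∞) ^ s < 1 := ENNReal.rpow_lt_one (by exact_mod_cast hlam1) hs
  have hAs : (A : ℝ≥0∞) ^ s ≠ ∞ := by simp [hs.le]
  have hsum : ∑' k, ‖P.step p k (y k)‖ₑ ≠ ∞ := by
    refine ne_top_of_le_ne_top (b := (1 - (lam : ℝ≥0∞) ^ s)⁻¹ * P.stepNorm p q lam s y)
      (ENNReal.mul_ne_top (ENNReal.inv_ne_top.2 (tsub_pos_of_lt hl1).ne') hy) ?_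
    rw [← ENNReal.tsum_geometric, ← ENNReal.tsum_mul_right]
    gcongr with k
    calc ‖P.step p k (y k)‖ₑ = ((lam : ℝ≥0∞) ^ s) ^ k *
          ((((lam : ℝ≥0∞) ^ s) ^ k)⁻¹ * ‖P.step p k (y k)‖ₑ) := by
          rw [← mul_assoc, ENNReal.mul_inv_cancel (pow_ne_zero _ hl) (ENNReal.pow_ne_top hlt),
            one_mul]
      _ ≤ _ := by
          gcongr
          exact le_seqNorm hq (fun k => (((lam : ℝ≥0∞) ^ s) ^ k)⁻¹ * ‖P.step p k (y k)‖ₑ) k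
  have hsum' : Summable fun k => ‖P.step p k (y k)‖ := by
    refine (ENNReal.summable_toReal hsum).congr fun k => ?_
    simp
  have hle : seqNorm q (fun k => ‖P.atomCoeff p s k (y k)‖ₑ) ≤
      (A : ℝ≥0∞) ^ s * P.stepNorm p q lam s y := by
    refine (seqNorm_mono fun k => P.enorm_atomCoeff_le hp hlam hA hP hs k (y k)).trans ?_
    rw [seqNorm_const_mul hq]; rfl
  let c : P.Coeff p q := ⟨fun k => P.atomCoeff p s k (y k),
    memℓp_of_seqNorm_ne_top hq (ne_top_of_le_ne_top (ENNReal.mul_ne_top hAs hy) hle)⟩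
  have hb : ∀ k, P.block s p q c k = P.step p k (y k) := fun k => by
    rw [block_eq_step]
    congr 1
    ext Q
    change y k Q * ((m.real Q.1 ^ (1 / p.toReal - s) : ℝ) : ℂ) * _ = _
    rw [mul_assoc, ← Complex.ofReal_mul, ← Real.rpow_add (P.real_pos k Q)]
    simp
  refine ⟨∑' k, P.step p k (y k), c, hsum'.of_norm.hasSum, ⟨?_, ?_⟩, ?_⟩
  · simpa only [hb] using hsum'
  · simpa only [hb] using hsum'.of_norm.hasSum
  · rw [← seqNorm_coe_lp hq]; exact hle

variable [hq1 : Fact (1 ≤ q)]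

theorem besovNorm_le_of_isRep {s : ℝ} (f : P.besov s p q) {c : P.Coeff p q}
    (h : P.IsRep s p q c (f : Lp ℂ p m)) : P.besovNorm s p q f ≤ ‖c‖ :=
  csInf_le ⟨0, by rintro _ ⟨c, _, rfl⟩; exact norm_nonneg c⟩ ⟨c, h, rfl⟩

theorem stepNorm_diff_le_besovNorm (hp : p ≠ ∞) (hlam : lam ≠ 0) (hlam1 : lam < 1) (hA : A ≠ 0)
    (hP : P.HasSize lam A) {s : ℝ} (hs : 0 < s) (f : P.besov s p q) :
    P.stepNorm p q lam s (fun k => P.diff p k (f : Lp ℂ p m)) ≤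
      2 * (A : ℝ≥0∞) ^ s * (1 - (lam : ℝ≥0∞) ^ s)⁻¹ * ENNReal.ofReal (P.besovNorm s p q f) := by
  set M := 2 * (A : ℝ≥0∞) ^ s * (1 - (lam : ℝ≥0∞) ^ s)⁻¹ with hM
  have hl1 : (lam : ℝ≥0∞) ^ s < 1 := ENNReal.rpow_lt_one (by exact_mod_cast hlam1) hs
  have hMt : M ≠ ∞ := ENNReal.mul_ne_top (ENNReal.mul_ne_top (by simp) (by simp [hs.le]))
    (ENNReal.inv_ne_top.2 (tsub_pos_of_lt hl1).ne')
  set N := P.stepNorm p q lam s (fun k => P.diff p k (f : Lp ℂ p m))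
  have hc : ∀ c : P.Coeff p q, P.IsRep s p q c (f : Lp ℂ p m) → N ≤ M * ENNReal.ofReal ‖c‖ :=
    fun c h => P.stepNorm_diff_le hp hq1.out hlam hP hs h
  obtain ⟨c₀, hc₀⟩ := f.2
  have hN : N ≠ ∞ := ne_top_of_le_ne_top (ENNReal.mul_ne_top hMt ENNReal.ofReal_ne_top) (hc c₀ hc₀)
  -- A nonzero constant permits division, after which the bound passes to the infimum over all
  -- representations.
  have hM0 : 0 < M.toReal := ENNReal.toReal_pos (by
    refine mul_ne_zero (mul_ne_zero two_ne_zero ?_) ?_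
    · simp [hA]
    · simp) hMt
  have hle : N.toReal / M.toReal ≤ P.besovNorm s p q f := by
    refine le_csInf ⟨_, c₀, hc₀, rfl⟩ ?_
    rintro _ ⟨c, h, rfl⟩
    rw [div_le_iff₀' hM0]
    have := ENNReal.toReal_mono (ENNReal.mul_ne_top hMt ENNReal.ofReal_ne_top) (hc c h)
    rwa [ENNReal.toReal_mul, ENNReal.toReal_ofReal (norm_nonneg _)] at this
  rw [div_le_iff₀' hM0] at hle
  calc N = ENNReal.ofReal N.toReal := (ENNReal.ofReal_toReal hN).symm
    _ ≤ ENNReal.ofReal (M.toReal * P.besovNorm s p q f) := ENNReal.ofReal_le_ofReal hle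
    _ = _ := by rw [ENNReal.ofReal_mul hM0.le, ENNReal.ofReal_toReal hMt]

end Size

end GoodGrid

/-! ### Heirs and free cells. -/

namespace GoodGrid

section Heirs

variable {I : Type*} [MeasurableSpace I] {m : Measure I} [IsFiniteMeasure m] (P : GoodGrid m)

theorem exists_parent_eq (k : ℕ) (W : P.cells k) : ∃ Q, P.parent k Q = W := by
  classical
  by_contra! h
  have h1 := P.real_eq_sum k W
  rw [Finset.filter_false_of_mem fun Q _ => h Q, Finset.sum_empty] at h1
  exact (P.real_pos k W).ne' h1

/-- A distinguished child of a cell. -/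
noncomputable def heir (k : ℕ) (W : P.cells k) : P.cells (k + 1) := (P.exists_parent_eq k W).choose

theorem parent_heir (k : ℕ) (W : P.cells k) : P.parent k (P.heir k W) = W :=
  (P.exists_parent_eq k W).choose_spec

/-- The cells that are the distinguished child of their parent. -/
def IsHeir : (k : ℕ) → P.cells k → Prop
  | 0, _ => False
  | k + 1, Q => Q = P.heir k (P.parent k Q)

/-- The cells that are not distinguished: they index the coordinates of level `k`. -/
abbrev Free (k : ℕ) := {Q : P.cells k // ¬ P.IsHeir k Q}

noncomputable instance (k : ℕ) : Fintype (P.Free k) := by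
  classical exact inferInstance

theorem isHeir_heir (k : ℕ) (W : P.cells k) : P.IsHeir (k + 1) (P.heir k W) := by
  change _ = _
  rw [parent_heir]

open Classical in
/-- The children of a cell other than the distinguished one. -/
noncomputable def cadets (k : ℕ) (W : P.cells k) : Finset (P.cells (k + 1)) :=
  Finset.univ.filter fun Q => ¬ P.IsHeir (k + 1) Q ∧ P.parent k Q = W

open Classical in
theorem children_eq_insert (k : ℕ) (W : P.cells k) :
    (Finset.univ.filter fun Q => P.parent k Q = W) = insert (P.heir k W) (P.cadets k W) := by
  ext Q
  simp only [cadets, Finset.mem_filter, Finset.mem_univ, true_and, Finset.mem_insert]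
  constructor
  · rintro rfl
    by_cases h : P.IsHeir (k + 1) Q
    · exact Or.inl h
    · exact Or.inr ⟨h, rfl⟩
  · rintro (rfl | h)
    · exact P.parent_heir k W
    · exact h.2

theorem heir_notMem_cadets (k : ℕ) (W : P.cells k) : P.heir k W ∉ P.cadets k W := by
  classical
  simp [cadets, P.isHeir_heir k W]

theorem sum_eq_sum_heir_add {M : Type*} [AddCommMonoid M] (k : ℕ) (g : P.cells (k + 1) → M) :
    ∑ Q, g Q = ∑ W, g (P.heir k W) + ∑ Q : P.Free (k + 1), g Q.1 := by
  classical
  rw [← Finset.sum_fiberwise (s := Finset.univ) (g := P.parent k) (f := g)]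
  have h : ∀ W, ∑ Q with P.parent k Q = W, g Q = g (P.heir k W) + ∑ Q ∈ P.cadets k W, g Q :=
    fun W => by
      rw [children_eq_insert, Finset.sum_insert (P.heir_notMem_cadets k W)]
  rw [Finset.sum_congr rfl fun W _ => h W, Finset.sum_add_distrib]
  congr 1
  rw [← Finset.sum_subtype (Finset.univ.filter fun Q => ¬ P.IsHeir (k + 1) Q) (by simp) g,
    ← Finset.sum_fiberwise (g := P.parent k)]
  refine Finset.sum_congr rfl fun W _ => ?_
  rw [Finset.filter_filter]
  rfl

/-- Each cell of level `k` has exactly one heir, so the free cells of level `k + 1` account for the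
increase in the number of cells, and the sum telescopes. All cells of level `0` are free. -/
theorem sum_card_free (k : ℕ) :
    ∑ i ∈ Finset.range (k + 1), Fintype.card (P.Free i) = Fintype.card (P.cells k) := by
  induction k with
  | zero =>
    simp only [zero_add, Finset.range_one, Finset.sum_singleton]
    exact Fintype.card_congr (Equiv.subtypeUnivEquiv fun Q => fun h => h)
  | succ k ih =>
    rw [Finset.sum_range_succ, ih]
    have h := P.sum_eq_sum_heir_add k (fun _ => 1)
    simpa using h.symm

theorem nonempty_cells [IsProbabilityMeasure m] (k : ℕ) : Nonempty (P.cells k) := by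
  by_contra h
  rw [not_nonempty_iff] at h
  have := P.sum_real k
  simp at this

/-- The upper ratio `b < 1` prevents a single child from carrying the full measure of its parent. -/
instance [IsProbabilityMeasure m] (k : ℕ) : Nonempty (P.Free k) := by
  cases k with
  | zero => exact ⟨⟨(P.nonempty_cells 0).some, fun h => h⟩⟩
  | succ k =>
    classical
    let W := (P.nonempty_cells k).some
    obtain ⟨a, b, -, -, -, hb, h⟩ := P.ratio
    have h1 := (h k W.1 W.2 (P.heir k W).1 (P.heir k W).2 (by
      have := P.subset_parent k (P.heir k W)
      rwa [parent_heir] at this)).2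
    have h2 := P.real_pos k W
    have h3 : P.cadets k W ≠ ∅ := fun h0 => by
      have := P.real_eq_sum k W
      rw [children_eq_insert, h0] at this
      simp only [insert_empty_eq, Finset.sum_singleton] at this
      nlinarith
    obtain ⟨Q, hQ⟩ := Finset.nonempty_iff_ne_empty.2 h3
    exact ⟨⟨Q, (Finset.mem_filter.1 hQ).2.1⟩⟩

end Heirs

section Coordinates

set_option linter.unusedSectionVars false

variable {I : Type*} [MeasurableSpace I] {m : Measure I} [IsFiniteMeasure m] (P : GoodGrid m)
  {p q : ℝ≥0∞} [hp1 : Fact (1 ≤ p)] {lam A : ℝ≥0}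

theorem isMeanZero_zero (y : P.cells 0 → ℂ) : P.IsMeanZero p 0 y := fun _ h => absurd h (by simp)

theorem isMeanZero_succ_iff (k : ℕ) (y : P.cells (k + 1) → ℂ) :
    P.IsMeanZero p (k + 1) y ↔ ∀ W, (m.real (P.heir k W).1 : ℂ) * y (P.heir k W) +
      ∑ Q ∈ P.cadets k W, (m.real Q.1 : ℂ) * y Q = 0 := by
  classical
  have h : ∀ W, P.avg p k (P.step p (k + 1) y) W = (m.real W.1 : ℂ)⁻¹ *
      ((m.real (P.heir k W).1 : ℂ) * y (P.heir k W) +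
        ∑ Q ∈ P.cadets k W, (m.real Q.1 : ℂ) * y Q) := fun W => by
    rw [avg_eq_sum, children_eq_insert, Finset.sum_insert (P.heir_notMem_cadets k W), avg_step]
  constructor
  · intro hy W
    have := h W
    rw [hy k (Nat.lt_succ_self k), Pi.zero_apply, eq_comm, mul_eq_zero, inv_eq_zero] at this
    exact this.resolve_left (by exact_mod_cast (P.real_pos k W).ne')
  · intro hy j hj
    rw [P.avg_congr_of_le p (Nat.lt_succ_iff.1 hj) (g := 0), map_zero]
    ext W
    rw [h, hy W, map_zero]; simp

open Classical in
/-- The mean zero coefficients with given values on the free cells. -/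
noncomputable def extend : (k : ℕ) → (P.Free k → ℂ) → P.cells k → ℂ
  | 0, z => fun Q => z ⟨Q, fun h => h⟩
  | k + 1, z => fun Q =>
    if h : P.IsHeir (k + 1) Q then
      -(m.real Q.1 : ℂ)⁻¹ * ∑ Q' ∈ P.cadets k (P.parent k Q), (m.real Q'.1 : ℂ) *
        (if h' : P.IsHeir (k + 1) Q' then 0 else z ⟨Q', h'⟩)
    else z ⟨Q, h⟩

theorem extend_free (k : ℕ) (z : P.Free k → ℂ) (Q : P.Free k) : P.extend k z Q.1 = z Q := by
  cases k with
  | zero => rfl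
  | succ k => simp [extend, Q.2]

theorem isMeanZero_extend (k : ℕ) (z : P.Free k → ℂ) : P.IsMeanZero p k (P.extend k z) := by
  cases k with
  | zero => exact P.isMeanZero_zero _
  | succ k =>
    classical
    rw [isMeanZero_succ_iff]
    intro W
    have h1 : P.extend (k + 1) z (P.heir k W) = -(m.real (P.heir k W).1 : ℂ)⁻¹ *
        ∑ Q ∈ P.cadets k W, (m.real Q.1 : ℂ) * P.extend (k + 1) z Q := by
      simp only [extend, P.isHeir_heir k W, dif_pos, parent_heir]
      congr 1
      refine Finset.sum_congr rfl fun Q hQ => ?_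
      have hQ' : ¬ P.IsHeir (k + 1) Q := (Finset.mem_filter.1 hQ).2.1
      simp [hQ']
    rw [h1, ← mul_assoc, mul_neg, mul_inv_cancel₀ (by exact_mod_cast (P.real_pos _ _).ne')]
    ring

/-- By the mean zero condition `m(H) |y(H)|` is at most the sum of `m(Q) |y(Q)|` over the other
children. Hölder with the weights `m(Q)`, of total at most `m(W) ≤ R * m(H)`, gives the `p`-th
powers. -/
theorem measure_mul_enorm_heir_le (hp : p ≠ ∞) {R : ℝ≥0∞} {k : ℕ} {W : P.cells k}
    (hR : m W.1 ≤ R * m (P.heir k W).1) {y : P.cells (k + 1) → ℂ}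
    (hy : P.IsMeanZero p (k + 1) y) :
    m (P.heir k W).1 * ‖y (P.heir k W)‖ₑ ^ p.toReal ≤
      R ^ (p.toReal - 1) * ∑ Q ∈ P.cadets k W, m Q.1 * ‖y Q‖ₑ ^ p.toReal := by
  classical
  have hp' := ENNReal.one_le_toReal hp1.out hp
  have hp0 : 0 < p.toReal := by linarith
  set H := P.heir k W
  have hH0 := P.cell_measure_ne_zero (k + 1) H
  have hHt := measure_ne_top m H.1
  have hme : ∀ Q : P.cells (k + 1), ‖(m.real Q.1 : ℂ)‖ₑ = m Q.1 := fun Q => by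
    rw [← ofReal_norm, Complex.norm_real, Real.norm_of_nonneg measureReal_nonneg,
      measureReal_def, ENNReal.ofReal_toReal (measure_ne_top m _)]
  have h1 : m H.1 * ‖y H‖ₑ ≤ ∑ Q ∈ P.cadets k W, m Q.1 * ‖y Q‖ₑ := by
    have := (P.isMeanZero_succ_iff k y).1 hy W
    rw [← hme, ← enorm_mul, eq_neg_of_add_eq_zero_left this, enorm_neg]
    refine (enorm_sum_le _ _).trans (le_of_eq ?_)
    refine Finset.sum_congr rfl fun Q _ => ?_
    rw [enorm_mul, hme]
  have h2 : ∑ Q ∈ P.cadets k W, m Q.1 ≤ m W.1 := by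
    have h := congrArg (fun μ : Measure I => μ univ) (P.restrict_eq_sum k W)
    simp only [Measure.restrict_apply_univ, Measure.coe_finsetSum, Finset.sum_apply] at h
    rw [h, children_eq_insert, Finset.sum_insert (P.heir_notMem_cadets k W)]
    exact le_add_self
  have h3 : (∑ Q ∈ P.cadets k W, m Q.1 * ‖y Q‖ₑ) ^ p.toReal ≤
      m W.1 ^ (p.toReal - 1) * ∑ Q ∈ P.cadets k W, m Q.1 * ‖y Q‖ₑ ^ p.toReal := by
    have h := ENNReal.tsum_mul_rpow_le (ι := P.cadets k W) hp' (fun Q => m Q.1.1)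
      (fun Q => ‖y Q.1‖ₑ) (A := m W.1) (by
        rw [tsum_fintype, Finset.sum_coe_sort _ fun Q : P.cells (k + 1) => m Q.1]; exact h2)
    simpa only [tsum_fintype, Finset.sum_coe_sort _ fun Q : P.cells (k + 1) => m Q.1 * ‖y Q‖ₑ,
      Finset.sum_coe_sort _ fun Q : P.cells (k + 1) => m Q.1 * ‖y Q‖ₑ ^ p.toReal] using h
  have hpos : m H.1 ^ (p.toReal - 1) ≠ 0 := by simp [hH0, hHt]
  have hfin : m H.1 ^ (p.toReal - 1) ≠ ∞ := ENNReal.rpow_ne_top_of_nonneg (by linarith) hHt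
  have h4 : m H.1 * m H.1 ^ (p.toReal - 1) = m H.1 ^ p.toReal := by
    nth_rewrite 1 [← ENNReal.rpow_one (m H.1)]
    rw [← ENNReal.rpow_add _ _ hH0 hHt]; congr 1; ring
  rw [← ENNReal.mul_le_mul_iff_left hpos hfin]
  calc m H.1 * ‖y H‖ₑ ^ p.toReal * m H.1 ^ (p.toReal - 1)
      = (m H.1 * ‖y H‖ₑ) ^ p.toReal := by
        rw [ENNReal.mul_rpow_of_nonneg _ _ hp0.le, ← h4]; ring
    _ ≤ (∑ Q ∈ P.cadets k W, m Q.1 * ‖y Q‖ₑ) ^ p.toReal := by gcongr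
    _ ≤ _ := h3
    _ ≤ (R * m H.1) ^ (p.toReal - 1) * ∑ Q ∈ P.cadets k W, m Q.1 * ‖y Q‖ₑ ^ p.toReal := by
        gcongr
    _ = _ := by rw [ENNReal.mul_rpow_of_nonneg _ _ (by linarith)]; ring

theorem HasSize.parent_le {P : GoodGrid m} (hP : P.HasSize lam A) (hlam : lam ≠ 0) (k : ℕ)
    (W : P.cells k) : m W.1 ≤ ((A * A / lam : ℝ≥0) : ℝ≥0∞) * m (P.heir k W).1 := by
  have hl : (lam : ℝ≥0∞) ≠ 0 := by simpa using hlam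
  rw [ENNReal.coe_div hlam, ENNReal.mul_div_right_comm.symm, ENNReal.le_div_iff_mul_le (by simp [hl])
    (by simp)]
  calc m W.1 * lam ≤ (A * (lam : ℝ≥0∞) ^ k) * lam := by gcongr; exact (hP k W).2
    _ = A * (lam : ℝ≥0∞) ^ (k + 1) := by ring
    _ ≤ A * (A * m (P.heir k W).1) := by gcongr; exact (hP (k + 1) _).1
    _ = _ := by push_cast; ring

/-- Discarding the heirs loses only a constant: the summand `1` pays for the free cells and the
power of `A * A / lam` for the heirs. -/
theorem enorm_step_rpow_le_sum_free (hp : p ≠ ∞) (hlam : lam ≠ 0) (hP : P.HasSize lam A) (k : ℕ)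
    {y : P.cells k → ℂ} (hy : P.IsMeanZero p k y) : ‖P.step p k y‖ₑ ^ p.toReal ≤
      (1 + ((A * A / lam : ℝ≥0) : ℝ≥0∞) ^ (p.toReal - 1)) *
        ∑ Q : P.Free k, m Q.1.1 * ‖y Q.1‖ₑ ^ p.toReal := by
  classical
  rw [P.enorm_step p hp]
  cases k with
  | zero =>
    let e₀ : P.Free 0 ≃ P.cells 0 := Equiv.subtypeUnivEquiv fun Q h => h
    have : ∑ Q : P.cells 0, m Q.1 * ‖y Q‖ₑ ^ p.toReal =
        ∑ Q : P.Free 0, m Q.1.1 * ‖y Q.1‖ₑ ^ p.toReal :=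
      (Fintype.sum_equiv e₀ _ _ fun _ => rfl).symm
    rw [this, add_mul, one_mul]
    exact le_self_add
  | succ k =>
    rw [sum_eq_sum_heir_add, add_mul, one_mul, add_comm]
    gcongr
    calc ∑ W, m (P.heir k W).1 * ‖y (P.heir k W)‖ₑ ^ p.toReal
        ≤ ∑ W, ((A * A / lam : ℝ≥0) : ℝ≥0∞) ^ (p.toReal - 1) *
            ∑ Q ∈ P.cadets k W, m Q.1 * ‖y Q‖ₑ ^ p.toReal :=
          Finset.sum_le_sum fun W _ =>
            P.measure_mul_enorm_heir_le hp (hP.parent_le hlam k W) hy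
      _ = _ := by
          rw [← Finset.mul_sum, ← Finset.sum_subtype
            (Finset.univ.filter fun Q => ¬ P.IsHeir (k + 1) Q) (by simp)
            (fun Q => m Q.1 * ‖y Q‖ₑ ^ p.toReal), ← Finset.sum_fiberwise (g := P.parent k)]
          congr 1
          refine Finset.sum_congr rfl fun W _ => ?_
          rw [Finset.filter_filter]
          rfl

theorem levelNorm_sigma (hp : p ≠ ∞) (e : ℕ ≃ Σ k, P.Free k) (Z : (Σ k, P.Free k) → ℂ) (k : ℕ) :
    levelNorm p (fun n => (e n).1) (fun n => Z (e n)) k ^ p.toReal =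
      ∑ Q : P.Free k, ‖Z ⟨k, Q⟩‖ₑ ^ p.toReal := by
  have hp' := ENNReal.one_le_toReal hp1.out hp
  have hp0 : 0 < p.toReal := by linarith
  unfold levelNorm
  rw [← ENNReal.rpow_mul, one_div_mul_cancel hp0.ne', ENNReal.rpow_one,
    e.tsum_eq (fun i : Σ k, P.Free k => if i.1 = k then ‖Z i‖ₑ ^ p.toReal else 0),
    ENNReal.tsum_sigma', tsum_eq_single k]
  · simp [tsum_fintype]
  · intro j hj
    simp [hj]

end Coordinates

end GoodGrid

/-! ### Coordinates and the isomorphism. -/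

namespace GoodGrid

section Isomorphism

variable {I : Type*} [MeasurableSpace I] {m : Measure I} [IsProbabilityMeasure m] (P : GoodGrid m)
  {p q : ℝ≥0∞} [hp1 : Fact (1 ≤ p)] {lam A : ℝ≥0}

/-- The sequence of the normalized values on the free cells. -/
noncomputable def coordSeq (e : ℕ ≃ Σ k, P.Free k) (p : ℝ≥0∞) (lam : ℝ≥0) (s : ℝ)
    (y : ∀ k, P.cells k → ℂ) (n : ℕ) : ℂ :=
  ((((lam : ℝ) ^ (1 / p.toReal - s)) ^ (e n).1 : ℝ) : ℂ) * y (e n).1 (e n).2.1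

/-- The weight `lam ^ (k * (1 / p - s))` is chosen so that its `p`-th power is the Besov weight
times `lam ^ k`, a substitute for the measure of the cell that is uniform on the level. -/
theorem levelNorm_coordSeq (hp : p ≠ ∞) (hlam : lam ≠ 0) (e : ℕ ≃ Σ k, P.Free k) (s : ℝ)
    (y : ∀ k, P.cells k → ℂ) (k : ℕ) :
    levelNorm p (fun n => (e n).1) (P.coordSeq e p lam s y) k ^ p.toReal =
      ((((lam : ℝ≥0∞) ^ s) ^ k)⁻¹) ^ p.toReal *
        ∑ Q : P.Free k, (lam : ℝ≥0∞) ^ k * ‖y k Q.1‖ₑ ^ p.toReal := by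
  have hp' := ENNReal.one_le_toReal hp1.out hp
  have hp0 : 0 < p.toReal := by linarith
  have hl : (lam : ℝ≥0∞) ≠ 0 := by simpa using hlam
  have hl' : 0 < (lam : ℝ) := by exact_mod_cast pos_iff_ne_zero.2 hlam
  have h := P.levelNorm_sigma hp e
    (fun i => ((((lam : ℝ) ^ (1 / p.toReal - s)) ^ i.1 : ℝ) : ℂ) * y i.1 i.2.1) k
  change levelNorm p (fun n => (e n).1) (fun n => _) k ^ p.toReal = _ at h
  unfold coordSeq
  rw [h, Finset.mul_sum]
  refine Finset.sum_congr rfl fun Q _ => ?_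
  rw [enorm_mul, ENNReal.mul_rpow_of_nonneg _ _ hp0.le, ← mul_assoc]
  congr 1
  rw [← ofReal_norm, Complex.norm_real, Real.norm_of_nonneg (by positivity),
    ENNReal.ofReal_pow (by positivity), ← ENNReal.ofReal_rpow_of_pos hl', ENNReal.ofReal_coe_nnreal]
  simp only [← ENNReal.rpow_natCast]
  rw [← ENNReal.rpow_mul, ← ENNReal.rpow_mul, ← ENNReal.rpow_mul, ← ENNReal.rpow_neg,
    ← ENNReal.rpow_mul, ← ENNReal.rpow_add _ _ hl (by simp)]
  congr 1
  field_simp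
  ring

theorem mixedNorm_coordSeq_le (hp : p ≠ ∞) (hq : 1 ≤ q) (hlam : lam ≠ 0) (hP : P.HasSize lam A)
    (e : ℕ ≃ Σ k, P.Free k) (s : ℝ) (y : ∀ k, P.cells k → ℂ) :
    mixedNorm p q (fun n => (e n).1) (P.coordSeq e p lam s y) ≤
      (A : ℝ≥0∞) ^ (1 / p.toReal) * P.stepNorm p q lam s y := by
  have hp' := ENNReal.one_le_toReal hp1.out hp
  have hp0 : 0 < p.toReal := by linarith
  unfold mixedNorm stepNorm
  rw [← seqNorm_const_mul hq]
  refine seqNorm_mono fun k => ?_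
  rw [← ENNReal.rpow_le_rpow_iff hp0, P.levelNorm_coordSeq hp hlam,
    ENNReal.mul_rpow_of_nonneg _ _ hp0.le, ENNReal.mul_rpow_of_nonneg _ _ hp0.le,
    ← ENNReal.rpow_mul, one_div_mul_cancel hp0.ne', ENNReal.rpow_one, P.enorm_step p hp]
  calc ((((lam : ℝ≥0∞) ^ s) ^ k)⁻¹) ^ p.toReal *
        ∑ Q : P.Free k, (lam : ℝ≥0∞) ^ k * ‖y k Q.1‖ₑ ^ p.toReal
      ≤ ((((lam : ℝ≥0∞) ^ s) ^ k)⁻¹) ^ p.toReal *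
        ∑ Q : P.Free k, (A * m Q.1.1) * ‖y k Q.1‖ₑ ^ p.toReal := by
        gcongr with Q
        exact (hP k Q.1).1
    _ = A * (((((lam : ℝ≥0∞) ^ s) ^ k)⁻¹) ^ p.toReal *
        ∑ Q : P.Free k, m Q.1.1 * ‖y k Q.1‖ₑ ^ p.toReal) := by
        simp only [mul_assoc, ← Finset.mul_sum]
        ring
    _ ≤ _ := by
        gcongr
        classical
        rw [← Finset.sum_subtype (Finset.univ.filter fun Q => ¬ P.IsHeir k Q) (by simp)
          (fun Q => m Q.1 * ‖y k Q‖ₑ ^ p.toReal)]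
        exact Finset.sum_le_sum_of_subset (Finset.filter_subset _ _)

theorem exists_stepNorm_le (hp : p ≠ ∞) (hq : 1 ≤ q) (hlam : lam ≠ 0) (hP : P.HasSize lam A)
    (e : ℕ ≃ Σ k, P.Free k) (s : ℝ) : ∃ M : ℝ≥0∞, M ≠ ∞ ∧ ∀ y : ∀ k, P.cells k → ℂ,
      (∀ k, P.IsMeanZero p k (y k)) → P.stepNorm p q lam s y ≤
        M * mixedNorm p q (fun n => (e n).1) (P.coordSeq e p lam s y) := by
  have hp' := ENNReal.one_le_toReal hp1.out hp
  have hp0 : 0 < p.toReal := by linarith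
  set D : ℝ≥0∞ := 1 + ((A * A / lam : ℝ≥0) : ℝ≥0∞) ^ (p.toReal - 1) with hD
  have hDt : D ≠ ∞ := ENNReal.add_ne_top.2
    ⟨by simp, ENNReal.rpow_ne_top_of_nonneg (by linarith) ENNReal.coe_ne_top⟩
  refine ⟨(D * A) ^ (1 / p.toReal), ENNReal.rpow_ne_top_of_nonneg (by positivity)
    (ENNReal.mul_ne_top hDt ENNReal.coe_ne_top), fun y hy => ?_⟩
  unfold mixedNorm stepNorm
  rw [← seqNorm_const_mul hq]
  refine seqNorm_mono fun k => ?_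
  rw [← ENNReal.rpow_le_rpow_iff hp0, ENNReal.mul_rpow_of_nonneg _ _ hp0.le,
    ENNReal.mul_rpow_of_nonneg _ _ hp0.le, P.levelNorm_coordSeq hp hlam,
    ← ENNReal.rpow_mul, one_div_mul_cancel hp0.ne', ENNReal.rpow_one]
  calc ((((lam : ℝ≥0∞) ^ s) ^ k)⁻¹) ^ p.toReal * ‖P.step p k (y k)‖ₑ ^ p.toReal
      ≤ ((((lam : ℝ≥0∞) ^ s) ^ k)⁻¹) ^ p.toReal *
          (D * ∑ Q : P.Free k, m Q.1.1 * ‖y k Q.1‖ₑ ^ p.toReal) := by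
        gcongr
        exact P.enorm_step_rpow_le_sum_free hp hlam hP k (hy k)
    _ ≤ ((((lam : ℝ≥0∞) ^ s) ^ k)⁻¹) ^ p.toReal *
          (D * ∑ Q : P.Free k, (A * (lam : ℝ≥0∞) ^ k) * ‖y k Q.1‖ₑ ^ p.toReal) := by
        gcongr with Q
        exact (hP k Q.1).2
    _ = _ := by
        simp only [mul_assoc, ← Finset.mul_sum]
        ring

/-- The enumeration of the free cells, level by level, has geometric growth. -/
theorem isGeometricLevel (hlam : lam ≠ 0) (hlam1 : lam < 1) (hP : P.HasSize lam A)
    (e : ℕ ≃ Σ k, P.Free k)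
    (he : ∀ n, ∑ i ∈ Finset.range (e n).1, Fintype.card (P.Free i) ≤ n ∧
      n < ∑ i ∈ Finset.range ((e n).1 + 1), Fintype.card (P.Free i)) :
    IsGeometricLevel lam (A / lam) (fun n => (e n).1) := by
  have hl : 0 < (lam : ℝ) := by exact_mod_cast pos_iff_ne_zero.2 hlam
  have hl1 : (lam : ℝ) < 1 := by exact_mod_cast hlam1
  have hr : ∀ k (Q : P.cells k), (lam : ℝ) ^ k ≤ A * m.real Q.1 ∧ m.real Q.1 ≤ A * (lam : ℝ) ^ k :=
    fun k Q => by
      obtain ⟨h1, h2⟩ := hP k Q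
      have h1' := ENNReal.toReal_mono (ENNReal.mul_ne_top ENNReal.coe_ne_top (measure_ne_top m _)) h1
      have h2' := ENNReal.toReal_mono (ENNReal.mul_ne_top ENNReal.coe_ne_top
        (ENNReal.pow_ne_top ENNReal.coe_ne_top)) h2
      simp only [ENNReal.toReal_mul, ENNReal.toReal_pow, ENNReal.coe_toReal] at h1' h2'
      exact ⟨h1', h2'⟩
  have hN1 : ∀ k, (Fintype.card (P.cells k) : ℝ) * (lam : ℝ) ^ k ≤ A := fun k => by
    calc (Fintype.card (P.cells k) : ℝ) * (lam : ℝ) ^ k = ∑ Q : P.cells k, (lam : ℝ) ^ k := by simp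
      _ ≤ ∑ Q : P.cells k, A * m.real Q.1 := Finset.sum_le_sum fun Q _ => (hr k Q).1
      _ = A := by rw [← Finset.mul_sum, P.sum_real, mul_one]
  have hN2 : ∀ k, 1 ≤ A * ((Fintype.card (P.cells k) : ℝ) * (lam : ℝ) ^ k) := fun k => by
    calc (1 : ℝ) = ∑ Q : P.cells k, m.real Q.1 := (P.sum_real k).symm
      _ ≤ ∑ Q : P.cells k, A * (lam : ℝ) ^ k := Finset.sum_le_sum fun Q _ => (hr k Q).2
      _ = _ := by simp; ring
  -- Needed for the indices of level `0`, which have no previous level to be compared with.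
  have hA1 : (1 : ℝ) ≤ A := by
    have := (hr 0 (P.nonempty_cells 0).some).1
    rw [pow_zero] at this
    refine this.trans (mul_le_of_le_one_right A.2 measureReal_le_one)
  have hAl : (A : ℝ) ≤ A / lam := by
    rw [le_div_iff₀ hl]; exact mul_le_of_le_one_right A.2 hl1.le
  intro n
  obtain ⟨h1, h2⟩ := he n
  rw [P.sum_card_free] at h2
  have h2' : (n : ℝ) + 1 ≤ Fintype.card (P.cells (e n).1) := by exact_mod_cast h2
  constructor
  · beta_reduce
    rcases hk : (e n).1 with _ | k
    · rw [pow_zero, mul_one]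
      have : (0 : ℝ) ≤ n := Nat.cast_nonneg n
      nlinarith
    · rw [hk, P.sum_card_free] at h1
      have h1' : (Fintype.card (P.cells k) : ℝ) ≤ n + 1 := by exact_mod_cast h1.trans n.le_succ
      calc (1 : ℝ) ≤ A * ((Fintype.card (P.cells k) : ℝ) * (lam : ℝ) ^ k) := hN2 k
        _ ≤ A * ((n + 1) * (lam : ℝ) ^ k) := by gcongr
        -- The index is bounded below through the cells of the level before its own; this shift
        -- produces the factor `1 / lam`.
        _ = A / lam * ((n + 1) * (lam : ℝ) ^ (k + 1)) := by
          rw [pow_succ]; field_simp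
  · calc ((n : ℝ) + 1) * (lam : ℝ) ^ (e n).1
        ≤ Fintype.card (P.cells (e n).1) * (lam : ℝ) ^ (e n).1 := by gcongr
      _ ≤ A := hN1 _
      _ ≤ _ := hAl

variable [hq1 : Fact (1 ≤ q)]

/-- Besov spaces are isomorphic to spaces of sequences with finite mixed norm. -/
theorem exists_coordinates (hp : p ≠ ∞) (hlam : lam ≠ 0) (hlam1 : lam < 1) (hA : A ≠ 0)
    (hP : P.HasSize lam A) {s : ℝ} (hs : 0 < s) :
    ∃ (lev : ℕ → ℕ) (B : ℝ) (Φ : P.besov s p q →ₗ[ℂ] (ℕ → ℂ)) (M : ℝ≥0∞),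
      IsGeometricLevel lam B lev ∧ Function.Injective Φ ∧
      (∀ x, x ∈ LinearMap.range Φ ↔ mixedNorm p q lev x ≠ ∞) ∧ M ≠ ∞ ∧
      ∀ f, mixedNorm p q lev (Φ f) ≤ M * ENNReal.ofReal (P.besovNorm s p q f) ∧
        ENNReal.ofReal (P.besovNorm s p q f) ≤ M * mixedNorm p q lev (Φ f) := by
  obtain ⟨e, he⟩ := exists_equiv_nat_sigma P.Free
  obtain ⟨M₂, hM₂, hle₂⟩ := P.exists_stepNorm_le hp hq1.out hlam hP e s
  have hl : 0 < (lam : ℝ) := by exact_mod_cast pos_iff_ne_zero.2 hlam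
  have hp' := ENNReal.one_le_toReal hp1.out hp
  have hl1 : (lam : ℝ≥0∞) ^ s < 1 := ENNReal.rpow_lt_one (by exact_mod_cast hlam1) hs
  set κ : ℕ → ℂ := fun k => ((((lam : ℝ) ^ (1 / p.toReal - s)) ^ k : ℝ) : ℂ) with hκ
  have hκ0 : ∀ k, κ k ≠ 0 := fun k => by
    simp only [hκ]; exact_mod_cast (by positivity)
  let Φ : P.besov s p q →ₗ[ℂ] (ℕ → ℂ) :=
    { toFun := fun f => P.coordSeq e p lam s (fun k => P.diff p k (f : Lp ℂ p m))
      map_add' := fun f g => by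
        ext n; simp [coordSeq, mul_add]
      map_smul' := fun a f => by
        ext n; simp [coordSeq]; ring }
  have hΦ : ∀ f, Φ f = P.coordSeq e p lam s (fun k => P.diff p k (f : Lp ℂ p m)) := fun f => rfl
  set M₁ : ℝ≥0∞ := (A : ℝ≥0∞) ^ (1 / p.toReal) *
    (2 * (A : ℝ≥0∞) ^ s * (1 - (lam : ℝ≥0∞) ^ s)⁻¹) with hM₁
  have hM₁t : M₁ ≠ ∞ := ENNReal.mul_ne_top
    (ENNReal.rpow_ne_top_of_nonneg (by positivity) ENNReal.coe_ne_top)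
    (ENNReal.mul_ne_top (ENNReal.mul_ne_top (by simp) (by simp [hs.le]))
    (ENNReal.inv_ne_top.2 (tsub_pos_of_lt hl1).ne'))
  have hup : ∀ f, mixedNorm p q (fun n => (e n).1) (Φ f) ≤
      M₁ * ENNReal.ofReal (P.besovNorm s p q f) := fun f => by
    rw [hΦ, hM₁, mul_assoc]
    refine (P.mixedNorm_coordSeq_le hp hq1.out hlam hP e s _).trans ?_
    gcongr
    exact P.stepNorm_diff_le_besovNorm hp hlam hlam1 hA hP hs f
  have hfin : ∀ f, mixedNorm p q (fun n => (e n).1) (Φ f) ≠ ∞ := fun f =>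
    ne_top_of_le_ne_top (ENNReal.mul_ne_top hM₁t ENNReal.ofReal_ne_top) (hup f)
  have hstep : ∀ f : P.besov s p q, P.stepNorm p q lam s (fun k => P.diff p k (f : Lp ℂ p m)) ≤
      M₂ * mixedNorm p q (fun n => (e n).1) (Φ f) := fun f =>
    hle₂ _ fun k => P.isMeanZero_diff p k _
  -- The martingale series of `f` converges because its step norm is finite, and its sum is `f`
  -- because its partial sums are the conditional expectations of `f`.
  have hsum : ∀ f : P.besov s p q, ∃ c : P.Coeff p q,
      HasSum (fun k => P.step p k (P.diff p k (f : Lp ℂ p m))) (f : Lp ℂ p m) ∧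
      P.IsRep s p q c (f : Lp ℂ p m) ∧ ENNReal.ofReal ‖c‖ ≤ (A : ℝ≥0∞) ^ s *
        P.stepNorm p q lam s (fun k => P.diff p k (f : Lp ℂ p m)) := fun f => by
    obtain ⟨g, c, h1, h2, h3⟩ := P.exists_isRep_of_stepNorm hp hq1.out hlam hlam1 hA hP hs
      (ne_top_of_le_ne_top (ENNReal.mul_ne_top hM₂ (hfin f)) (hstep f))
    obtain ⟨c₀, hc₀⟩ := f.2
    have t1 := P.tendsto_cexp hp (fun j => ⟨_, P.block_eq_step p q s c₀ j⟩) hc₀.2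
    have t2 := h1.tendsto_sum_nat.comp (Filter.tendsto_add_atTop_nat 1)
    simp only [Function.comp_def, P.sum_step_diff] at t2
    have hgf : g = f := tendsto_nhds_unique t2 t1
    rw [hgf] at h1 h2
    exact ⟨c, h1, h2, h3⟩
  refine ⟨fun n => (e n).1, A / lam, Φ, max M₁ ((A : ℝ≥0∞) ^ s * M₂),
    P.isGeometricLevel hlam hlam1 hP e he, ?_, ?_, ?_, fun f => ⟨?_, ?_⟩⟩
  · rw [← LinearMap.ker_eq_bot, LinearMap.ker_eq_bot']
    intro f hf
    have h0 : mixedNorm p q (fun n => (e n).1) (Φ f) = 0 := by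
      have := hup 0
      rw [hf]
      have hz : ∀ k, levelNorm p (fun n => (e n).1) (0 : ℕ → ℂ) k = 0 := fun k => by
        have hp0 : 0 < p.toReal := by linarith
        simp [levelNorm, hp0]
      refine le_antisymm ?_ (by simp)
      have h := seqNorm_const_mul (q := q) hq1.out 0 (fun _ => 0)
      unfold mixedNorm
      refine (seqNorm_mono (v := fun _ => 0 * 0) fun k => ?_).trans (h.le.trans (by simp))
      simp [hz]
    have h1 := hstep f
    rw [h0, mul_zero] at h1
    obtain ⟨c, h2, -, -⟩ := hsum f
    have h3 : ∀ k, P.step p k (P.diff p k (f : Lp ℂ p m)) = 0 := fun k => by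
      have h4 := (le_seqNorm hq1.out _ k).trans h1
      simp only [nonpos_iff_eq_zero, mul_eq_zero, ENNReal.inv_eq_zero, enorm_eq_zero] at h4
      exact h4.resolve_left (ENNReal.pow_ne_top hl1.ne_top)
    simp only [h3] at h2
    exact Subtype.ext (h2.unique hasSum_zero)
  · intro x
    constructor
    · rintro ⟨f, rfl⟩; exact hfin f
    · intro hx
      -- Surjectivity: undo the weights, read the sequence on the free cells and fill in the heirs
      -- by the mean zero condition.
      let y : ∀ k, P.cells k → ℂ := fun k =>
        P.extend k fun Q => (κ k)⁻¹ * x (e.symm ⟨k, Q⟩)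
      have hy0 : ∀ k, P.IsMeanZero p k (y k) := fun k => P.isMeanZero_extend k _
      have hxy : P.coordSeq e p lam s y = x := by
        ext n
        have h1 : y (e n).1 (e n).2.1 = (κ (e n).1)⁻¹ * x n := by
          simp only [y]
          rw [extend_free]
          simp
        unfold coordSeq
        rw [h1, ← mul_assoc]
        change κ (e n).1 * _ * _ = _
        rw [mul_inv_cancel₀ (hκ0 _), one_mul]
      have h1 := hle₂ y hy0
      rw [hxy] at h1
      obtain ⟨f, c, h2, h3, -⟩ := P.exists_isRep_of_stepNorm hp hq1.out hlam hlam1 hA hP hs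
        (ne_top_of_le_ne_top (ENNReal.mul_ne_top hM₂ hx) h1)
      refine ⟨⟨f, c, h3⟩, ?_⟩
      rw [hΦ, ← hxy]
      congr 1
      ext1 k
      exact P.diff_eq_of_hasSum hp hy0 h2 k
  · simp only [ne_eq, max_eq_top, not_or]
    exact ⟨hM₁t, ENNReal.mul_ne_top (by simp [hs.le]) hM₂⟩
  · refine (hup f).trans ?_
    gcongr
    exact le_max_left _ _
  · obtain ⟨c, -, h2, h3⟩ := hsum f
    calc ENNReal.ofReal (P.besovNorm s p q f) ≤ ENNReal.ofReal ‖c‖ :=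
          ENNReal.ofReal_le_ofReal (P.besovNorm_le_of_isRep f h2)
      _ ≤ _ := h3
      _ ≤ (A : ℝ≥0∞) ^ s * (M₂ * mixedNorm p q (fun n => (e n).1) (Φ f)) := by
          gcongr; exact hstep f
      _ ≤ _ := by
          rw [← mul_assoc]
          gcongr
          exact le_max_right _ _

theorem besovNorm_nonneg {s : ℝ} (f : P.besov s p q) : 0 ≤ P.besovNorm s p q f :=
  Real.sInf_nonneg (by rintro _ ⟨c, _, rfl⟩; exact norm_nonneg c)

/-- Besov spaces of grids whose cells have geometric size are isomorphic. -/
theorem exists_linearEquiv_besov {J : Type*} [MeasurableSpace J] {μ : Measure J}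
    [IsProbabilityMeasure μ] (G : GoodGrid μ) {lam' A' : ℝ≥0} (hp : p ≠ ∞) (hlam : lam ≠ 0)
    (hlam1 : lam < 1) (hA : A ≠ 0) (hP : P.HasSize lam A) (hlam' : lam' ≠ 0) (hlam1' : lam' < 1)
    (hA' : A' ≠ 0) (hG : G.HasSize lam' A') {s : ℝ} (hs : 0 < s) :
    ∃ (T : P.besov s p q ≃ₗ[ℂ] G.besov s p q) (C : ℝ), 0 < C ∧
      ∀ f : P.besov s p q, G.besovNorm s p q (T f) ≤ C * P.besovNorm s p q f ∧
        P.besovNorm s p q f ≤ C * G.besovNorm s p q (T f) := by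
  obtain ⟨lev, B, Φ, M, hlev, hinj, hrange, hM, hnorm⟩ :=
    P.exists_coordinates (q := q) hp hlam hlam1 hA hP hs
  obtain ⟨lev', B', Φ', M', hlev', hinj', hrange', hM', hnorm'⟩ :=
    G.exists_coordinates (q := q) hp hlam' hlam1' hA' hG hs
  have a1 : 0 < (lam : ℝ) := by exact_mod_cast pos_iff_ne_zero.2 hlam
  have a2 : (lam : ℝ) < 1 := by exact_mod_cast hlam1
  have b1 : 0 < (lam' : ℝ) := by exact_mod_cast pos_iff_ne_zero.2 hlam'
  have b2 : (lam' : ℝ) < 1 := by exact_mod_cast hlam1'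
  obtain ⟨N, hN, hle⟩ := hlev.mixedNorm_le a1 a2 b1 b2 hlev' hp1.out hp hq1.out
  obtain ⟨N', hN', hle'⟩ := hlev'.mixedNorm_le b1 b2 a1 a2 hlev hp1.out hp hq1.out
  -- Both ranges consist of the sequences of finite mixed norm, and finiteness is the same for the
  -- two level functions.
  have hrr : LinearMap.range Φ = LinearMap.range Φ' := by
    ext x
    rw [hrange, hrange']
    exact ⟨fun h => ne_top_of_le_ne_top (ENNReal.mul_ne_top hN h) (hle x),
      fun h => ne_top_of_le_ne_top (ENNReal.mul_ne_top hN' h) (hle' x)⟩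
  let T : P.besov s p q ≃ₗ[ℂ] G.besov s p q :=
    (LinearEquiv.ofInjective Φ hinj).trans ((LinearEquiv.ofEq _ _ hrr).trans
      (LinearEquiv.ofInjective Φ' hinj').symm)
  have hT : ∀ f, Φ' (T f) = Φ f := fun f => by
    have h := (LinearEquiv.ofInjective Φ' hinj').apply_symm_apply
      (LinearEquiv.ofEq _ _ hrr (LinearEquiv.ofInjective Φ hinj f))
    exact congrArg Subtype.val h
  set C : ℝ≥0∞ := M * M' * (N + N') + 1 with hC
  have hCt : C ≠ ∞ := ENNReal.add_ne_top.2 ⟨ENNReal.mul_ne_top (ENNReal.mul_ne_top hM hM')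
    (ENNReal.add_ne_top.2 ⟨hN, hN'⟩), ENNReal.one_ne_top⟩
  have key : ∀ {x y : ℝ}, 0 ≤ x → ENNReal.ofReal y ≤ C * ENNReal.ofReal x → y ≤ C.toReal * x :=
    fun {x y} hx h => by
      rw [← ENNReal.ofReal_toReal hCt, ← ENNReal.ofReal_mul ENNReal.toReal_nonneg] at h
      exact (ENNReal.ofReal_le_ofReal_iff (mul_nonneg ENNReal.toReal_nonneg hx)).1 h
  refine ⟨T, C.toReal, ENNReal.toReal_pos (by simp [hC]) hCt, fun f => ⟨?_, ?_⟩⟩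
  · refine key (P.besovNorm_nonneg f) ?_
    calc ENNReal.ofReal (G.besovNorm s p q (T f)) ≤ M' * mixedNorm p q lev' (Φ' (T f)) :=
          (hnorm' _).2
      _ ≤ M' * (N * mixedNorm p q lev (Φ f)) := by rw [hT]; gcongr; exact hle _
      _ ≤ M' * (N * (M * ENNReal.ofReal (P.besovNorm s p q f))) := by gcongr; exact (hnorm f).1
      _ = (M * M' * N) * ENNReal.ofReal (P.besovNorm s p q f) := by ring
      _ ≤ _ := by
          gcongr
          refine le_trans ?_ le_self_add
          gcongr
          exact le_self_add
  · refine key (G.besovNorm_nonneg _) ?_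
    calc ENNReal.ofReal (P.besovNorm s p q f) ≤ M * mixedNorm p q lev (Φ f) := (hnorm _).2
      _ ≤ M * (N' * mixedNorm p q lev' (Φ' (T f))) := by rw [hT]; gcongr; exact hle' _
      _ ≤ M * (N' * (M' * ENNReal.ofReal (G.besovNorm s p q (T f)))) := by
          gcongr; exact (hnorm' _).1
      _ = (M * M' * N') * ENNReal.ofReal (G.besovNorm s p q (T f)) := by ring
      _ ≤ _ := by
          gcongr
          refine le_trans ?_ le_self_add
          gcongr
          exact le_add_self

end Isomorphism

end GoodGrid

/-! ### Regularity and the size of the cells. -/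

/-- Ahlfors regularity of dimension one, up to scale one, of the balls of a function of two
variables. -/
def IsOneRegular {I : Type*} [MeasurableSpace I] (α : I → I → ℝ) (m : Measure I) (D : ℝ) : Prop :=
  0 < D ∧ ∀ x r, 0 < r → m (quasiBall α x r) ≤ ENNReal.ofReal (D * r) ∧
    (r ≤ 1 → ENNReal.ofReal r ≤ ENNReal.ofReal D * m (quasiBall α x r))

theorem IsOneRegular.hasSize {I : Type*} [MeasurableSpace I] {α : I → I → ℝ} {m : Measure I}
    [IsProbabilityMeasure m] {D : ℝ} (h : IsOneRegular α m D) (P : GoodGrid m) {η : ℝ}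
    (hP : P.IsAdapted α η) : ∃ lam A : ℝ≥0, lam ≠ 0 ∧ lam < 1 ∧ A ≠ 0 ∧ P.HasSize lam A := by
  obtain ⟨c₁, c₂, c₃, c₄, lam, h1, h2, -, -, h5, h6, hcell⟩ := hP
  obtain ⟨hD, hreg⟩ := h
  lift lam to ℝ≥0 using h5.le
  have h5' : lam ≠ 0 := by rintro rfl; simp at h5
  have h6' : lam < 1 := by exact_mod_cast h6
  -- The lower regularity bound holds for radii up to `1` only.
  set c := min c₁ 1 with hc
  have hc0 : 0 < c := lt_min h1 one_pos
  -- Adaptedness says nothing about level `0`; its finitely many cells are absorbed into the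
  -- constant.
  set a₀ : ℝ := ∑ Q : P.cells 0, (m.real Q.1)⁻¹ with ha₀
  have ha₀0 : 0 ≤ a₀ := Finset.sum_nonneg fun Q _ => inv_nonneg.2 measureReal_nonneg
  set A : ℝ := D / c + D * (2 * c₂) + a₀ + 1 with hA
  have hDc : 0 < D / c := by positivity
  have hDc2 : 0 < D * (2 * c₂) := by positivity
  have hA0 : 0 < A := by positivity
  refine ⟨lam, A.toNNReal, h5', h6', (Real.toNNReal_pos.2 hA0).ne', ?_⟩
  have key : ∀ k, ∀ Q : P.cells k, (lam : ℝ) ^ k ≤ A * m.real Q.1 ∧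
      m.real Q.1 ≤ A * (lam : ℝ) ^ k := by
    intro k Q
    have hm0 := P.real_pos k Q
    rcases Nat.eq_zero_or_pos k with rfl | hk
    · rw [pow_zero, mul_one]
      constructor
      · have : (m.real Q.1)⁻¹ ≤ a₀ :=
          Finset.single_le_sum (f := fun Q : P.cells 0 => (m.real Q.1)⁻¹)
            (fun Q _ => inv_nonneg.2 measureReal_nonneg) (Finset.mem_univ Q)
        calc (1 : ℝ) = (m.real Q.1)⁻¹ * m.real Q.1 := (inv_mul_cancel₀ hm0.ne').symm
          _ ≤ A * m.real Q.1 := mul_le_mul_of_nonneg_right (by linarith) hm0.le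
      · have : m.real Q.1 ≤ 1 := measureReal_le_one
        linarith
    · obtain ⟨⟨z, hz, hzQ⟩, hdiam, -⟩ := hcell k hk Q.1 Q.2
      have hl : 0 < (lam : ℝ) ^ k := by positivity
      have hl1 : (lam : ℝ) ^ k ≤ 1 := pow_le_one₀ h5.le h6.le
      constructor
      · have h7 := (hreg z (c * lam ^ k) (by positivity)).2
          (mul_le_one₀ (min_le_right _ _) hl.le hl1)
        have h8 : quasiBall α z (c * lam ^ k) ⊆ Q.1 := fun y hy => hzQ (lt_of_lt_of_le hy
          (mul_le_mul_of_nonneg_right (min_le_left _ _) hl.le))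
        have h9 := ENNReal.toReal_mono (by finiteness)
          (h7.trans (mul_le_mul_right (measure_mono h8) _))
        rw [ENNReal.toReal_mul, ENNReal.toReal_ofReal (by positivity),
          ENNReal.toReal_ofReal hD.le] at h9
        have h10 : (lam : ℝ) ^ k ≤ D / c * m.real Q.1 := by
          rw [div_mul_eq_mul_div, le_div_iff₀ hc0, mul_comm]; exact h9
        refine h10.trans ?_
        gcongr; linarith
      · have h7 := (hreg z (2 * c₂ * lam ^ k) (by positivity)).1
        have h8 : Q.1 ⊆ quasiBall α z (2 * c₂ * lam ^ k) := fun y hy => by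
          have := hdiam z hz y hy
          have h9 : 0 < c₂ * (lam : ℝ) ^ k := by positivity
          change α z y < _
          linarith
        have h9 := ENNReal.toReal_mono (by finiteness) ((measure_mono h8).trans h7)
        rw [ENNReal.toReal_ofReal (by positivity)] at h9
        refine (h9.trans (le_of_eq (by ring : _ = D * (2 * c₂) * (lam : ℝ) ^ k))).trans ?_
        gcongr; linarith
  intro k Q
  obtain ⟨k1, k2⟩ := key k Q
  have e2 : ((lam : ℝ≥0∞)) ^ k = ENNReal.ofReal ((lam : ℝ) ^ k) := by
    rw [ENNReal.ofReal_pow h5.le, ENNReal.ofReal_coe_nnreal]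
  have e3 : m Q.1 = ENNReal.ofReal (m.real Q.1) := by
    rw [measureReal_def, ENNReal.ofReal_toReal (measure_ne_top m _)]
  rw [show (A.toNNReal : ℝ≥0∞) = ENNReal.ofReal A from rfl, e2, e3, ← ENNReal.ofReal_mul hA0.le, ← ENNReal.ofReal_mul hA0.le]
  exact ⟨ENNReal.ofReal_le_ofReal k1, ENNReal.ofReal_le_ofReal k2⟩

/-! ### The measure quasi-metric of a homogeneous space. -/

section Homogeneous

set_option linter.unusedSectionVars false

variable {I : Type*} [MeasurableSpace I] {ρ : I → I → ℝ} {m : Measure I}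

local notation "β" => measureQuasiMetric ρ m

theorem measureQuasiMetric_nonneg (x y : I) : 0 ≤ β x y :=
  Real.sInf_nonneg (by rintro _ ⟨z, r, -, -, -, rfl⟩; exact measureReal_nonneg)

theorem measureQuasiMetric_symm (x y : I) : β x y = β y x := by
  unfold measureQuasiMetric
  congr 1
  ext t
  constructor <;> rintro ⟨z, r, h0, h1, h2, h3⟩ <;> exact ⟨z, r, h0, h2, h1, h3⟩

theorem measureQuasiMetric_le {x y z : I} {r : ℝ} (hr : 0 < r) (hx : x ∈ quasiBall ρ z r)
    (hy : y ∈ quasiBall ρ z r) : β x y ≤ m.real (quasiBall ρ z r) :=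
  csInf_le ⟨0, by rintro _ ⟨z, r, -, -, -, rfl⟩; exact measureReal_nonneg⟩ ⟨z, r, hr, hx, hy, rfl⟩

theorem mem_quasiBall_self (hρ : IsQuasiMetric ρ) (x : I) {r : ℝ} (hr : 0 < r) :
    x ∈ quasiBall ρ x r := by
  change ρ x x < r
  rwa [hρ.self_eq_zero]

theorem IsQuasiMetric.nonneg (hρ : IsQuasiMetric ρ) (x y : I) : 0 ≤ ρ x y := by
  by_cases h : x = y
  · rw [h, hρ.self_eq_zero]
  · exact (hρ.pos_of_ne x y h).le

theorem exists_quasiBall_of_lt (hρ : IsQuasiMetric ρ) {x y : I} {t : ℝ} (h : β x y < t) :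
    ∃ z r, 0 < r ∧ x ∈ quasiBall ρ z r ∧ y ∈ quasiBall ρ z r ∧ m.real (quasiBall ρ z r) < t := by
  have h0 := hρ.nonneg x y
  obtain ⟨_, ⟨z, r, h1, h2, h3, rfl⟩, h4⟩ := exists_lt_of_csInf_lt
    (⟨_, x, ρ x y + 1, by linarith, mem_quasiBall_self hρ x (by linarith),
      (by linarith : ρ x y < ρ x y + 1), rfl⟩ : Set.Nonempty
    {t : ℝ | ∃ (z : I) (r : ℝ), 0 < r ∧ x ∈ quasiBall ρ z r ∧ y ∈ quasiBall ρ z r ∧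
    t = m.real (quasiBall ρ z r)}) h
  exact ⟨z, r, h1, h2, h3, h4⟩

theorem quasiBall_mono {x : I} {r r' : ℝ} (h : r ≤ r') : quasiBall ρ x r ⊆ quasiBall ρ x r' :=
  fun _ hy => lt_of_lt_of_le hy h

theorem quasiBall_subset_of_mem {K : ℝ} (hK : 1 ≤ K)
    (hρ : ∀ x y z, ρ x z ≤ K * (ρ x y + ρ y z)) {x z : I} {r r' : ℝ} (hx : x ∈ quasiBall ρ z r) :
    quasiBall ρ x r' ⊆ quasiBall ρ z (K * (r + r')) := fun y hy => by
  have h1 : ρ z x < r := hx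
  have h2 : ρ x y < r' := hy
  change ρ z y < _
  refine (hρ z x y).trans_lt ?_
  gcongr

variable [IsProbabilityMeasure m] [TopologicalSpace I]

theorem IsHomogeneousSpace.exists_real_le (hI : IsHomogeneousSpace ρ m) (L : ℝ) :
    ∃ D : ℝ, 1 ≤ D ∧ ∀ x r, 0 < r →
      m.real (quasiBall ρ x (L * r)) ≤ D * m.real (quasiBall ρ x r) := by
  obtain ⟨C, hC⟩ := hI.doubling
  have h1 : ∀ x r, 0 < r → m.real (quasiBall ρ x r) ≤ C * m.real (quasiBall ρ x (r / 2)) :=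
    fun x r hr => by
      have := ENNReal.toReal_mono (hC x r hr).2.2.ne (hC x r hr).2.1.le
      rwa [ENNReal.toReal_mul, ENNReal.coe_toReal] at this
  obtain ⟨n, hn⟩ := pow_unbounded_of_one_lt L (one_lt_two)
  refine ⟨max C 1 ^ n, one_le_pow₀ (le_max_right _ _), fun x r hr => ?_⟩
  have h2 : ∀ n : ℕ, m.real (quasiBall ρ x (2 ^ n * r)) ≤
      max (C : ℝ) 1 ^ n * m.real (quasiBall ρ x r) := fun n => by
    induction n with
    | zero => simp
    | succ n ih =>
      calc m.real (quasiBall ρ x (2 ^ (n + 1) * r))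
          ≤ C * m.real (quasiBall ρ x (2 ^ (n + 1) * r / 2)) := h1 _ _ (by positivity)
        _ = C * m.real (quasiBall ρ x (2 ^ n * r)) := by congr 3; ring
        _ ≤ max (C : ℝ) 1 * (max (C : ℝ) 1 ^ n * m.real (quasiBall ρ x r)) := by
            gcongr; exact le_max_left _ _
        _ = _ := by ring
  refine le_trans ?_ (h2 n)
  refine measureReal_mono (quasiBall_mono ?_)
  gcongr

theorem IsHomogeneousSpace.real_pos (hI : IsHomogeneousSpace ρ m) (x : I) {r : ℝ} (hr : 0 < r) :
    0 < m.real (quasiBall ρ x r) := by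
  obtain ⟨C, hC⟩ := hI.doubling
  exact ENNReal.toReal_pos (hC x r hr).1.ne' (measure_ne_top m _)

/-- The balls about `x` shrink to the null set `{x}`. Continuity from above is applied to their
interiors, since quasi-balls need not be measurable. -/
theorem IsHomogeneousSpace.exists_real_lt [BorelSpace I] (hI : IsHomogeneousSpace ρ m)
    (hm : ∀ x : I, m {x} = 0) (x : I) {ε : ℝ} (hε : 0 < ε) :
    ∃ r, 0 < r ∧ m.real (quasiBall ρ x r) < ε := by
  set U : ℕ → Set I := fun n => interior (quasiBall ρ x (1 / (n + 1))) with hU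
  have hanti : Antitone U := fun n k h => interior_mono (quasiBall_mono (by gcongr))
  have hxU : ∀ n, U n ∈ 𝓝 x := fun n =>
    interior_mem_nhds.2 ((hI.nhds_basis x).mem_of_mem (by positivity))
  have hinter : ⋂ n, U n = {x} := by
    refine subset_antisymm (fun y hy => ?_) (singleton_subset_iff.2
      (mem_iInter.2 fun n => mem_of_mem_nhds (hxU n)))
    by_contra hne
    have h1 := hI.quasiMetric.pos_of_ne x y fun h => hne h.symm
    obtain ⟨n, hn⟩ := exists_nat_one_div_lt h1
    have h2 : y ∈ quasiBall ρ x (1 / (n + 1)) := interior_subset (mem_iInter.1 hy n)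
    change ρ x y < _ at h2
    exact absurd h2 (by push Not; exact hn.le)
  have ht := tendsto_measure_iInter_atTop (μ := m) (s := U)
    (fun n => isOpen_interior.measurableSet.nullMeasurableSet) hanti ⟨0, measure_ne_top m _⟩
  rw [hinter, hm] at ht
  obtain ⟨n, hn⟩ := (ht.eventually (gt_mem_nhds (ENNReal.ofReal_pos.2 hε))).exists
  obtain ⟨r, hr, hrU⟩ := (hI.nhds_basis x).mem_iff.1 (hxU n)
  refine ⟨r, hr, ?_⟩
  have h3 := (measure_mono hrU).trans_lt hn
  have h4 := (ENNReal.toReal_lt_toReal (measure_ne_top m _) ENNReal.ofReal_ne_top).2 h3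
  rwa [ENNReal.toReal_ofReal hε.le] at h4

theorem IsHomogeneousSpace.measureQuasiMetric_self [BorelSpace I] (hI : IsHomogeneousSpace ρ m)
    (hm : ∀ x : I, m {x} = 0) (x : I) : β x x = 0 := by
  refine le_antisymm (le_of_forall_pos_le_add fun ε hε => ?_) (measureQuasiMetric_nonneg x x)
  obtain ⟨r, hr, h⟩ := hI.exists_real_lt hm x hε
  rw [zero_add]
  exact (measureQuasiMetric_le hr (mem_quasiBall_self hI.quasiMetric x hr)
    (mem_quasiBall_self hI.quasiMetric x hr)).trans h.le

/-- Engulfing: if a ball containing `x, y` and a ball containing `y, w` have radii at most `R`, the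
larger one dilated by `K * (1 + 2 * K)` contains `x` and `w`, and doubling controls its measure. -/
theorem IsHomogeneousSpace.measureQuasiMetric_le_max (hI : IsHomogeneousSpace ρ m) :
    ∃ D : ℝ, 1 ≤ D ∧ ∀ x y w, β x w ≤ D * max (β x y) (β y w) := by
  obtain ⟨K, hK, htri⟩ := hI.quasiMetric.quasi_triangle
  obtain ⟨D, hD, hdoub⟩ := hI.exists_real_le (K * (1 + K * 2))
  have hsymm := hI.quasiMetric.symm
  have main : ∀ {t : ℝ} {x y w z z' : I} {R R' : ℝ}, 0 < R → R' ≤ R → x ∈ quasiBall ρ z R →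
      y ∈ quasiBall ρ z R → y ∈ quasiBall ρ z' R' → w ∈ quasiBall ρ z' R' →
      m.real (quasiBall ρ z R) < t → β x w ≤ D * t := by
    intro t x y w z z' R R' hR hRR hx hy hy' hw ht
    have h1 : quasiBall ρ z R ⊆ quasiBall ρ z (K * (1 + K * 2) * R) :=
      quasiBall_mono (by nlinarith [mul_pos (by linarith : 0 < K) hR])
    have h2 : w ∈ quasiBall ρ z (K * (1 + K * 2) * R) := by
      have a1 : ρ z y < R := hy
      have a2 : ρ y z' < R := by rw [hsymm]; exact lt_of_lt_of_le hy' hRR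
      have a3 : ρ z' w < R := lt_of_lt_of_le hw hRR
      have a4 : ρ y w < K * (2 * R) := (htri y z' w).trans_lt (by gcongr; linarith)
      change ρ z w < _
      calc ρ z w ≤ K * (ρ z y + ρ y w) := htri _ _ _
        _ < K * (R + K * (2 * R)) := by gcongr
        _ = _ := by ring
    calc β x w ≤ m.real (quasiBall ρ z (K * (1 + K * 2) * R)) :=
          measureQuasiMetric_le (by positivity) (h1 hx) h2
      _ ≤ D * m.real (quasiBall ρ z R) := hdoub z R hR
      _ ≤ D * t := by gcongr
  refine ⟨D, hD, fun x y w => ?_⟩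
  have hDpos : 0 < D := by linarith
  rw [← div_le_iff₀' hDpos]
  refine le_of_forall_gt_imp_ge_of_dense fun t ht => ?_
  rw [div_le_iff₀' hDpos]
  obtain ⟨z, R, hR, hx, hy, h1⟩ := exists_quasiBall_of_lt hI.quasiMetric
    ((le_max_left _ _).trans_lt ht)
  obtain ⟨z', R', hR', hy', hw, h2⟩ := exists_quasiBall_of_lt hI.quasiMetric
    ((le_max_right _ _).trans_lt ht)
  rcases le_total R' R with h | h
  · exact main hR h hx hy hy' hw h1
  · rw [measureQuasiMetric_symm]
    exact main hR' h hw hy' hy hx h2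

theorem IsHomogeneousSpace.exists_quasiBall_eq_univ [CompactSpace I]
    (hI : IsHomogeneousSpace ρ m) (x : I) : ∃ R, 0 < R ∧ quasiBall ρ x R = univ := by
  obtain ⟨K, hK, htri⟩ := hI.quasiMetric.quasi_triangle
  obtain ⟨t, -, ht⟩ := isCompact_univ.elim_nhds_subcover (fun y => quasiBall ρ y 1)
    fun y _ => (hI.nhds_basis y).mem_of_mem one_pos
  have hnn : ∀ z, 0 ≤ ρ x z := hI.quasiMetric.nonneg x
  have hS : 0 ≤ ∑ z ∈ t, ρ x z := Finset.sum_nonneg fun z _ => hnn z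
  refine ⟨K * (∑ z ∈ t, ρ x z + 1), by positivity, eq_univ_of_forall fun y => ?_⟩
  obtain ⟨z, hz, hy⟩ := mem_iUnion₂.1 (ht (mem_univ y))
  have h1 : ρ z y < 1 := hy
  have h2 : ρ x z ≤ ∑ z ∈ t, ρ x z := Finset.single_le_sum (fun z _ => hnn z) hz
  change ρ x y < _
  exact (htri x z y).trans_lt (mul_lt_mul_of_pos_left (by linarith) (by linarith))

/-- Every point of the `β`-ball lies in a `ρ`-ball about `x` of measure at most `D * r`; one such
ball of nearly maximal radius, doubled, contains them all. For the lower bound, halve the radius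
from a ball that is the whole space until the measure drops below `r`: by doubling it is still
comparable to `r`, and that ball lies in the `β`-ball. -/
theorem IsHomogeneousSpace.isOneRegular [CompactSpace I] [BorelSpace I]
    (hI : IsHomogeneousSpace ρ m) (hm : ∀ x : I, m {x} = 0) :
    ∃ D, IsOneRegular β m D := by
  obtain ⟨K, hK, htri⟩ := hI.quasiMetric.quasi_triangle
  obtain ⟨D, hD, hdoub⟩ := hI.exists_real_le (K * (1 + K * 2))
  obtain ⟨D₂, hD₂, hdoub₂⟩ := hI.exists_real_le 2
  have hsymm := hI.quasiMetric.symm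
  have hK0 : 0 < K := by linarith
  have hDD : 0 < D₂ * D := by positivity
  refine ⟨D₂ * D, hDD, fun x r hr => ⟨?_, fun hr1 => ?_⟩⟩
  · obtain ⟨R₀, hR₀, hR₀u⟩ := hI.exists_quasiBall_eq_univ x
    set S : Set ℝ := {R | 0 < R ∧ m.real (quasiBall ρ x R) ≤ D * r} with hS
    have hcov : ∀ y ∈ quasiBall β x r, ∃ R ∈ S, y ∈ quasiBall ρ x R := by
      intro y hy
      obtain ⟨z, R, hR, hx, hy, h1⟩ := exists_quasiBall_of_lt hI.quasiMetric hy
      refine ⟨K * 2 * R, ⟨by positivity, ?_⟩, ?_⟩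
      · calc m.real (quasiBall ρ x (K * 2 * R))
            ≤ m.real (quasiBall ρ z (K * (R + K * 2 * R))) :=
              measureReal_mono (quasiBall_subset_of_mem hK htri hx)
          _ = m.real (quasiBall ρ z (K * (1 + K * 2) * R)) := by congr 2; ring
          _ ≤ D * m.real (quasiBall ρ z R) := hdoub z R hR
          _ ≤ D * r := by gcongr
      · have a1 : ρ x z < R := by rw [hsymm]; exact hx
        have a2 : ρ z y < R := hy
        change ρ x y < _
        calc ρ x y ≤ K * (ρ x z + ρ z y) := htri _ _ _
          _ < K * (R + R) := by gcongr
          _ = _ := by ring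
    have hDr : D * r ≤ D₂ * D * r := by
      rw [mul_assoc]; exact le_mul_of_one_le_left (by positivity) hD₂
    have hfin : ∀ R, m.real (quasiBall ρ x R) ≤ D₂ * D * r →
        quasiBall β x r ⊆ quasiBall ρ x R →
        m (quasiBall β x r) ≤ ENNReal.ofReal (D₂ * D * r) := fun R h1 h2 => by
      refine (measure_mono h2).trans ?_
      rw [← ENNReal.ofReal_toReal (measure_ne_top m (quasiBall ρ x R))]
      exact ENNReal.ofReal_le_ofReal h1
    by_cases hbig : ∃ R ∈ S, R₀ ≤ R
    · obtain ⟨R, hRS, hR⟩ := hbig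
      refine hfin R (hRS.2.trans hDr) ?_
      exact (subset_univ _).trans (hR₀u.symm.subset.trans (quasiBall_mono hR))
    · push Not at hbig
      rcases S.eq_empty_or_nonempty with hSe | hSn
      · have : quasiBall β x r = ∅ := by
          refine eq_empty_of_forall_notMem fun y hy => ?_
          obtain ⟨R, hR, -⟩ := hcov y hy
          rw [hSe] at hR
          exact hR
        rw [this, measure_empty]
        exact bot_le
      · have hbdd : BddAbove S := ⟨R₀, fun R hR => (hbig R hR).le⟩
        have hpos : 0 < sSup S := by
          obtain ⟨R, hR⟩ := hSn
          exact lt_of_lt_of_le hR.1 (le_csSup hbdd hR)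
        obtain ⟨R, hRS, hR⟩ := exists_lt_of_lt_csSup hSn (half_lt_self hpos)
        refine hfin (2 * R) ?_ fun y hy => ?_
        · refine (hdoub₂ x R hRS.1).trans ?_
          rw [mul_assoc]
          gcongr
          exact hRS.2
        · obtain ⟨R', hR', hy'⟩ := hcov y hy
          exact quasiBall_mono (by have := le_csSup hbdd hR'; linarith) hy'
  · obtain ⟨R₀, hR₀, hR₀u⟩ := hI.exists_quasiBall_eq_univ x
    have hex : ∃ n : ℕ, m.real (quasiBall ρ x (R₀ / 2 ^ n)) < r := by
      obtain ⟨R, hR, h⟩ := hI.exists_real_lt hm x hr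
      obtain ⟨n, hn⟩ := pow_unbounded_of_one_lt (R₀ / R) one_lt_two
      refine ⟨n, (measureReal_mono (quasiBall_mono ?_)).trans_lt h⟩
      rw [div_le_iff₀ (by positivity)]
      rw [div_lt_iff₀ hR] at hn
      linarith
    classical
    have hn := Nat.find_spec hex
    have hmin : ∀ k, k < Nat.find hex → r ≤ m.real (quasiBall ρ x (R₀ / 2 ^ k)) :=
      fun k hk => not_lt.1 (Nat.find_min hex hk)
    set n := Nat.find hex
    -- At `n = 0` the ball is the whole space, of measure `1 ≥ r`, so at least one halving took
    -- place.
    obtain ⟨k, hk⟩ : ∃ k, n = k + 1 := by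
      rcases h0 : n with _ | k
      · rw [h0, pow_zero, div_one, hR₀u, probReal_univ] at hn
        linarith
      · exact ⟨k, rfl⟩
    have h1 := hmin k (by omega)
    have hR : 0 < R₀ / 2 ^ n := by positivity
    have h2 : r ≤ D₂ * m.real (quasiBall ρ x (R₀ / 2 ^ n)) := by
      refine h1.trans ?_
      have := hdoub₂ x (R₀ / 2 ^ n) hR
      rwa [show 2 * (R₀ / 2 ^ n) = R₀ / 2 ^ k by rw [hk, pow_succ]; field_simp] at this
    have h3 : quasiBall ρ x (R₀ / 2 ^ n) ⊆ quasiBall β x r := fun y hy =>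
      (measureQuasiMetric_le hR (mem_quasiBall_self hI.quasiMetric x hR) hy).trans_lt hn
    calc ENNReal.ofReal r ≤ ENNReal.ofReal (D₂ * m.real (quasiBall ρ x (R₀ / 2 ^ n))) :=
          ENNReal.ofReal_le_ofReal h2
      _ = ENNReal.ofReal D₂ * m (quasiBall ρ x (R₀ / 2 ^ n)) := by
          rw [ENNReal.ofReal_mul (by linarith), measureReal_def,
            ENNReal.ofReal_toReal (measure_ne_top m _)]
      _ ≤ _ := by
          gcongr
          exact le_mul_of_one_le_right (by linarith) hD

theorem IsHomogeneousSpace.nhds_basis_measureQuasiMetric [BorelSpace I]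
    (hI : IsHomogeneousSpace ρ m) (hm : ∀ x : I, m {x} = 0) (x : I) :
    (𝓝 x).HasBasis (fun r : ℝ => 0 < r) (fun r => quasiBall β x r) := by
  obtain ⟨K, hK, htri⟩ := hI.quasiMetric.quasi_triangle
  have hsymm := hI.quasiMetric.symm
  have hK0 : 0 < K := by linarith
  obtain ⟨D, hD, hdoub⟩ := hI.exists_real_le (K * 2)
  refine (hI.nhds_basis x).to_hasBasis (fun r hr => ?_) fun ε hε => ?_
  · have hr' : 0 < r / (K * 2) := by positivity
    have h0 := hI.real_pos x hr'
    refine ⟨m.real (quasiBall ρ x (r / (K * 2))) / D, by positivity, fun y hy => ?_⟩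
    obtain ⟨z, R, hR, hx, hy, h1⟩ := exists_quasiBall_of_lt hI.quasiMetric hy
    rw [lt_div_iff₀ (by linarith)] at h1
    change ρ x y < r
    by_contra! hlt
    have a1 : ρ x z < R := by rw [hsymm]; exact hx
    have a2 : ρ z y < R := hy
    -- A ball containing two points at `ρ`-distance at least `r` has radius at least `r / (2 * K)`.
    -- Its dilate then contains a fixed ball about `x`, so its measure is bounded below.
    have a3 : r / (K * 2) ≤ R := by
      rw [div_le_iff₀ (by positivity)]
      have := htri x z y
      nlinarith
    have a4 : quasiBall ρ x (r / (K * 2)) ⊆ quasiBall ρ z (K * 2 * R) := by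
      refine (quasiBall_mono a3).trans ((quasiBall_subset_of_mem hK htri hx).trans_eq ?_)
      congr 1; ring
    have a5 := (measureReal_mono (μ := m) a4).trans (hdoub z R hR)
    linarith
  · obtain ⟨r, hr, h⟩ := hI.exists_real_lt hm x hε
    exact ⟨r, hr, fun y hy => (measureQuasiMetric_le hr
      (mem_quasiBall_self hI.quasiMetric x hr) hy).trans_lt h⟩

end Homogeneous

/-! ### Nets and nested partitions. -/

section Nets

variable {X : Type*} [PseudoMetricSpace X] [CompactSpace X] [Nonempty X]

/-- A maximal separated set is a net, and compactness makes it finite. It is indexed by `0, ..., M`,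
with an arbitrary value beyond, to suit `SimpleFunc.nearestPtInd`. -/
theorem exists_finite_net {ε : ℝ} (hε : 0 < ε) : ∃ (M : ℕ) (e : ℕ → X),
    (∀ i ≤ M, ∀ j ≤ M, i ≠ j → ε < dist (e i) (e j)) ∧ ∀ x, ∃ i ≤ M, dist (e i) x ≤ ε := by
  lift ε to ℝ≥0 using hε.le
  have hε' : ε / 2 ≠ 0 := by
    have : ε ≠ 0 := by rintro rfl; simp at hε
    positivity
  obtain ⟨T, -, hTf, hT⟩ := Metric.exists_finite_isCover_of_isCompact hε'
    (isCompact_univ (X := X))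
  have hpack : Metric.packingNumber ε (univ : Set X) ≠ ⊤ := by
    have h1 := Metric.packingNumber_two_mul_le_externalCoveringNumber (ε / 2) (univ : Set X)
    have h2 := hT.externalCoveringNumber_le_encard
    rw [show 2 * (ε / 2) = ε by field_simp] at h1
    exact ne_top_of_le_ne_top (by simpa using hTf) (h1.trans h2)
  set s := Metric.maximalSeparatedSet ε (univ : Set X) with hs
  have hsf : s.Finite := by
    rw [← encard_ne_top_iff, hs, Metric.encard_maximalSeparatedSet hpack]
    exact hpack
  have hsep : Metric.IsSeparated ε s := Metric.isSeparated_maximalSeparatedSet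
  have hcov : Metric.IsCover ε univ s := Metric.isCover_maximalSeparatedSet hpack
  have hne : s.Nonempty := hcov.nonempty univ_nonempty
  have hcard : 0 < hsf.toFinset.card := Finset.card_pos.2 (by simpa using hne)
  let φ := hsf.toFinset.equivFin
  let e : ℕ → X := fun i => if h : i < hsf.toFinset.card then (φ.symm ⟨i, h⟩).1 else hne.some
  refine ⟨hsf.toFinset.card - 1, e, fun i hi j hj hij => ?_, fun x => ?_⟩
  · have hi' : i < hsf.toFinset.card := by omega
    have hj' : j < hsf.toFinset.card := by omega
    simp only [e, dif_pos hi', dif_pos hj']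
    have h := hsep (hsf.mem_toFinset.1 (φ.symm ⟨i, hi'⟩).2)
      (hsf.mem_toFinset.1 (φ.symm ⟨j, hj'⟩).2) (fun h => hij (by
        have := φ.symm.injective (Subtype.ext h)
        simpa using this))
    change (ε : ℝ≥0∞) < edist _ _ at h
    rw [edist_dist, ← ENNReal.ofReal_coe_nnreal, ENNReal.ofReal_lt_ofReal_iff'] at h
    exact h.1
  · obtain ⟨y, hy, hxy⟩ := hcov (mem_univ x)
    have hxy' : edist x y ≤ ε := hxy
    have hy' : y ∈ hsf.toFinset := hsf.mem_toFinset.2 hy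
    refine ⟨φ ⟨y, hy'⟩, by have := (φ ⟨y, hy'⟩).2; omega, ?_⟩
    simp only [e, Fin.is_lt, dif_pos, Fin.eta, Equiv.symm_apply_apply]
    rw [edist_dist, ← ENNReal.ofReal_coe_nnreal, ENNReal.ofReal_le_ofReal_iff hε.le] at hxy'
    rwa [dist_comm]

end Nets

section NestedPartition

variable {X : Type*} [PseudoMetricSpace X]

/-- Addresses of a point at level `k`, computed from the nearest points of level `k + d`. -/
def netAddress (ind : ℕ → X → ℕ) (e : ℕ → ℕ → X) : ℕ → ℕ → X → ℕ
  | k, 0, x => ind k x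
  | k, d + 1, x => ind k (e (k + 1) (netAddress ind e (k + 1) d x))

/-- Pigeonhole, which carries the König-type selection of compatible addresses below. -/
theorem exists_frequently_eq_of_le {u : ℕ → ℕ} {M : ℕ} (hu : ∀ d, u d ≤ M) {p : ℕ → Prop}
    (hp : ∃ᶠ d in Filter.atTop, p (u d)) : ∃ j ≤ M, p j ∧ ∃ᶠ d in Filter.atTop, u d = j := by
  by_contra! h
  have h1 : ∀ j ∈ Finset.range (M + 1), ∀ᶠ d in Filter.atTop, ¬ (p (u d) ∧ u d = j) := by
    intro j hj
    by_cases hpj : p j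
    · have := h j (by simpa [Nat.lt_succ_iff] using hj) hpj
      filter_upwards [this] with d hd h'
      exact hd h'.2
    · refine Filter.Eventually.of_forall fun d h' => hpj (h'.2 ▸ h'.1)
  rw [← Filter.eventually_all_finset] at h1
  obtain ⟨d, hd, hd'⟩ := (hp.and_eventually h1).exists
  exact hd' (u d) (by simpa [Nat.lt_succ_iff] using hu d) ⟨hd, rfl⟩

/-- Nested partitions of a compact metric space into Borel sets of comparable inner and outer
radius. -/
theorem exists_nested_partition [CompactSpace X] [Nonempty X] [MeasurableSpace X] [BorelSpace X]
    {δ : ℝ} (hδ : 0 < δ) (hδ1 : δ ≤ 1 / 16) :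
    ∃ (a : ℕ → X → ℕ) (M : ℕ → ℕ) (z : ℕ → ℕ → X), (∀ k x, a k x ≤ M k) ∧
      (∀ k, Measurable (a k)) ∧ (∀ k x y, a (k + 1) x = a (k + 1) y → a k x = a k y) ∧
      (∀ k, ∀ i ≤ M k, ∀ x, dist (z k i) x < δ ^ k / 4 → a k x = i) ∧
      ∀ k x, dist (z k (a k x)) x ≤ 2 * δ ^ k := by
  classical
  choose M e hsep hcov using fun k => exists_finite_net (X := X) (pow_pos hδ k)
  set ind : ℕ → X → ℕ := fun k => SimpleFunc.nearestPtInd (e k) (M k) with hind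
  have hindM : ∀ k x, ind k x ≤ M k := fun k x => SimpleFunc.nearestPtInd_le _ _ _
  have hindm : ∀ k, Measurable (ind k) := fun k => SimpleFunc.measurable _
  have hnear : ∀ k x, ∀ i ≤ M k, dist (e k (ind k x)) x ≤ dist (e k i) x := fun k x i hi => by
    have h := SimpleFunc.edist_nearestPt_le (e k) x hi
    rw [edist_dist, edist_dist, ENNReal.ofReal_le_ofReal_iff dist_nonneg] at h
    exact h
  have hind_dist : ∀ k x, dist (e k (ind k x)) x ≤ δ ^ k := fun k x => by
    obtain ⟨i, hi, h⟩ := hcov k x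
    exact (hnear k x i hi).trans h
  set u := netAddress ind e with hu
  have u0 : ∀ k x, u k 0 x = ind k x := fun k x => by rw [hu, netAddress]
  have us : ∀ k d x, u k (d + 1) x = ind k (e (k + 1) (u (k + 1) d x)) := fun k d x => by
    rw [hu, netAddress]
  have huM : ∀ k d x, u k d x ≤ M k := fun k d x => by
    cases d with
    | zero => rw [u0]; exact hindM _ _
    | succ d => rw [us]; exact hindM _ _
  have hum : ∀ d k, Measurable (u k d) := fun d => by
    induction d with
    | zero =>
      intro k
      rw [show u k 0 = ind k from funext (u0 k)]
      exact hindm k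
    | succ d ih =>
      intro k
      have : u k (d + 1) = (fun j => ind k (e (k + 1) j)) ∘ u (k + 1) d := funext fun x => us k d x
      rw [this]
      exact (measurable_of_countable _).comp (ih (k + 1))
  have hpow : ∀ k, 0 < δ ^ k := fun k => pow_pos hδ k
  have hpow' : ∀ k, δ ^ (k + 1) ≤ δ ^ k / 16 := fun k => by
    rw [pow_succ]; nlinarith [hpow k]
  have hud : ∀ d k x, dist (e k (u k d x)) x ≤ 2 * δ ^ k := fun d => by
    induction d with
    | zero =>
      intro k x
      rw [u0]
      linarith [hind_dist k x, hpow k]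
    | succ d ih =>
      intro k x
      rw [us]
      have h1 := hind_dist k (e (k + 1) (u (k + 1) d x))
      have h2 := ih (k + 1) x
      have h3 := hpow' k
      have h4 := dist_triangle (e k (ind k (e (k + 1) (u (k + 1) d x))))
        (e (k + 1) (u (k + 1) d x)) x
      linarith [hpow k]
  -- Addresses started at a finite depth need not be compatible between levels. Those recurring for
  -- infinitely many depths can be chosen compatibly: a recurrent address has a recurrent child.
  let F : ℕ → ℕ → X → Prop := fun k i x => ∃ᶠ d in Filter.atTop, u k d x = i
  have hFm : ∀ k i, MeasurableSet {x | F k i x} := fun k i => by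
    simp only [F, Filter.frequently_atTop]
    have : {x | ∀ a, ∃ b ≥ a, u k b x = i} = ⋂ a, ⋃ b, ⋃ (_ : a ≤ b), (u k b) ⁻¹' {i} := by
      ext x; simp
    rw [this]
    exact MeasurableSet.iInter fun a => MeasurableSet.iUnion fun b => MeasurableSet.iUnion fun _ =>
      hum b k (measurableSet_singleton i)
  have hF0 : ∀ x, ∃ i ≤ M 0, F 0 i x := fun x => by
    obtain ⟨j, hj, -, h⟩ := exists_frequently_eq_of_le (u := fun d => u 0 d x) (p := fun _ => True)
      (fun d => huM 0 d x) (Filter.Frequently.of_forall fun _ => trivial)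
    exact ⟨j, hj, h⟩
  have hFs : ∀ k i x, F k i x → ∃ j ≤ M (k + 1), ind k (e (k + 1) j) = i ∧ F (k + 1) j x := by
    intro k i x h
    have h' : ∃ᶠ d in Filter.atTop, ind k (e (k + 1) (u (k + 1) d x)) = i := by
      change ∃ᶠ d in Filter.atTop, u k d x = i at h
      rw [Filter.frequently_atTop] at h ⊢
      intro a
      obtain ⟨b, hb, hbi⟩ := h (a + 1)
      obtain ⟨b, rfl⟩ : ∃ b', b = b' + 1 := ⟨b - 1, by omega⟩
      exact ⟨b, by omega, by rw [← us]; exact hbi⟩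
    exact exists_frequently_eq_of_le (u := fun d => u (k + 1) d x)
      (p := fun j => ind k (e (k + 1) j) = i) (fun d => huM (k + 1) d x) h'
  let Good : ℕ → Type _ := fun k => {f : X → ℕ // Measurable f ∧ ∀ x, f x ≤ M k ∧ F k (f x) x}
  have hnext : ∀ k (f : Good k), ∃ g : Good (k + 1), ∀ x, ind k (e (k + 1) (g.1 x)) = f.1 x := by
    intro k f
    have hspec : ∀ x, ind k (e (k + 1) (Nat.findGreatest
        (fun j => ind k (e (k + 1) j) = f.1 x ∧ F (k + 1) j x) (M (k + 1)))) = f.1 x ∧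
        F (k + 1) (Nat.findGreatest
        (fun j => ind k (e (k + 1) j) = f.1 x ∧ F (k + 1) j x) (M (k + 1))) x := fun x => by
      obtain ⟨j, hj, h⟩ := hFs k (f.1 x) x (f.2.2 x).2
      exact Nat.findGreatest_spec (P := fun j => ind k (e (k + 1) j) = f.1 x ∧ F (k + 1) j x) hj h
    -- Taking the greatest admissible index makes the choice measurable.
    refine ⟨⟨fun x => Nat.findGreatest
      (fun j => ind k (e (k + 1) j) = f.1 x ∧ F (k + 1) j x) (M (k + 1)), ?_, fun x =>
      ⟨Nat.findGreatest_le _, (hspec x).2⟩⟩, fun x => (hspec x).1⟩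
    refine measurable_findGreatest fun j _ => ?_
    have : {x | ind k (e (k + 1) j) = f.1 x ∧ F (k + 1) j x} =
        f.1 ⁻¹' {ind k (e (k + 1) j)} ∩ {x | F (k + 1) j x} := by
      ext x; simp [eq_comm]
    rw [this]
    exact (f.2.1 (measurableSet_singleton _)).inter (hFm _ _)
  have hstart : Nonempty (Good 0) := by
    refine ⟨⟨fun x => Nat.findGreatest (fun j => F 0 j x) (M 0), ?_, fun x =>
      ⟨Nat.findGreatest_le _, ?_⟩⟩⟩
    · exact measurable_findGreatest fun j _ => hFm 0 j
    · obtain ⟨j, hj, h⟩ := hF0 x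
      exact Nat.findGreatest_spec (P := fun j => F 0 j x) hj h
  choose next hnext using hnext
  let A : ∀ k, Good k := fun k => Nat.rec hstart.some (fun k f => next k f) k
  have hA : ∀ k x, ind k (e (k + 1) ((A (k + 1)).1 x)) = (A k).1 x := fun k x => hnext k (A k) x
  refine ⟨fun k => (A k).1, M, e, fun k x => ((A k).2.2 x).1, fun k => (A k).2.1,
    fun k x y h => ?_, fun k i hi x hx => ?_, fun k x => ?_⟩
  · beta_reduce at h ⊢
    rw [← hA k x, ← hA k y, h]
  -- The net point of level `k + 1` that labels `x` is within `δ ^ k / 8` of `x`, hence within `3 *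
  -- δ ^ k / 8` of `e k i`. Were another point of level `k` nearest to it, two points of the net
  -- would be closer than `δ ^ k`.
  · by_contra hne
    have h1 := hA k x
    set j := (A (k + 1)).1 x
    obtain ⟨d, hd⟩ := ((A (k + 1)).2.2 x).2.exists
    change u (k + 1) d x = j at hd
    have h2 := hud d (k + 1) x
    rw [hd] at h2
    have h3 := hnear k (e (k + 1) j) i hi
    rw [h1] at h3
    have h4 := hsep k _ ((A k).2.2 x).1 i hi hne
    have h5 := dist_triangle (e k ((A k).1 x)) (e (k + 1) j) (e k i)
    have h6 := dist_triangle (e k i) x (e (k + 1) j)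
    rw [dist_comm (e (k + 1) j) (e k i)] at h5
    rw [dist_comm x] at h6
    have := hpow' k
    linarith [hpow k]
  · obtain ⟨d, hd⟩ := ((A k).2.2 x).2.exists
    have h2 := hud d k x
    rwa [hd] at h2

end NestedPartition

/-! ### Labellings, their grids and the boundary exponent. -/

section Labelling

set_option linter.unusedSectionVars false

variable {I : Type*} [TopologicalSpace I] [MeasurableSpace I]

/-- Nested measurable labellings of the points of a space, such that the points with a given label
of level `k` form a set of measure comparable to `lam ^ k`. -/
structure IsLabelling (m : Measure I) (a : ℕ → I → ℕ) (N : ℕ → ℕ) (lam c C : ℝ) : Prop where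
  lt : ∀ k x, a k x < N k
  measurable : ∀ k, Measurable (a k)
  nested : ∀ k x y, a (k + 1) x = a (k + 1) y → a k x = a k y
  separates : ∀ x, ∀ U ∈ 𝓝 x, ∃ k, ∀ y, a k y = a k x → y ∈ U
  lam_pos : 0 < lam
  lam_lt : lam < 1
  c_pos : 0 < c
  c_le : c ≤ C
  mul_lt : C * lam < c
  size : ∀ k i, i < N k → c * lam ^ k ≤ m.real (a k ⁻¹' {i}) ∧ m.real (a k ⁻¹' {i}) ≤ C * lam ^ k

namespace IsLabelling

variable {m : Measure I} [IsFiniteMeasure m] {a : ℕ → I → ℕ} {N : ℕ → ℕ} {lam c C : ℝ}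

theorem measure_ne_zero (h : IsLabelling m a N lam c C) {k i : ℕ} (hi : i < N k) :
    m (a k ⁻¹' {i}) ≠ 0 := fun h0 => by
  have h1 := (h.size k i hi).1
  rw [measureReal_def, h0, ENNReal.toReal_zero] at h1
  have := mul_pos h.c_pos (pow_pos h.lam_pos k)
  linarith

theorem nonempty (h : IsLabelling m a N lam c C) {k i : ℕ} (hi : i < N k) :
    (a k ⁻¹' {i}).Nonempty := nonempty_of_measure_ne_zero (h.measure_ne_zero hi)

open Classical in
/-- The good grid of the level sets of a labelling. -/
noncomputable def grid [BorelSpace I] (h : IsLabelling m a N lam c C) : GoodGrid m where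
  cells k := (Finset.range (N k)).image fun i => a k ⁻¹' {i}
  measurableSet k Q hQ := by
    obtain ⟨i, -, rfl⟩ := Finset.mem_image.1 hQ
    exact h.measurable k (measurableSet_singleton i)
  measure_pos k Q hQ := by
    obtain ⟨i, hi, rfl⟩ := Finset.mem_image.1 hQ
    exact pos_iff_ne_zero.2 (h.measure_ne_zero (Finset.mem_range.1 hi))
  disjoint k Q hQ W hW hne := by
    obtain ⟨i, -, rfl⟩ := Finset.mem_image.1 hQ
    obtain ⟨j, -, rfl⟩ := Finset.mem_image.1 hW
    have : a k ⁻¹' {i} ∩ a k ⁻¹' {j} = ∅ := by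
      ext x
      simp only [mem_inter_iff, mem_preimage, mem_singleton_iff, mem_empty_iff_false, iff_false]
      rintro ⟨rfl, rfl⟩
      exact hne rfl
    rw [this, measure_empty]
  cover k := by
    have : (⋃ Q ∈ (Finset.range (N k)).image fun i => a k ⁻¹' {i}, Q) = univ := by
      refine eq_univ_of_forall fun x => mem_iUnion₂.2 ⟨a k ⁻¹' {a k x}, ?_, rfl⟩
      exact Finset.mem_image.2 ⟨a k x, Finset.mem_range.2 (h.lt k x), rfl⟩
    rw [this, compl_univ, measure_empty]
  nested k Q hQ := by
    obtain ⟨i, hi, rfl⟩ := Finset.mem_image.1 hQ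
    obtain ⟨x, rfl⟩ := h.nonempty (Finset.mem_range.1 hi)
    refine ⟨a k ⁻¹' {a k x}, Finset.mem_image.2 ⟨a k x, Finset.mem_range.2 (h.lt k x), rfl⟩, ?_⟩
    intro y hy
    exact h.nested k y x hy
  generates := by
    refine le_antisymm (MeasurableSpace.generateFrom_le ?_) ?_
    · rintro Q ⟨k, hQ⟩
      obtain ⟨i, -, rfl⟩ := Finset.mem_image.1 hQ
      exact h.measurable k (measurableSet_singleton i)
    · rw [BorelSpace.measurable_eq (α := I)]
      refine MeasurableSpace.generateFrom_le fun U hU => ?_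
      have hU' : U = ⋃ k, ⋃ i, ⋃ (_ : i < N k ∧ a k ⁻¹' {i} ⊆ U), a k ⁻¹' {i} := by
        refine subset_antisymm (fun x hx => ?_) ?_
        · obtain ⟨k, hk⟩ := h.separates x U (IsOpen.mem_nhds hU hx)
          exact mem_iUnion.2 ⟨k, mem_iUnion.2 ⟨a k x, mem_iUnion.2 ⟨⟨h.lt k x, hk⟩, rfl⟩⟩⟩
        · exact iUnion_subset fun k => iUnion_subset fun i => iUnion_subset fun hi => hi.2
      rw [hU']
      refine MeasurableSet.iUnion fun k => MeasurableSet.iUnion fun i => MeasurableSet.iUnion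
        fun hi => MeasurableSpace.measurableSet_generateFrom ⟨k, ?_⟩
      exact Finset.mem_image.2 ⟨i, Finset.mem_range.2 hi.1, rfl⟩
  ratio := by
    have hc := h.c_pos
    have hC : 0 < C := hc.trans_le h.c_le
    have hl := h.lam_pos
    refine ⟨c * lam / C, C * lam / c, by positivity, ?_, by positivity, ?_, ?_⟩
    · rw [div_lt_one hC]
      nlinarith [h.lam_lt, h.c_le]
    · rw [div_lt_one hc]; exact h.mul_lt
    · intro k P hP Q hQ _
      obtain ⟨i, hi, rfl⟩ := Finset.mem_image.1 hP
      obtain ⟨j, hj, rfl⟩ := Finset.mem_image.1 hQ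
      obtain ⟨h1, h2⟩ := h.size k i (Finset.mem_range.1 hi)
      obtain ⟨h3, h4⟩ := h.size (k + 1) j (Finset.mem_range.1 hj)
      constructor
      · calc c * lam / C * m.real (a k ⁻¹' {i}) ≤ c * lam / C * (C * lam ^ k) := by gcongr
          _ = c * lam ^ (k + 1) := by field_simp; ring
          _ ≤ _ := h3
      · calc m.real (a (k + 1) ⁻¹' {j}) ≤ C * lam ^ (k + 1) := h4
          _ = C * lam / c * (c * lam ^ k) := by field_simp; ring
          _ ≤ _ := by gcongr

theorem mem_grid_iff [BorelSpace I] (h : IsLabelling m a N lam c C) {k : ℕ} {Q : Set I} :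
    Q ∈ h.grid.cells k ↔ ∃ i, i < N k ∧ a k ⁻¹' {i} = Q := by
  simp [grid]

variable {α : I → I → ℝ} {z : ℕ → ℕ → I} {w₀ : ℝ}

/-- The part of a cell that is close to its complement loses a fixed proportion of its measure at
each level, since the central child of each cell is far from the complement. -/
theorem measure_boundary_le (h : IsLabelling m a N lam c C) (hw₀ : 0 < w₀)
    (hz : ∀ k i, i < N k → a k (z k i) = i)
    (hgap : ∀ k i x y, i < N k → a (k + 1) x = a (k + 1) (z k i) → a k y ≠ i →
      w₀ * lam ^ k ≤ α x y) (j : ℕ) : ∀ k i w, i < N k → (∀ l < j, w < w₀ * lam ^ (k + l)) →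
    m {x ∈ a k ⁻¹' {i} | (⨅ y ∈ (a k ⁻¹' {i})ᶜ, ENNReal.ofReal (α x y)) ≤ ENNReal.ofReal w} ≤
      ENNReal.ofReal ((1 - c * lam / C) ^ j * m.real (a k ⁻¹' {i})) := by
  have hC : 0 < C := h.c_pos.trans_le h.c_le
  have hε1 : c * lam / C < 1 := by
    rw [div_lt_one hC]; nlinarith [h.lam_lt, h.c_le, h.c_pos]
  induction j with
  | zero =>
    intro k i w hi _
    rw [pow_zero, one_mul, measureReal_def, ENNReal.ofReal_toReal (measure_ne_top m _)]
    exact measure_mono fun x hx => hx.1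
  | succ j ih =>
    intro k i w hi hw
    set Q := a k ⁻¹' {i} with hQ
    set i₀ := a (k + 1) (z k i) with hi₀
    set R := a (k + 1) ⁻¹' {i₀} with hR
    have hRQ : R ⊆ Q := fun x hx => (h.nested k x (z k i) hx).trans (hz k i hi)
    have hmR : MeasurableSet R := h.measurable _ (measurableSet_singleton _)
    classical
    set T := (Finset.range (N (k + 1))).filter fun i' => a (k + 1) ⁻¹' {i'} ⊆ Q ∧ i' ≠ i₀ with hT
    have hsub : {x ∈ Q | (⨅ y ∈ Qᶜ, ENNReal.ofReal (α x y)) ≤ ENNReal.ofReal w} ⊆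
        ⋃ i' ∈ T, {x ∈ a (k + 1) ⁻¹' {i'} |
          (⨅ y ∈ (a (k + 1) ⁻¹' {i'})ᶜ, ENNReal.ofReal (α x y)) ≤ ENNReal.ofReal w} := by
      rintro x ⟨hxQ, hx⟩
      have hsubQ : a (k + 1) ⁻¹' {a (k + 1) x} ⊆ Q := fun y hy => (h.nested k y x hy).trans hxQ
      have hne : a (k + 1) x ≠ i₀ := by
        intro heq
        have h1 : ENNReal.ofReal (w₀ * lam ^ k) ≤ ⨅ y ∈ Qᶜ, ENNReal.ofReal (α x y) :=
          le_iInf₂ fun y hy => ENNReal.ofReal_le_ofReal (hgap k i x y hi heq hy)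
        have h2 := h1.trans hx
        rw [ENNReal.ofReal_le_ofReal_iff'] at h2
        have h3 := hw 0 (Nat.succ_pos j)
        have h4 := mul_pos hw₀ (pow_pos h.lam_pos k)
        rw [add_zero] at h3
        rcases h2 with h2 | h2 <;> linarith
      refine mem_iUnion₂.2 ⟨a (k + 1) x, Finset.mem_filter.2
        ⟨Finset.mem_range.2 (h.lt _ _), hsubQ, hne⟩, rfl, le_trans ?_ hx⟩
      -- The child has the larger complement, so a point close to the complement of `Q` is also
      -- close to that of the child.
      exact biInf_mono fun y hy => fun hy' => hy (hsubQ hy')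
    have hdisj : (T : Set ℕ).PairwiseDisjoint fun i' => a (k + 1) ⁻¹' {i'} := fun i' _ j' _ hne =>
      Disjoint.preimage _ (by simpa using hne)
    have hsum : ∑ i' ∈ T, m.real (a (k + 1) ⁻¹' {i'}) ≤ m.real Q - m.real R := by
      rw [← measureReal_biUnion_finset hdisj
        (fun i' _ => h.measurable _ (measurableSet_singleton _)),
        ← measureReal_sdiff hRQ hmR]
      refine measureReal_mono (iUnion₂_subset fun i' hi' x hx => ?_)
      obtain ⟨-, h1, h2⟩ := Finset.mem_filter.1 hi'
      exact ⟨h1 hx, fun hxR => h2 (by rw [← (hx : a (k + 1) x = i')]; exact hxR)⟩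
    -- The central child `R` holds at least this proportion of `Q`, and it misses the boundary
    -- layer.
    have hRm : c * lam / C * m.real Q ≤ m.real R := by
      have h1 := (h.size k i hi).2
      have h2 := (h.size (k + 1) i₀ (h.lt _ _)).1
      have hc := h.c_pos
      have hl := h.lam_pos
      calc c * lam / C * m.real Q ≤ c * lam / C * (C * lam ^ k) := by gcongr
        _ = c * lam ^ (k + 1) := by field_simp; ring
        _ ≤ _ := h2
    have hpow : 0 ≤ (1 - c * lam / C) ^ j := pow_nonneg (by linarith) j
    calc m {x ∈ Q | (⨅ y ∈ Qᶜ, ENNReal.ofReal (α x y)) ≤ ENNReal.ofReal w}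
        ≤ ∑ i' ∈ T, m {x ∈ a (k + 1) ⁻¹' {i'} |
          (⨅ y ∈ (a (k + 1) ⁻¹' {i'})ᶜ, ENNReal.ofReal (α x y)) ≤ ENNReal.ofReal w} :=
          (measure_mono hsub).trans (measure_biUnion_finset_le _ _)
      _ ≤ ∑ i' ∈ T, ENNReal.ofReal ((1 - c * lam / C) ^ j * m.real (a (k + 1) ⁻¹' {i'})) := by
          refine Finset.sum_le_sum fun i' hi' => ih (k + 1) i' w
            (Finset.mem_range.1 (Finset.mem_filter.1 hi').1) fun l hl => ?_
          have := hw (l + 1) (by omega)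
          rwa [show k + 1 + l = k + (l + 1) by ring]
      _ = ENNReal.ofReal ((1 - c * lam / C) ^ j * ∑ i' ∈ T, m.real (a (k + 1) ⁻¹' {i'})) := by
          rw [Finset.mul_sum, ENNReal.ofReal_sum_of_nonneg fun i' _ =>
            mul_nonneg hpow measureReal_nonneg]
      _ ≤ _ := by
          refine ENNReal.ofReal_le_ofReal ?_
          rw [pow_succ, mul_assoc]
          refine mul_le_mul_of_nonneg_left ?_ hpow
          linarith

/-- If `lam ^ (n + 1) < t ≤ lam ^ n`, the loss of a factor `κ` can be used `n + 1` times. With `η`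
defined by `lam ^ η = κ`, the result `κ ^ (n + 1)` is at most `t ^ η`. -/
theorem exists_boundary_exponent (h : IsLabelling m a N lam c C) (hw₀ : 0 < w₀)
    (hz : ∀ k i, i < N k → a k (z k i) = i)
    (hgap : ∀ k i x y, i < N k → a (k + 1) x = a (k + 1) (z k i) → a k y ≠ i →
      w₀ * lam ^ k ≤ α x y) : ∃ η : ℝ, 0 < η ∧ ∀ k i, i < N k → ∀ t : ℝ, 0 < t →
    m {x ∈ a k ⁻¹' {i} | (⨅ y ∈ (a k ⁻¹' {i})ᶜ, ENNReal.ofReal (α x y)) ≤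
      ENNReal.ofReal (w₀ / 2 * t * lam ^ k)} ≤ ENNReal.ofReal (1 * t ^ η) * m (a k ⁻¹' {i}) := by
  have hC : 0 < C := h.c_pos.trans_le h.c_le
  have hc := h.c_pos
  have hl := h.lam_pos
  have hε1 : c * lam / C < 1 := by
    rw [div_lt_one hC]; nlinarith [h.lam_lt, h.c_le]
  have hε0 : 0 < c * lam / C := by positivity
  set κ := 1 - c * lam / C with hκ
  have hκ0 : 0 < κ := by linarith
  have hκ1 : κ < 1 := by linarith
  set η := Real.logb lam κ with hη
  have hη0 : 0 < η := Real.logb_pos_of_base_lt_one hl h.lam_lt hκ0 hκ1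
  have hlη : lam ^ η = κ := Real.rpow_logb hl h.lam_lt.ne hκ0
  refine ⟨η, hη0, fun k i hi t ht => ?_⟩
  rw [one_mul]
  have hfin : m (a k ⁻¹' {i}) = ENNReal.ofReal (m.real (a k ⁻¹' {i})) := by
    rw [measureReal_def, ENNReal.ofReal_toReal (measure_ne_top m _)]
  rcases le_or_gt 1 t with ht1 | ht1
  · calc _ ≤ m (a k ⁻¹' {i}) := measure_mono fun x hx => hx.1
      _ = 1 * m (a k ⁻¹' {i}) := (one_mul _).symm
      _ ≤ _ := by
        gcongr
        rw [ENNReal.one_le_ofReal]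
        exact Real.one_le_rpow ht1 hη0.le
  · obtain ⟨n, hn1, hn2⟩ := exists_nat_pow_near_of_lt_one ht ht1.le hl h.lam_lt
    refine (h.measure_boundary_le hw₀ hz hgap (n + 1) k i _ hi fun l hln => ?_).trans ?_
    · have h1 : lam ^ n ≤ lam ^ l := pow_le_pow_of_le_one hl.le h.lam_lt.le (by omega)
      have h2 : t ≤ lam ^ l := hn2.trans h1
      have h3 : 0 < lam ^ k := by positivity
      have h4 : 0 < lam ^ l := by positivity
      calc w₀ / 2 * t * lam ^ k ≤ w₀ / 2 * lam ^ l * lam ^ k := by gcongr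
        _ < w₀ * lam ^ l * lam ^ k := by gcongr; linarith
        _ = _ := by rw [pow_add]; ring
    · rw [hfin, ← ENNReal.ofReal_mul (by positivity)]
      refine ENNReal.ofReal_le_ofReal ?_
      gcongr
      have hpow : κ ^ (n + 1) = (lam ^ (n + 1)) ^ η := by
        conv_lhs => rw [← hlη]
        rw [← Real.rpow_natCast, ← Real.rpow_mul hl.le, mul_comm η, Real.rpow_mul hl.le,
          Real.rpow_natCast]
      refine hpow.le.trans ?_
      exact Real.rpow_le_rpow (by positivity) hn1.le hη0.le

end IsLabelling

end Labelling

/-! ### Existence of grids on homogeneous spaces. -/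

section Existence

/-- A metric equivalent to a power of the measure quasi-metric. -/
theorem IsHomogeneousSpace.exists_metric {I : Type*} [tI : TopologicalSpace I] [MeasurableSpace I]
    [BorelSpace I] {ρ : I → I → ℝ} {m : Measure I} [IsProbabilityMeasure m]
    (hI : IsHomogeneousSpace ρ m) (hm : ∀ x : I, m {x} = 0) :
    ∃ (d : PseudoMetricSpace I) (θ : ℝ), tI = d.toUniformSpace.toTopologicalSpace ∧ 0 < θ ∧
      ∀ x y, d.dist x y ≤ measureQuasiMetric ρ m x y ^ θ ∧
        measureQuasiMetric ρ m x y ^ θ ≤ 2 * d.dist x y := by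
  obtain ⟨D, hD, hmax⟩ := hI.measureQuasiMetric_le_max
  -- Two uses of the quasi-ultrametric inequality give a four-point inequality with constant `D ^
  -- 2`. Enlarging it makes `B > 1` even if `D = 1`, so that `θ` with `B ^ θ = 2` exists; the chain
  -- metric construction requires the constant `2`.
  set B := (D + 1) ^ 2 with hB
  have hB1 : 1 < B := by nlinarith
  set θ := Real.logb B 2 with hθ
  have hθ0 : 0 < θ := Real.logb_pos hB1 one_lt_two
  have hBθ : B ^ θ = 2 := Real.rpow_logb (by linarith) hB1.ne' two_pos
  have hnn : ∀ x y, 0 ≤ measureQuasiMetric ρ m x y := measureQuasiMetric_nonneg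
  let d₀ : I → I → ℝ≥0 := fun x y => ⟨measureQuasiMetric ρ m x y ^ θ, by have := hnn x y; positivity⟩
  have hself : ∀ x, d₀ x x = 0 := fun x => by
    ext
    change measureQuasiMetric ρ m x x ^ θ = 0
    rw [hI.measureQuasiMetric_self hm, Real.zero_rpow hθ0.ne']
  have hcomm : ∀ x y, d₀ x y = d₀ y x := fun x y => by
    ext
    change measureQuasiMetric ρ m x y ^ θ = measureQuasiMetric ρ m y x ^ θ
    rw [measureQuasiMetric_symm]
  have h4 : ∀ x₁ x₂ x₃ x₄, d₀ x₁ x₄ ≤ 2 * max (d₀ x₁ x₂) (max (d₀ x₂ x₃) (d₀ x₃ x₄)) := by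
    intro x₁ x₂ x₃ x₄
    rw [← NNReal.coe_le_coe]
    push_cast
    change measureQuasiMetric ρ m x₁ x₄ ^ θ ≤ 2 * max (measureQuasiMetric ρ m x₁ x₂ ^ θ)
      (max (measureQuasiMetric ρ m x₂ x₃ ^ θ) (measureQuasiMetric ρ m x₃ x₄ ^ θ))
    set M := max (measureQuasiMetric ρ m x₁ x₂)
      (max (measureQuasiMetric ρ m x₂ x₃) (measureQuasiMetric ρ m x₃ x₄)) with hM
    have hM0 : 0 ≤ M := (hnn _ _).trans (le_max_left _ _)
    have h1 : measureQuasiMetric ρ m x₁ x₄ ≤ B * M := by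
      have a1 := hmax x₁ x₂ x₄
      have a2 := hmax x₂ x₃ x₄
      have a3 : max (measureQuasiMetric ρ m x₁ x₂) (measureQuasiMetric ρ m x₂ x₄) ≤ D * M := by
        refine max_le ((le_max_left _ _).trans (le_mul_of_one_le_left hM0 hD)) (a2.trans ?_)
        gcongr
        exact le_max_right _ _
      calc measureQuasiMetric ρ m x₁ x₄ ≤ D * (D * M) := a1.trans (by gcongr)
        _ ≤ B * M := by rw [← mul_assoc]; gcongr; nlinarith
    have h2 : M ^ θ ≤ max (measureQuasiMetric ρ m x₁ x₂ ^ θ)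
        (max (measureQuasiMetric ρ m x₂ x₃ ^ θ) (measureQuasiMetric ρ m x₃ x₄ ^ θ)) := by
      rcases max_choice (measureQuasiMetric ρ m x₁ x₂)
        (max (measureQuasiMetric ρ m x₂ x₃) (measureQuasiMetric ρ m x₃ x₄)) with h | h
      · rw [hM, h]; exact le_max_left _ _
      · rcases max_choice (measureQuasiMetric ρ m x₂ x₃) (measureQuasiMetric ρ m x₃ x₄) with h' | h'
        · rw [hM, h, h']; exact (le_max_left _ _).trans (le_max_right _ _)
        · rw [hM, h, h']; exact (le_max_right _ _).trans (le_max_right _ _)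
    calc measureQuasiMetric ρ m x₁ x₄ ^ θ ≤ (B * M) ^ θ :=
          Real.rpow_le_rpow (hnn _ _) h1 hθ0.le
      _ = 2 * M ^ θ := by rw [Real.mul_rpow (by linarith) hM0, hBθ]
      _ ≤ _ := by gcongr
  let d := PseudoMetricSpace.ofPreNNDist d₀ hself hcomm
  have h1 : ∀ x y, d.dist x y ≤ measureQuasiMetric ρ m x y ^ θ :=
    PseudoMetricSpace.dist_ofPreNNDist_le d₀ hself hcomm
  have h2 : ∀ x y, measureQuasiMetric ρ m x y ^ θ ≤ 2 * d.dist x y :=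
    PseudoMetricSpace.le_two_mul_dist_ofPreNNDist d₀ hself hcomm h4
  refine ⟨d, θ, ?_, hθ0, fun x y => ⟨h1 x y, h2 x y⟩⟩
  refine TopologicalSpace.ext_nhds fun x => ?_
  refine (hI.nhds_basis_measureQuasiMetric hm x).ext (@Metric.nhds_basis_ball I d x) ?_ ?_
  · intro r hr
    refine ⟨r ^ θ / 2, by positivity, fun y hy => ?_⟩
    have hy' : d.dist x y < r ^ θ / 2 := by rw [d.dist_comm]; exact hy
    have h3 : measureQuasiMetric ρ m x y ^ θ < r ^ θ := by linarith [h2 x y]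
    exact (Real.rpow_lt_rpow_iff (hnn _ _) hr.le hθ0).1 h3
  · intro r hr
    refine ⟨r ^ (1 / θ), by positivity, fun y hy => ?_⟩
    have hy' : measureQuasiMetric ρ m x y < r ^ (1 / θ) := hy
    have h3 : measureQuasiMetric ρ m x y ^ θ < r := by
      have := Real.rpow_lt_rpow (hnn _ _) hy' hθ0
      rwa [← Real.rpow_mul hr.le, one_div_mul_cancel hθ0.ne', Real.rpow_one] at this
    change d.dist y x < r
    rw [d.dist_comm]
    exact (h1 x y).trans_lt h3

theorem IsHomogeneousSpace.exists_isHomogeneousGrid {I : Type*} [TopologicalSpace I]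
    [CompactSpace I] [MeasurableSpace I] [BorelSpace I] {ρ : I → I → ℝ} {m : Measure I}
    [IsProbabilityMeasure m] (hI : IsHomogeneousSpace ρ m) (hm : ∀ x : I, m {x} = 0) :
    ∃ (P : GoodGrid m) (η : ℝ), 0 < η ∧ P.IsHomogeneousGrid ρ η := by
  obtain ⟨E, hE, hreg⟩ := hI.isOneRegular hm
  obtain ⟨d, θ, htop, hθ, hd⟩ := hI.exists_metric hm
  subst htop
  have hne : Nonempty I := nonempty_of_isProbabilityMeasure m
  have hnn : ∀ x y, 0 ≤ measureQuasiMetric ρ m x y := measureQuasiMetric_nonneg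
  have hlow : ∀ {r : ℝ} (x y : I), 0 ≤ r → measureQuasiMetric ρ m x y < r → dist x y < r ^ θ :=
    fun {r} x y hr h => (hd x y).1.trans_lt (Real.rpow_lt_rpow (hnn x y) h hθ)
  have hupp : ∀ {r : ℝ} (x y : I), 0 ≤ r → dist x y ≤ r ^ θ / 2 →
      measureQuasiMetric ρ m x y ≤ r := fun {r} x y hr h =>
    (Real.rpow_le_rpow_iff (hnn x y) hr hθ).1 (by have := (hd x y).2; linarith)
  have hpowinv : ∀ {b : ℝ}, 0 ≤ b → (b ^ (1 / θ)) ^ θ = b := fun {b} hb => by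
    rw [← Real.rpow_mul hb, one_div_mul_cancel hθ.ne', Real.rpow_one]
  -- In the metric, with `δ = lam ^ θ`, cells contain balls of radius `δ ^ k / 4` and have diameter
  -- at most `4 * δ ^ k`. The factor `2` in the comparison with `β ^ θ` turns `4` into `8`. Central
  -- children are within `δ ^ k / 8` of the centre, which leaves a gap of `δ ^ k / 8`.
  set c₁ : ℝ := (1 / 4) ^ (1 / θ) with hc₁
  set c₂ : ℝ := 8 ^ (1 / θ) with hc₂
  set w₀ : ℝ := (1 / 8) ^ (1 / θ) with hw₀
  have hc₁0 : 0 < c₁ := by positivity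
  have hc₂0 : 0 < c₂ := by positivity
  have hw₀0 : 0 < w₀ := by positivity
  have hc₁1 : c₁ ≤ 1 := Real.rpow_le_one (by norm_num) (by norm_num) (by positivity)
  set c := c₁ / E with hc
  set C := E * (2 * c₂) + c with hC
  have hc0 : 0 < c := by positivity
  have hC0 : 0 < C := by positivity
  -- The first bound gives `δ ≤ 1 / 32`, for the geometry; the second gives `C * lam < c`, so that a
  -- child is a proper fraction of its parent.
  set lam := min ((1 / 32) ^ (1 / θ)) (c / (2 * C)) with hlam
  have hlam0 : 0 < lam := lt_min (by positivity) (by positivity)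
  have hlamC : C * lam < c := by
    have h1 : lam ≤ c / (2 * C) := min_le_right _ _
    have h2 : C * lam ≤ C * (c / (2 * C)) := by gcongr
    have h3 : C * (c / (2 * C)) = c / 2 := by field_simp
    linarith
  have hcC : c ≤ C := le_add_of_nonneg_left (by positivity)
  have hlam1 : lam < 1 := by
    by_contra! h
    have : C ≤ C * lam := le_mul_of_one_le_right hC0.le h
    linarith
  set δ := lam ^ θ with hδ
  have hδ0 : 0 < δ := by positivity
  have hδ1 : δ ≤ 1 / 32 := by
    have h1 : lam ≤ (1 / 32) ^ (1 / θ) := min_le_left _ _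
    have h2 := Real.rpow_le_rpow hlam0.le h1 hθ.le
    rwa [hpowinv (by norm_num)] at h2
  have hpow : ∀ k : ℕ, (lam ^ k) ^ θ = δ ^ k := fun k => by
    rw [hδ, ← Real.rpow_natCast, ← Real.rpow_natCast, ← Real.rpow_mul hlam0.le,
      ← Real.rpow_mul hlam0.le, mul_comm]
  have hmulpow : ∀ {b : ℝ} (k : ℕ), 0 ≤ b → (b ^ (1 / θ) * lam ^ k) ^ θ = b * δ ^ k :=
    fun {b} k hb => by
      rw [Real.mul_rpow (by positivity) (by positivity), hpowinv hb, hpow]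
  obtain ⟨a, M, z, haM, ham, hnest, hball, hdist⟩ :=
    exists_nested_partition (X := I) hδ0 (hδ1.trans (by norm_num))
  have hz : ∀ k i, i < M k + 1 → a k (z k i) = i := fun k i hi =>
    hball k i (Nat.lt_succ_iff.1 hi) _ (by rw [dist_self]; positivity)
  have hinner : ∀ k i, i < M k + 1 →
      quasiBall (measureQuasiMetric ρ m) (z k i) (c₁ * lam ^ k) ⊆ a k ⁻¹' {i} := by
    intro k i hi x hx
    refine hball k i (Nat.lt_succ_iff.1 hi) x ?_
    have := hlow (z k i) x (by positivity) hx
    rw [hc₁, hmulpow k (by norm_num)] at this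
    linarith
  have hdiam : ∀ k x y, a k x = a k y → measureQuasiMetric ρ m x y ≤ c₂ * lam ^ k := by
    intro k x y hxy
    refine hupp x y (by positivity) ?_
    rw [hc₂, hmulpow k (by norm_num)]
    have h1 := hdist k x
    have h2 := hdist k y
    rw [← hxy] at h2
    have h3 := dist_triangle_left x y (z k (a k x))
    linarith
  have hlab : IsLabelling m a (fun k => M k + 1) lam c C := by
    refine ⟨fun k x => Nat.lt_succ_iff.2 (haM k x), ham, hnest, fun x U hU => ?_, hlam0, hlam1, hc0,
      hcC, hlamC, fun k i hi => ⟨?_, ?_⟩⟩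
    · obtain ⟨ε, hε, hεU⟩ := Metric.mem_nhds_iff.1 hU
      obtain ⟨k, hk⟩ := exists_pow_lt_of_lt_one (show 0 < ε / 4 by positivity)
        (show δ < 1 by linarith)
      refine ⟨k, fun y hy => hεU ?_⟩
      rw [Metric.mem_ball]
      have h1 := hdist k x
      have h2 := hdist k y
      rw [hy] at h2
      have h3 := dist_triangle_left y x (z k (a k x))
      linarith
    · have h1 := (hreg (z k i) (c₁ * lam ^ k) (by positivity)).2
        (mul_le_one₀ hc₁1 (by positivity) (pow_le_one₀ hlam0.le hlam1.le))
      have h2 := ENNReal.toReal_mono (by finiteness)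
        (h1.trans (mul_le_mul_right (measure_mono (hinner k i hi)) _))
      rw [ENNReal.toReal_mul, ENNReal.toReal_ofReal (by positivity),
        ENNReal.toReal_ofReal hE.le] at h2
      rw [hc, div_mul_eq_mul_div, div_le_iff₀ hE, mul_comm _ E]
      exact h2
    · have h1 := (hreg (z k i) (2 * c₂ * lam ^ k) (by positivity)).1
      have h2 : a k ⁻¹' {i} ⊆
          quasiBall (measureQuasiMetric ρ m) (z k i) (2 * c₂ * lam ^ k) := fun x hx => by
        have h3 := hdiam k (z k i) x ((hz k i hi).trans hx.symm)
        have h4 : 0 < c₂ * lam ^ k := by positivity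
        change measureQuasiMetric ρ m _ _ < _
        linarith
      have h3 := ENNReal.toReal_mono (by finiteness) ((measure_mono h2).trans h1)
      rw [ENNReal.toReal_ofReal (by positivity)] at h3
      refine h3.trans ?_
      rw [hC, ← mul_assoc]
      gcongr
      linarith
  have hgap : ∀ k i x y, i < M k + 1 → a (k + 1) x = a (k + 1) (z k i) → a k y ≠ i →
      w₀ * lam ^ k ≤ measureQuasiMetric ρ m x y := by
    intro k i x y hi hx hy
    by_contra! hlt
    have h1 := hlow x y (by positivity) hlt
    rw [hw₀, hmulpow k (by norm_num)] at h1
    refine hy (hball k i (Nat.lt_succ_iff.1 hi) y ?_)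
    have h2 := hdist (k + 1) x
    have h3 := hdist (k + 1) (z k i)
    rw [← hx] at h3
    have h4 := dist_triangle_left (z k i) x (z (k + 1) (a (k + 1) x))
    have h5 := dist_triangle (z k i) x y
    have h6 : δ ^ (k + 1) ≤ δ ^ k / 32 := by
      rw [pow_succ]; nlinarith [pow_pos hδ0 k]
    linarith
  obtain ⟨η, hη, hbdry⟩ := hlab.exists_boundary_exponent hw₀0 hz hgap
  refine ⟨hlab.grid, η, hη, c₁, c₂, w₀ / 2, 1, lam, hc₁0, hc₂0, by positivity, one_pos, hlam0, hlam1,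
    fun k _ Q hQ => ?_⟩
  obtain ⟨i, hi, rfl⟩ := hlab.mem_grid_iff.1 hQ
  exact ⟨⟨z k i, hz k i hi, hinner k i hi⟩,
    fun x hx y hy => hdiam k x y ((hx : a k x = i).trans (hy : a k y = i).symm), hbdry k i hi⟩

end Existence

/-! ### The unit interval and its dyadic grid. -/

namespace unitInterval

theorem volume_preimage_coe_le (s : Set ℝ) :
    volume (((↑) : unitInterval → ℝ) ⁻¹' s) ≤ volume s := by
  rw [volume_apply]
  exact measure_mono (image_preimage_subset _ _)

theorem volume_preimage_coe {s : Set ℝ} (hs : s ⊆ unitInterval) :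
    volume (((↑) : unitInterval → ℝ) ⁻¹' s) = volume s := by
  rw [volume_apply, Subtype.image_preimage_coe, inter_eq_right.2 hs]

theorem volume_quasiBall_dist_le (z : unitInterval) (r : ℝ) :
    volume (quasiBall (fun x y : unitInterval => dist x y) z r) ≤ ENNReal.ofReal (2 * r) := by
  refine (measure_mono fun y hy => ?_).trans
    ((volume_preimage_coe_le (Ioo (z - r : ℝ) (z + r))).trans_eq ?_)
  · have h : |(z : ℝ) - y| < r := hy
    rw [abs_lt] at h
    exact ⟨by linarith, by linarith⟩
  · rw [Real.volume_Ioo]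
    congr 1
    ring

/-- As `r / 2 ≤ 1 / 2`, on at least one side of `z` an interval of length `r / 2` fits into the unit
interval. -/
theorem le_volume_quasiBall_dist (z : unitInterval) {r : ℝ} (hr : 0 < r) (hr1 : r ≤ 1) :
    ENNReal.ofReal (r / 2) ≤ volume (quasiBall (fun x y : unitInterval => dist x y) z r) := by
  have hz0 := z.2.1
  have hz1 := z.2.2
  rcases le_total (z : ℝ) (1 / 2) with hz | hz
  · have hs : Icc (z : ℝ) (z + r / 2) ⊆ unitInterval := fun y hy =>
      ⟨hz0.trans hy.1, by linarith [hy.2]⟩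
    calc ENNReal.ofReal (r / 2) = volume (Icc (z : ℝ) (z + r / 2)) := by
          rw [Real.volume_Icc]; congr 1; ring
      _ = _ := (volume_preimage_coe hs).symm
      _ ≤ _ := measure_mono fun y hy => by
          change |(z : ℝ) - y| < r
          rw [abs_lt]
          constructor <;> linarith [hy.1, hy.2]
  · have hs : Icc (z - r / 2 : ℝ) z ⊆ unitInterval := fun y hy =>
      ⟨by linarith [hy.1], hy.2.trans hz1⟩
    calc ENNReal.ofReal (r / 2) = volume (Icc (z - r / 2 : ℝ) z) := by
          rw [Real.volume_Icc]; congr 1; ring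
      _ = _ := (volume_preimage_coe hs).symm
      _ ≤ _ := measure_mono fun y hy => by
          change |(z : ℝ) - y| < r
          rw [abs_lt]
          constructor <;> linarith [hy.1, hy.2]

/-- The measure quasi-metric of the unit interval is its usual metric. -/
theorem measureQuasiMetric_eq :
    measureQuasiMetric (fun x y : unitInterval => dist x y) volume =
      fun x y : unitInterval => dist x y := by
  funext x y
  have hmid : ((x : ℝ) + y) / 2 ∈ unitInterval :=
    ⟨by linarith [x.2.1, y.2.1], by linarith [x.2.2, y.2.2]⟩
  have hmem : ∀ ε : ℝ, 0 < ε → ∀ w : unitInterval, w = x ∨ w = y →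
      w ∈ quasiBall (fun x y : unitInterval => dist x y) ⟨_, hmid⟩ (dist x y / 2 + ε) := by
    intro ε hε w hw
    change |((x : ℝ) + y) / 2 - w| < |(x : ℝ) - y| / 2 + ε
    have h1 := le_abs_self ((x : ℝ) - y)
    have h2 := neg_abs_le ((x : ℝ) - y)
    rw [abs_lt]
    rcases hw with rfl | rfl <;> constructor <;> linarith
  have hd : 0 ≤ dist x y := dist_nonneg
  refine le_antisymm (le_of_forall_pos_le_add fun ε hε => ?_) (le_csInf ?_ ?_)
  · calc measureQuasiMetric (fun x y : unitInterval => dist x y) volume x y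
        ≤ volume.real (quasiBall (fun x y : unitInterval => dist x y) ⟨_, hmid⟩
          (dist x y / 2 + ε / 2)) := by
          refine csInf_le ⟨0, ?_⟩ ⟨⟨_, hmid⟩, dist x y / 2 + ε / 2, by positivity,
            hmem _ (half_pos hε) x (Or.inl rfl), hmem _ (half_pos hε) y (Or.inr rfl), rfl⟩
          rintro _ ⟨z, r, -, -, -, rfl⟩
          exact measureReal_nonneg
      _ ≤ dist x y + ε := by
          refine ENNReal.toReal_le_of_le_ofReal (by positivity)
            ((volume_quasiBall_dist_le _ _).trans_eq ?_)
          congr 1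
          ring
  · exact ⟨_, ⟨_, hmid⟩, _, by positivity, hmem 1 one_pos x (Or.inl rfl),
      hmem 1 one_pos y (Or.inr rfl), rfl⟩
  · rintro _ ⟨z, r, hr, hx, hy, rfl⟩
    -- Balls are convex, so a ball containing both points has at least the length of the interval
    -- between them. The balls about the midpoint show that this is sharp.
    have hsub : uIcc x y ⊆ quasiBall (fun x y : unitInterval => dist x y) z r := by
      intro w hw
      have hx' : |(z : ℝ) - x| < r := hx
      have hy' : |(z : ℝ) - y| < r := hy
      change |(z : ℝ) - w| < r
      rw [abs_lt] at hx' hy' ⊢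
      rcases mem_uIcc.1 hw with ⟨h1, h2⟩ | ⟨h1, h2⟩ <;>
      · have h1' := Subtype.coe_le_coe.2 h1
        have h2' := Subtype.coe_le_coe.2 h2
        constructor <;> linarith
    have h := measureReal_mono (μ := (volume : Measure unitInterval)) hsub
    rwa [measureReal_def, volume_uIcc, edist_dist, ENNReal.toReal_ofReal dist_nonneg,
      dist_comm] at h

theorem isOneRegular :
    IsOneRegular (fun x y : unitInterval => dist x y) (volume : Measure unitInterval) 2 := by
  refine ⟨two_pos, fun x r hr => ⟨volume_quasiBall_dist_le x r, fun hr1 => ?_⟩⟩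
  calc ENNReal.ofReal r = ENNReal.ofReal 2 * ENNReal.ofReal (r / 2) := by
        rw [← ENNReal.ofReal_mul two_pos.le]; congr 1; ring
    _ ≤ _ := by gcongr; exact le_volume_quasiBall_dist x hr hr1

/-- The index of the dyadic interval of level `k` that contains a point. -/
noncomputable def dyadicIndex (k : ℕ) (x : unitInterval) : ℕ :=
  -- The minimum puts the endpoint `1` into the last interval.
  min ⌊(2 : ℝ) ^ k * x⌋₊ (2 ^ k - 1)

theorem dyadicIndex_succ (k : ℕ) (x : unitInterval) :
    dyadicIndex k x = dyadicIndex (k + 1) x / 2 := by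
  have h : ⌊(2 : ℝ) ^ k * x⌋₊ = ⌊(2 : ℝ) ^ (k + 1) * x⌋₊ / 2 := by
    rw [← Nat.floor_div_ofNat]
    congr 1
    rw [pow_succ]
    change _ = _ / (2 : ℝ)
    ring
  have h2 : 0 < 2 ^ k := by positivity
  rw [dyadicIndex, dyadicIndex, h, pow_succ]
  omega

theorem dyadicIndex_lt (k : ℕ) (x : unitInterval) : dyadicIndex k x < 2 ^ k := by
  have h2 : 0 < 2 ^ k := by positivity
  rw [dyadicIndex]
  omega

theorem mem_Icc_of_dyadicIndex_eq {k i : ℕ} {x : unitInterval} (h : dyadicIndex k x = i) :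
    (x : ℝ) ∈ Icc (i * (1 / 2 : ℝ) ^ k) ((i + 1) * (1 / 2 : ℝ) ^ k) := by
  have hu : (0 : ℝ) < 2 ^ k := by positivity
  have h0 : 0 ≤ (2 : ℝ) ^ k * x := mul_nonneg hu.le x.2.1
  rw [one_div, inv_pow, ← div_eq_mul_inv, ← div_eq_mul_inv, mem_Icc, div_le_iff₀ hu,
    le_div_iff₀ hu, mul_comm (x : ℝ)]
  constructor
  · refine le_trans ?_ (Nat.floor_le h0)
    have h1 : i ≤ ⌊(2 : ℝ) ^ k * x⌋₊ := h.symm.le.trans (min_le_left _ _)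
    exact_mod_cast h1
  · rcases min_choice ⌊(2 : ℝ) ^ k * x⌋₊ (2 ^ k - 1) with h1 | h1
    · rw [← h, dyadicIndex, h1]
      exact (Nat.lt_floor_add_one _).le
    · have h2 : i + 1 = 2 ^ k := by
        have h2 : 0 < 2 ^ k := by positivity
        rw [← h, dyadicIndex, h1]
        omega
      have h3 : (i + 1 : ℝ) = 2 ^ k := by exact_mod_cast h2
      rw [h3]
      exact mul_le_of_le_one_right hu.le x.2.2

theorem dyadicIndex_eq {k i : ℕ} (hi : i < 2 ^ k) {x : unitInterval}
    (hx : (x : ℝ) ∈ Ico (i * (1 / 2 : ℝ) ^ k) ((i + 1) * (1 / 2 : ℝ) ^ k)) :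
    dyadicIndex k x = i := by
  have hu : (0 : ℝ) < 2 ^ k := by positivity
  have h0 : 0 ≤ (2 : ℝ) ^ k * x := mul_nonneg hu.le x.2.1
  rw [one_div, inv_pow, ← div_eq_mul_inv, ← div_eq_mul_inv, mem_Ico, div_le_iff₀ hu,
    lt_div_iff₀ hu, mul_comm (x : ℝ)] at hx
  have h : ⌊(2 : ℝ) ^ k * x⌋₊ = i := (Nat.floor_eq_iff h0).2 hx
  rw [dyadicIndex, h]
  omega

theorem dyadic_subset {k i : ℕ} (hi : i < 2 ^ k) :
    Icc (i * (1 / 2 : ℝ) ^ k) ((i + 1) * (1 / 2 : ℝ) ^ k) ⊆ unitInterval := by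
  intro x hx
  have h : (i + 1 : ℝ) ≤ 2 ^ k := by exact_mod_cast hi
  refine ⟨le_trans (by positivity) hx.1, hx.2.trans ?_⟩
  rw [one_div, inv_pow, ← div_eq_mul_inv]
  exact div_le_one_of_le₀ h (by positivity)

theorem volume_dyadicIndex {k i : ℕ} (hi : i < 2 ^ k) :
    volume (dyadicIndex k ⁻¹' {i}) = ENNReal.ofReal ((1 / 2) ^ k) := by
  refine le_antisymm ?_ ?_
  · refine (measure_mono fun x hx => mem_Icc_of_dyadicIndex_eq hx).trans
      ((volume_preimage_coe_le (Icc (i * (1 / 2 : ℝ) ^ k) ((i + 1) * (1 / 2 : ℝ) ^ k))).trans_eq ?_)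
    rw [Real.volume_Icc]
    congr 1
    ring
  · calc ENNReal.ofReal ((1 / 2) ^ k)
        = volume (Ico (i * (1 / 2 : ℝ) ^ k) ((i + 1) * (1 / 2 : ℝ) ^ k)) := by
          rw [Real.volume_Ico]; congr 1; ring
      _ = _ := (volume_preimage_coe (Ico_subset_Icc_self.trans (dyadic_subset hi))).symm
      _ ≤ _ := measure_mono fun x hx => dyadicIndex_eq hi hx

theorem dist_le_of_dyadicIndex_eq {k : ℕ} {x y : unitInterval}
    (h : dyadicIndex k x = dyadicIndex k y) : dist x y ≤ (1 / 2) ^ k := by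
  have h1 := mem_Icc_of_dyadicIndex_eq h
  have h2 := mem_Icc_of_dyadicIndex_eq (k := k) (x := y) rfl
  change |(x : ℝ) - y| ≤ _
  rw [add_mul, one_mul] at h1 h2
  rw [abs_le]
  constructor <;> linarith [h1.1, h1.2, h2.1, h2.2]

theorem isLabelling_dyadicIndex :
    IsLabelling (volume : Measure unitInterval) dyadicIndex (fun k => 2 ^ k) (1 / 2) 1 1 where
  lt := dyadicIndex_lt
  measurable k := by
    have h : Measurable fun x : unitInterval => ⌊(2 : ℝ) ^ k * x⌋₊ :=
      Nat.measurable_floor.comp (measurable_subtype_coe.const_mul _)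
    exact h.min measurable_const
  nested k x y h := by rw [dyadicIndex_succ, h, ← dyadicIndex_succ]
  separates x U hU := by
    obtain ⟨ε, hε, hεU⟩ := Metric.mem_nhds_iff.1 hU
    obtain ⟨k, hk⟩ := exists_pow_lt_of_lt_one hε (one_half_lt_one (α := ℝ))
    exact ⟨k, fun y hy => hεU ((dist_le_of_dyadicIndex_eq hy).trans_lt hk)⟩
  lam_pos := by norm_num
  lam_lt := by norm_num
  c_pos := one_pos
  c_le := le_rfl
  mul_lt := by norm_num
  size k i hi := by
    rw [measureReal_def, volume_dyadicIndex hi, ENNReal.toReal_ofReal (by positivity), one_mul]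
    exact ⟨le_rfl, le_rfl⟩

/-- A point within `w` of the complement is within `w` of one of the two endpoints. -/
theorem volume_dyadic_boundary_le {k i : ℕ} (hi : i < 2 ^ k) {w : ℝ} (hw : 0 < w) :
    volume {x ∈ dyadicIndex k ⁻¹' {i} | (⨅ y ∈ (dyadicIndex k ⁻¹' {i})ᶜ,
      ENNReal.ofReal (dist x y)) ≤ ENNReal.ofReal w} ≤ ENNReal.ofReal (2 * w) := by
  set l := i * (1 / 2 : ℝ) ^ k with hl
  set r := (i + 1) * (1 / 2 : ℝ) ^ k with hr
  have hsub : {x ∈ dyadicIndex k ⁻¹' {i} | (⨅ y ∈ (dyadicIndex k ⁻¹' {i})ᶜ,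
      ENNReal.ofReal (dist x y)) ≤ ENNReal.ofReal w} ⊆
      ((↑) : unitInterval → ℝ) ⁻¹' (Icc l (l + w) ∪ Icc (r - w) r) := by
    rintro x ⟨hxQ, hx⟩
    obtain ⟨h1, h2⟩ := mem_Icc_of_dyadicIndex_eq hxQ
    by_contra hcon
    have h3 : l + w < x := by
      by_contra h; exact hcon (Or.inl ⟨h1, not_lt.1 h⟩)
    have h4 : x < r - w := by
      by_contra h; exact hcon (Or.inr ⟨not_lt.1 h, h2⟩)
    have h5 : ENNReal.ofReal (min (x - l) (r - x)) ≤ ⨅ y ∈ (dyadicIndex k ⁻¹' {i})ᶜ,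
        ENNReal.ofReal (dist x y) := by
      refine le_iInf₂ fun y hy => ENNReal.ofReal_le_ofReal ?_
      change _ ≤ |(x : ℝ) - y|
      rcases lt_or_ge (y : ℝ) l with hyl | hyl
      · exact (min_le_left _ _).trans ((by linarith : (x : ℝ) - l ≤ x - y).trans (le_abs_self _))
      · have hyr : r ≤ y := by
          by_contra h; exact hy (dyadicIndex_eq hi ⟨hyl, not_le.1 h⟩)
        exact (min_le_right _ _).trans
          ((by linarith : r - (x : ℝ) ≤ -(x - y)).trans (neg_le_abs _))
    have h6 := (ENNReal.ofReal_le_ofReal_iff hw.le).1 (h5.trans hx)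
    have h7 : w < min (x - l) (r - x) := lt_min (by linarith) (by linarith)
    linarith
  calc _ ≤ volume (Icc l (l + w) ∪ Icc (r - w) r) :=
        (measure_mono hsub).trans (volume_preimage_coe_le _)
    _ ≤ volume (Icc l (l + w)) + volume (Icc (r - w) r) := measure_union_le _ _
    _ = _ := by
        rw [Real.volume_Icc, Real.volume_Icc, ← ENNReal.ofReal_add (by linarith) (by linarith)]
        congr 1
        ring

/-- The dyadic intervals are a grid of the unit interval with boundary exponent one. -/
theorem isHomogeneousGrid_dyadic :
    isLabelling_dyadicIndex.grid.IsHomogeneousGrid (fun x y : unitInterval => dist x y) 1 := by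
  rw [GoodGrid.IsHomogeneousGrid, measureQuasiMetric_eq]
  refine ⟨1 / 2, 1, 1, 2, 1 / 2, by norm_num, one_pos, one_pos, two_pos, by norm_num, by norm_num,
    fun k _ Q hQ => ?_⟩
  obtain ⟨i, hi, rfl⟩ := isLabelling_dyadicIndex.mem_grid_iff.1 hQ
  have hu : (0 : ℝ) < (1 / 2) ^ k := by positivity
  refine ⟨?_, fun x hx y hy => ?_, fun t ht => ?_⟩
  · have hz : (i + 1 / 2 : ℝ) * (1 / 2) ^ k ∈ unitInterval :=
      dyadic_subset hi ⟨by gcongr; norm_num, by gcongr; norm_num⟩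
    have hball : quasiBall (fun x y : unitInterval => dist x y) ⟨_, hz⟩ (1 / 2 * (1 / 2) ^ k) ⊆
        dyadicIndex k ⁻¹' {i} := by
      intro y hy
      have h : |(i + 1 / 2 : ℝ) * (1 / 2) ^ k - y| < 1 / 2 * (1 / 2) ^ k := hy
      rw [abs_lt] at h
      exact dyadicIndex_eq hi ⟨by linarith, by linarith⟩
    refine ⟨⟨_, hz⟩, hball ?_, hball⟩
    change dist _ _ < _
    rw [dist_self]
    positivity
  · rw [one_mul]
    exact dist_le_of_dyadicIndex_eq (hx.trans hy.symm)
  · refine (volume_dyadic_boundary_le hi (by positivity)).trans_eq ?_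
    rw [volume_dyadicIndex hi, ← ENNReal.ofReal_mul (by positivity), Real.rpow_one]
    congr 1
    ring

end unitInterval

theorem mainTheorem9 {I : Type*} [TopologicalSpace I] [CompactSpace I] [MeasurableSpace I]
    [BorelSpace I] (ρ : I → I → ℝ) (m : Measure I) [IsProbabilityMeasure m]
    (hI : IsHomogeneousSpace ρ m) (hm : ∀ x : I, m {x} = 0) :
    (∃ (P : GoodGrid m) (η : ℝ), 0 < η ∧ P.IsHomogeneousGrid ρ η) ∧
    (∃ G : GoodGrid (volume : Measure unitInterval),
      G.IsHomogeneousGrid (fun x y : unitInterval => dist x y) 1) ∧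
    ∀ (p q : ℝ≥0∞) [Fact (1 ≤ p)] [Fact (1 ≤ q)], p ≠ ∞ →
      ∀ s : ℝ, 0 < s → s < 1 / p.toReal →
      ∀ (P : GoodGrid m) (η : ℝ), s * p.toReal < η → P.IsHomogeneousGrid ρ η →
      ∀ (G : GoodGrid (volume : Measure unitInterval)) (η' : ℝ), s * p.toReal < η' →
        G.IsHomogeneousGrid (fun x y : unitInterval => dist x y) η' →
        ∃ (T : P.besov s p q ≃ₗ[ℂ] G.besov s p q) (C : ℝ), 0 < C ∧
          ∀ f : P.besov s p q,
            G.besovNorm s p q (T f) ≤ C * P.besovNorm s p q f ∧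
            P.besovNorm s p q f ≤ C * G.besovNorm s p q (T f) := by
  refine ⟨hI.exists_isHomogeneousGrid hm, ⟨_, unitInterval.isHomogeneousGrid_dyadic⟩, ?_⟩
  intro p q _ _ hp s hs _ P η _ hP G η' _ hG
  obtain ⟨D, hD⟩ := hI.isOneRegular hm
  obtain ⟨lam, A, hlam, hlam1, hA, hPA⟩ := hD.hasSize P hP
  -- Regularity of the usual distance now gives the size of the cells of `G`, as that of `β` did for
  -- `P`.
  rw [GoodGrid.IsHomogeneousGrid, unitInterval.measureQuasiMetric_eq] at hG
  obtain ⟨lam', A', hlam', hlam1', hA', hGA⟩ := unitInterval.isOneRegular.hasSize G hG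
  exact P.exists_linearEquiv_besov G hp hlam hlam1 hA hPA hlam' hlam1' hA' hGA hs
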